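/- Let $H$ be a complex Hilbert space, $\omega>0$, and let $L^2=L^2([0,\omega],H)$ carry the inner product $\langle x,y\rangle=\frac1\omega\int_0^\omega\langle x(s),y(s)\rangle_H\,ds$. Let $\mathcal V:[0,\omega]\to B(H)$ be such that for each $x\in H$ the function $s\mapsto\mathcal V(s)x$ is strongly measurable and belongs to $L^2$, and let $\widehat{\mathcal V}(n)\in B(H)$, $n\in\mathbb Z$, be its Fourier coefficients, $$\widehat{\mathcal V}(n)x=\frac1\omega\int_0^\omega \mathcal V(s)x\,e^{-i\frac{2\pi n}{\omega}s}\,ds,\qquad x\in H.$$ Assume that $$\sum_{n\in\mathbb Z}\|\widehat{\mathcal V}(n)\|^2<\infty\qquad\text{and}\qquad \sum_{j,\ell\in\mathbb Z}\Big\|\sum_{n\neq \ell}\frac{\widehat{\mathcal V}(j+n)\widehat{\mathcal V}(\ell+n)}{\ell-n}\Big\|^2<\infty .$$ Let $W_2^1$ be the Sobolev space of (absolutely) continuous functions $y:[0,\omega]\to H$ with derivative $y'\in L^2$, and let $L$ be the operator in $L^2$ given by $$(Ly)(s)=y'(s)-\mathcal V(s)\,y(\omega-s),\qquad D(L)=\{y\in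 W_2^1:\ y(0)=y(\omega)\};$$ it is well defined, that is, $s\mapsto\mathcal V(s)y(\omega-s)$ belongs to $L^2$ for every $y\in D(L)$. Then $L$ is the infinitesimal generator of a unique strongly continuous group $T:\mathbb R\to B(L^2)$, and the spectral bound of $L$ and the growth bound of $T$ coincide: $$\sup\{\operatorname{Re}\lambda:\ \lambda\in\sigma(L)\}=\inf\{a\in\mathbb R:\ \exists M\ \forall t\ge 0\ \ \|T(t)\|\le M e^{at}\}.$$ The same holds for the backward semigroup: the spectral bound of $-L$ coincides with the growth bound of $t\mapsto T(-t)$, $t\ge0$. (Both bounds are taken in $[-\infty,\infty]$, with $\sup\emptyset=-\infty$.) -/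

import Mathlib

open MeasureTheory Filter Topology Set

noncomputable section

namespace MixedProblem

/-! ### Strongly continuous groups, generators, spectral and growth bounds -/

section Abstract

variable {X : Type*} [NormedAddCommGroup X] [NormedSpace ℂ X]

/-- `T : ℝ → B(X)` is a strongly continuous (`C₀`-) group of bounded operators. -/
structure IsC0Group (T : ℝ → X →L[ℂ] X) : Prop where
  zero : T 0 = 1
  add : ∀ s t : ℝ, T (s + t) = T s * T t
  cont : ∀ x : X, Continuous fun t : ℝ => T t x

/-- The (possibly unbounded) operator `A` is the infinitesimal generator of `T`:
`x ∈ D(A)` and `A x = z` if and only if `(T(t) x - x) / t → z` as `t → 0`. -/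
def IsGenerator (T : ℝ → X →L[ℂ] X) (A : X →ₗ.[ℂ] X) : Prop :=
  ∀ x z : X, (x, z) ∈ A.graph ↔
    Tendsto (fun t : ℝ => ((t : ℂ)⁻¹) • (T t x - x)) (𝓝[≠] 0) (𝓝 z)

/-- The resolvent set: `z - A : D(A) → X` is a bijection with bounded inverse `R`. -/
def resolventSet (A : X →ₗ.[ℂ] X) : Set ℂ :=
  {z | ∃ R : X →L[ℂ] X,
    (∀ x : X, ∃ h : R x ∈ A.domain, z • R x - A ⟨R x, h⟩ = x) ∧
    ∀ y : A.domain, R (z • (y : X) - A y) = y}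

/-- The spectrum of a (possibly unbounded) operator. -/
def spectrum (A : X →ₗ.[ℂ] X) : Set ℂ := (resolventSet A)ᶜ

/-- The spectral bound `s(A) = sup {Re z : z ∈ σ(A)}`, in `[-∞, ∞]` (`-∞` if `σ(A)` is empty). -/
def spectralBound (A : X →ₗ.[ℂ] X) : EReal :=
  sSup ((fun z : ℂ => ((z.re : ℝ) : EReal)) '' spectrum A)

/-- The growth bound
`inf {a ∈ ℝ : there is M with ‖T(t)‖ ≤ M e^{a t} for all t ≥ 0}`, in `[-∞, ∞]`. -/
def growthBound (T : ℝ → X →L[ℂ] X) : EReal :=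
  sInf ((fun a : ℝ => (a : EReal)) ''
    {a : ℝ | ∃ M : ℝ, ∀ t : ℝ, 0 ≤ t → ‖T t‖ ≤ M * Real.exp (a * t)})

end Abstract

/-! ### The space `L²([0, ω], H)` and the operators `L₀`, `V` and `L` -/

/-- Normalized Lebesgue measure `ds / ω` on `[0, ω]`. -/
def mu (ω : ℝ) : Measure ℝ := ENNReal.ofReal ω⁻¹ • volume.restrict (Icc 0 ω)

instance (ω : ℝ) : IsFiniteMeasure (mu ω) := 
  Measure.smul_finite _ ENNReal.ofReal_ne_top

variable {H : Type*} [NormedAddCommGroup H] [InnerProductSpace ℂ H]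

/-- `L²([0, ω], H)`, with inner product `⟨x, y⟩ = (1/ω) ∫₀^ω ⟨x(s), y(s)⟩ ds`. -/
abbrev L2 (ω : ℝ) (H : Type*) [NormedAddCommGroup H] [InnerProductSpace ℂ H] : Type _ :=
  Lp H 2 (mu ω)

/-- `f` is the continuous representative on `[0, ω]` of a function `y` in the Sobolev space
`W¹₂([0, ω], H)`, and `g ∈ L²` is the derivative of `y`: `f` is the absolutely continuous function
`f(s) = f(0) + ∫₀ˢ g`. -/
def IsSobolevRep (ω : ℝ) (f : ℝ → H) (y g : L2 ω H) : Prop :=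
  y =ᵐ[mu ω] f ∧ ∀ s ∈ Icc 0 ω, f s = f 0 + ∫ τ in (0 : ℝ)..s, g τ

lemma mu_ac (ω : ℝ) : mu ω ≪ volume.restrict (Icc 0 ω) :=
  Measure.smul_absolutelyContinuous

lemma ae_mu_iff {ω : ℝ} (hω : 0 < ω) {p : ℝ → Prop} :
    (∀ᵐ s ∂(mu ω), p s) ↔ ∀ᵐ s ∂(volume.restrict (Icc 0 ω)), p s := by
  have h : ENNReal.ofReal ω⁻¹ ≠ 0 := by simpa using hω
  simp only [mu, ae_iff, Measure.smul_apply, smul_eq_mul, mul_eq_zero, h, false_or]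

lemma intervalIntegrable_L2 {ω : ℝ} (hω : 0 < ω) (g : L2 ω H) {s : ℝ} (hs : s ∈ Icc 0 ω) :
    IntervalIntegrable g volume 0 s := by
  have h1 : Integrable g (mu ω) := (Lp.memLp g).integrable (by norm_num)
  have h : ENNReal.ofReal ω⁻¹ ≠ 0 := by simpa using hω
  have h2 : IntegrableOn g (Icc 0 ω) volume :=
    (integrable_smul_measure h ENNReal.ofReal_ne_top).1 h1
  rw [intervalIntegrable_iff_integrableOn_Icc_of_le hs.1]
  exact h2.mono_set (Icc_subset_Icc_right hs.2)

/-- The graph of `L₀ = d/ds` with periodic boundary conditions: all pairs `(y, y')` with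
`y ∈ W¹₂([0, ω], H)` and `y(0) = y(ω)`. -/
def derivGraph (ω : ℝ) (hω : 0 < ω) (H : Type*) [NormedAddCommGroup H] [InnerProductSpace ℂ H] :
    Submodule ℂ (L2 ω H × L2 ω H) where
  carrier := {p | ∃ f : ℝ → H, IsSobolevRep ω f p.1 p.2 ∧ f 0 = f ω}
  zero_mem' := by
    refine ⟨0, ⟨Lp.coeFn_zero _ _ _, fun s hs => ?_⟩, rfl⟩
    have h0 : ∀ᵐ t ∂(volume.restrict (Icc 0 ω)), (0 : L2 ω H) t = 0 :=
      (ae_mu_iff hω).1 (Lp.coeFn_zero _ _ _)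
    rw [intervalIntegral.integral_of_le hs.1, integral_eq_zero_of_ae]
    · simp
    · exact ae_restrict_of_ae_restrict_of_subset
        (Ioc_subset_Icc_self.trans (Icc_subset_Icc_right hs.2)) h0
  add_mem' := by
    rintro ⟨y₁, g₁⟩ ⟨y₂, g₂⟩ ⟨f₁, ⟨h₁, k₁⟩, b₁⟩ ⟨f₂, ⟨h₂, k₂⟩, b₂⟩
    refine ⟨f₁ + f₂, ⟨(Lp.coeFn_add y₁ y₂).trans (h₁.add h₂), fun s hs => ?_⟩, ?_⟩
    · have h0 := (ae_mu_iff hω).1 (Lp.coeFn_add g₁ g₂)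
      have e : ∫ τ in (0 : ℝ)..s, (g₁ + g₂ : L2 ω H) τ
          = ∫ τ in (0 : ℝ)..s, (g₁ τ + g₂ τ) := by
        rw [intervalIntegral.integral_of_le hs.1, intervalIntegral.integral_of_le hs.1]
        exact integral_congr_ae (ae_restrict_of_ae_restrict_of_subset
          (Ioc_subset_Icc_self.trans (Icc_subset_Icc_right hs.2)) h0)
      change f₁ s + f₂ s = f₁ 0 + f₂ 0 + ∫ τ in (0 : ℝ)..s, (g₁ + g₂ : L2 ω H) τ
      rw [e, intervalIntegral.integral_add (intervalIntegrable_L2 hω g₁ hs)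
        (intervalIntegrable_L2 hω g₂ hs), k₁ s hs, k₂ s hs]
      abel
    · change f₁ 0 + f₂ 0 = f₁ ω + f₂ ω
      rw [b₁, b₂]
  smul_mem' := by
    rintro c ⟨y, g⟩ ⟨f, ⟨h, k⟩, b⟩
    refine ⟨c • f, ⟨(Lp.coeFn_smul c y).trans (h.const_smul c), fun s hs => ?_⟩, ?_⟩
    · have h0 := (ae_mu_iff hω).1 (Lp.coeFn_smul c g)
      have e : ∫ τ in (0 : ℝ)..s, (c • g : L2 ω H) τ = ∫ τ in (0 : ℝ)..s, c • g τ := by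
        rw [intervalIntegral.integral_of_le hs.1, intervalIntegral.integral_of_le hs.1]
        exact integral_congr_ae (ae_restrict_of_ae_restrict_of_subset
          (Ioc_subset_Icc_self.trans (Icc_subset_Icc_right hs.2)) h0)
      change c • f s = c • f 0 + ∫ τ in (0 : ℝ)..s, (c • g : L2 ω H) τ
      rw [e, intervalIntegral.integral_smul, k s hs, smul_add]
    · change c • f 0 = c • f ω
      rw [b]

/-- The operator `L₀ = d/ds` in `L²([0, ω], H)`,
with domain `{y ∈ W¹₂([0, ω], H) : y(0) = y(ω)}`. -/
def derivOp (ω : ℝ) (hω : 0 < ω) (H : Type*) [NormedAddCommGroup H] [InnerProductSpace ℂ H] :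
    L2 ω H →ₗ.[ℂ] L2 ω H :=
  (derivGraph ω hω H).toLinearPMap

lemma derivGraph_unique [CompleteSpace H] {ω : ℝ} (hω : 0 < ω) :
    ∀ p ∈ derivGraph ω hω H, p.1 = 0 → p.2 = 0 := by
  rintro ⟨y, g⟩ ⟨f, ⟨h, k⟩, -⟩ hy
  change y = 0 at hy
  subst hy
  have hgi := intervalIntegrable_L2 hω g (right_mem_Icc.2 hω.le)
  have hF : ContinuousOn (fun s => f 0 + ∫ τ in (0 : ℝ)..s, g τ) (Icc 0 ω) := by
    have := intervalIntegral.continuousOn_primitive_interval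
      (f := g) (μ := volume) (a := 0) (b := ω) (by
        rw [uIcc_of_le hω.le]
        exact (intervalIntegrable_iff_integrableOn_Icc_of_le hω.le).1 hgi)
    rw [uIcc_of_le hω.le] at this
    exact continuousOn_const.add this
  have h0 : (fun s => f 0 + ∫ τ in (0 : ℝ)..s, g τ) =ᵐ[volume.restrict (Icc 0 ω)]
      fun _ => (0 : H) := by
    have a1 := (ae_mu_iff hω).1 (h.symm.trans (Lp.coeFn_zero _ _ _))
    filter_upwards [a1, ae_restrict_mem measurableSet_Icc] with s hs hs'
    have := k s hs'
    exact this.symm.trans hs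
  have h1 : EqOn (fun s => f 0 + ∫ τ in (0 : ℝ)..s, g τ) (fun _ => (0 : H)) (Icc 0 ω) :=
    Measure.eqOn_Icc_of_ae_eq volume hω.ne h0 hF continuousOn_const
  have h2 := hgi.ae_hasDerivAt_integral
  have hg0 : ∀ᵐ s ∂(mu ω), g s = 0 := by
    refine (ae_mu_iff hω).2 ?_
    rw [← Measure.restrict_congr_set (Ioo_ae_eq_Icc (a := (0 : ℝ)) (b := ω) (μ := volume))]
    filter_upwards [ae_restrict_of_ae h2, ae_restrict_mem measurableSet_Ioo] with s hs hs'
    have hd := hs (by rw [uIcc_of_le hω.le]; exact Ioo_subset_Icc_self hs') 0 (by simp)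
    have hd' : HasDerivAt (fun u => f 0 + ∫ τ in (0 : ℝ)..u, g τ) (g s) s := hd.const_add (f 0)
    have he : (fun u => f 0 + ∫ τ in (0 : ℝ)..u, g τ) =ᶠ[𝓝 s] fun _ => (0 : H) := by
      filter_upwards [Icc_mem_nhds hs'.1 hs'.2] with u hu using h1 hu
    exact hd'.unique ((hasDerivAt_const s (0 : H)).congr_of_eventuallyEq he)
  exact Lp.ext (EventuallyEq.trans hg0 (Lp.coeFn_zero _ _ _).symm)

/-- `y ∈ D(L₀)` and `L₀ y = g` if and only if `y ∈ W¹₂`, `y(0) = y(ω)` and `y' = g`. -/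
lemma mem_derivOp_graph [CompleteSpace H] {ω : ℝ} (hω : 0 < ω) (y g : L2 ω H) :
    (y, g) ∈ (derivOp ω hω H).graph ↔ ∃ f : ℝ → H, IsSobolevRep ω f y g ∧ f 0 = f ω := by
  unfold derivOp
  rw [Submodule.toLinearPMap_graph_eq _ (derivGraph_unique hω)]
  rfl

/-- Reflection `s ↦ ω - s` preserves null sets of `[0, ω]`. -/
lemma quasi_reflect (ω : ℝ) : Measure.QuasiMeasurePreserving (fun s => ω - s) (mu ω) (mu ω) := by
  have h : MeasurePreserving (fun s : ℝ => ω - s) volume volume :=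
    volume.measurePreserving_sub_left ω
  have h' := h.restrict_preimage (s := Icc 0 ω) measurableSet_Icc
  have e : (fun s : ℝ => ω - s) ⁻¹' Icc 0 ω = Icc 0 ω := by
    ext s
    simp only [mem_preimage, mem_Icc]
    constructor <;> rintro ⟨a, b⟩ <;> constructor <;> linarith
  rw [e] at h'
  exact h'.quasiMeasurePreserving.smul_measure _

/-- The operator `(V y)(s) = 𝓥(s) y(ω - s)` in `L²([0, ω], H)`, on its natural domain
`{y ∈ L² : V y ∈ L²}`. -/
def potentialOp (ω : ℝ) (𝓥 : ℝ → H →L[ℂ] H) : L2 ω H →ₗ.[ℂ] L2 ω H where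
  domain :=
    { carrier := {y | MemLp (fun s => 𝓥 s (y (ω - s))) 2 (mu ω)}
      zero_mem' := by
        refine (MemLp.zero (ε := H)).ae_eq ?_
        filter_upwards [(quasi_reflect ω).ae (Lp.coeFn_zero H 2 (mu ω))] with s hs
        rw [hs]
        simp
      add_mem' := by
        intro y₁ y₂ h₁ h₂
        refine (h₁.add h₂).ae_eq ?_
        filter_upwards [(quasi_reflect ω).ae (Lp.coeFn_add y₁ y₂)] with s hs
        rw [hs]
        simp
      smul_mem' := by
        intro c y h
        refine (h.const_smul c).ae_eq ?_
        filter_upwards [(quasi_reflect ω).ae (Lp.coeFn_smul c y)] with s hs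
        rw [hs]
        simp }
  toFun :=
    { toFun := fun y => MemLp.toLp (fun s => 𝓥 s ((y : L2 ω H) (ω - s))) y.2
      map_add' := by
        rintro ⟨y₁, h₁⟩ ⟨y₂, h₂⟩
        rw [← MemLp.toLp_add]
        refine (MemLp.toLp_eq_toLp_iff _ _).2 ?_
        filter_upwards [(quasi_reflect ω).ae (Lp.coeFn_add y₁ y₂)] with s hs
        simp only [AddMemClass.mk_add_mk]
        rw [hs]
        simp
      map_smul' := by
        rintro c ⟨y, h⟩
        rw [RingHom.id_apply, ← MemLp.toLp_const_smul]
        refine (MemLp.toLp_eq_toLp_iff _ _).2 ?_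
        filter_upwards [(quasi_reflect ω).ae (Lp.coeFn_smul c y)] with s hs
        simp only [SetLike.mk_smul_mk]
        rw [hs]
        simp }

/-- The operator `L = L₀ - V`, `(L y)(s) = y'(s) - 𝓥(s) y(ω - s)`. -/
def mixedOp (ω : ℝ) (hω : 0 < ω) (𝓥 : ℝ → H →L[ℂ] H) : L2 ω H →ₗ.[ℂ] L2 ω H :=
  derivOp ω hω H - potentialOp ω 𝓥

/-! ### Fourier coefficients of the potential -/

/-- The function `s ↦ 𝓥(s) x` is (strongly) measurable and belongs to `L²([0, ω], H)`, for every
`x ∈ H`. -/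
def StronglyL2 (ω : ℝ) (𝓥 : ℝ → H →L[ℂ] H) : Prop :=
  ∀ x : H, MemLp (fun s => 𝓥 s x) 2 (mu ω)

/-- The linear map `x ↦ 𝓥(·) x` from `H` to `L²([0, ω], H)`. -/
def orbitMap {ω : ℝ} {𝓥 : ℝ → H →L[ℂ] H} (h𝓥 : StronglyL2 ω 𝓥) : H →ₗ[ℂ] L2 ω H where
  toFun x := (h𝓥 x).toLp
  map_add' x y := by
    rw [← MemLp.toLp_add]
    refine (MemLp.toLp_eq_toLp_iff _ _).2 (Eventually.of_forall fun s => ?_)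
    simp
  map_smul' c x := by
    rw [RingHom.id_apply, ← MemLp.toLp_const_smul]
    refine (MemLp.toLp_eq_toLp_iff _ _).2 (Eventually.of_forall fun s => ?_)
    simp

lemma orbitMap_continuous [CompleteSpace H] {ω : ℝ} {𝓥 : ℝ → H →L[ℂ] H}
    (h𝓥 : StronglyL2 ω 𝓥) : Continuous (orbitMap h𝓥) := by
  refine LinearMap.continuous_of_seq_closed_graph _ fun u x y hu hy => ?_
  have hm : TendstoInMeasure (mu ω) (fun n => (orbitMap h𝓥 (u n) : ℝ → H)) atTop y :=
    tendstoInMeasure_of_tendsto_Lp hy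
  obtain ⟨ns, hns, hae⟩ := hm.exists_seq_tendsto_ae
  refine Lp.ext ?_
  have hcoe : ∀ᵐ s ∂(mu ω), ∀ n, (orbitMap h𝓥 (u n) : ℝ → H) s = 𝓥 s (u n) :=
    ae_all_iff.2 fun n => MemLp.coeFn_toLp (h𝓥 (u n))
  have hx : (orbitMap h𝓥 x : ℝ → H) =ᵐ[mu ω] fun s => 𝓥 s x := MemLp.coeFn_toLp (h𝓥 x)
  filter_upwards [hae, hcoe, hx] with s h1 h2 h3
  rw [h3]
  refine tendsto_nhds_unique h1 ?_
  simp only [h2]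
  exact ((𝓥 s).continuous.tendsto x).comp (hu.comp hns.tendsto_atTop)

/-- The exponential `e^{-2π i n s / ω}`. -/
def expNeg (ω : ℝ) (n : ℤ) (s : ℝ) : ℂ :=
  Complex.exp (-(2 * Real.pi * n * s / ω : ℝ) * Complex.I)

lemma norm_expNeg (ω : ℝ) (n : ℤ) (s : ℝ) : ‖expNeg ω n s‖ = 1 := by
  unfold expNeg
  rw [← Complex.ofReal_neg]
  exact Complex.norm_exp_ofReal_mul_I _

lemma integrable_expNeg_smul {ω : ℝ} (n : ℤ) {f : ℝ → H} (hf : MemLp f 2 (mu ω)) :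
    Integrable (fun s => expNeg ω n s • f s) (mu ω) := by
  have : Continuous (expNeg ω n) := by
    unfold expNeg
    fun_prop
  exact (hf.integrable (by norm_num)).bdd_smul (C := 1) this.aestronglyMeasurable
    (Eventually.of_forall fun s => (norm_expNeg ω n s).le)

/-- The Fourier coefficient `x̂(n) = (1/ω) ∫₀^ω x(s) e^{-2π i n s / ω} ds` of `x ∈ L²`, as a bounded
linear map `L²([0, ω], H) → H`. -/
def fourierCoeffL2 (ω : ℝ) (H : Type*) [NormedAddCommGroup H] [InnerProductSpace ℂ H] (n : ℤ) :
    L2 ω H →L[ℂ] H :=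
  LinearMap.mkContinuousOfExistsBound
    { toFun := fun x => ∫ s, expNeg ω n s • x s ∂(mu ω)
      map_add' := fun x y => by
        rw [← integral_add (integrable_expNeg_smul n (Lp.memLp x))
          (integrable_expNeg_smul n (Lp.memLp y))]
        refine integral_congr_ae ?_
        filter_upwards [Lp.coeFn_add x y] with s hs
        rw [hs]
        simp
      map_smul' := fun c x => by
        rw [RingHom.id_apply, ← integral_smul]
        refine integral_congr_ae ?_
        filter_upwards [Lp.coeFn_smul c x] with s hs
        rw [hs]
        simp [smul_comm c] }
    (by
      refine ⟨((mu ω univ) ^ (1 / (1 : ENNReal).toReal - 1 / (2 : ENNReal).toReal)).toReal,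
        fun x => ?_⟩
      have hx := Lp.memLp x
      have h1 : ‖∫ s, expNeg ω n s • x s ∂(mu ω)‖ ≤ ∫ s, ‖x s‖ ∂(mu ω) := by
        refine (norm_integral_le_integral_norm _).trans_eq ?_
        refine integral_congr_ae (Eventually.of_forall fun s => ?_)
        simp [norm_smul, norm_expNeg]
      have h2 : ∫ s, ‖x s‖ ∂(mu ω) = (eLpNorm x 1 (mu ω)).toReal := by
        rw [eLpNorm_one_eq_lintegral_enorm,
          integral_norm_eq_lintegral_enorm hx.aestronglyMeasurable]
      have h3 := eLpNorm_le_eLpNorm_mul_rpow_measure_univ (μ := mu ω) (p := 1) (q := 2)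
        (by norm_num) hx.aestronglyMeasurable
      have h4 : (mu ω univ) ^ (1 / (1 : ENNReal).toReal - 1 / (2 : ENNReal).toReal) ≠ ⊤ :=
        ENNReal.rpow_ne_top_of_nonneg (by norm_num) (measure_ne_top _ _)
      have h5 := ENNReal.toReal_mono (ENNReal.mul_ne_top hx.eLpNorm_ne_top h4) h3
      rw [ENNReal.toReal_mul, mul_comm] at h5
      exact (h1.trans_eq h2).trans h5)

/-- The Fourier coefficient `𝓥̂(n) ∈ B(H)`,
`𝓥̂(n) x = (1/ω) ∫₀^ω 𝓥(s) x e^{-2π i n s / ω} ds`. -/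
def fourierCoeffOp [CompleteSpace H] {ω : ℝ} {𝓥 : ℝ → H →L[ℂ] H} (h𝓥 : StronglyL2 ω 𝓥)
    (n : ℤ) : H →L[ℂ] H :=
  (fourierCoeffL2 ω H n).comp ⟨orbitMap h𝓥, orbitMap_continuous h𝓥⟩

lemma fourierCoeffOp_apply [CompleteSpace H] {ω : ℝ} (hω : 0 < ω) {𝓥 : ℝ → H →L[ℂ] H}
    (h𝓥 : StronglyL2 ω 𝓥) (n : ℤ) (x : H) :
    fourierCoeffOp h𝓥 n x
      = (1 / ω : ℝ) • ∫ s in (0 : ℝ)..ω,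
          Complex.exp (-(2 * Real.pi * n * s / ω : ℝ) * Complex.I) • 𝓥 s x := by
  have h1 : fourierCoeffOp h𝓥 n x = ∫ s, expNeg ω n s • 𝓥 s x ∂(mu ω) := by
    change ∫ s, expNeg ω n s • (orbitMap h𝓥 x : ℝ → H) s ∂(mu ω) = _
    refine integral_congr_ae ?_
    filter_upwards [MemLp.coeFn_toLp (h𝓥 x)] with s hs
    change expNeg ω n s • ((h𝓥 x).toLp : ℝ → H) s = _
    rw [hs]
  rw [h1, mu, integral_smul_measure, ENNReal.toReal_ofReal (by positivity), one_div,
    intervalIntegral.integral_of_le hω.le, integral_Icc_eq_integral_Ioc]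
  rfl

end MixedProblem

end

/-! Put κ = 2π/ω. The Fourier transform turns L into diag(iκn) − V on ℓ²(ℤ, H). The reflection s ↦ ω
− s makes V a Hankel matrix, with entry v(n + l) at (n, l), where v is the sequence of Fourier
coefficients of the potential. The plan is to find a bounded similarity to an operator iκν + C in
which C is bounded and commutes with ν; for such an operator generation and growth can be computed
directly.

A nonzero Hankel matrix is never Hilbert–Schmidt, so two similarities are used. Dividing v(n + l) by
iκ(n − l) off the diagonal gives a Hilbert–Schmidt matrix Y, because v and 1/k are square summable
and (n, l) ↦ (n + l, n − l) is injective. The double-sum hypothesis says that VY is Hilbert–Schmidt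
too, up to finitely many columns. Conjugation by 1 + Y then replaces V by a Hilbert–Schmidt matrix B
(`exists_hankel_reduction`, `IsFreqMul.hankel_similarity`). Next, a quadratic fixed-point equation
in Hilbert–Schmidt matrices replaces B by a matrix b that is diagonal apart from one finite central
block of indices (`exists_blockDiagonalization`). Both intertwinings are first shown on the domain
of diag(iκn). They become equalities of graphs because, for one large real μ, one side of μ −
operator is onto and the other is injective (`exists_hankel_similarity`).

Setting the frequency ν to zero on the central block and moving the difference into the bounded part
gives iκν + C. Its group is exp(iκνt) exp(tC) with a unitary first factor, so its growth bound is
that of exp(tC), which is the largest real part in σ(C) (`exists_norm_exp_le_of_spectrum_le`,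
`re_le_of_norm_exp_le`). The shifts iκk are imaginary and do not change real parts. Since C is
Hilbert–Schmidt, its far blocks are small, and a Neumann series handles all but finitely many of
them. Hence σ(C) and the spectrum of iκν + C lead to the same supremum, with the possible exception
of the point 0 of σ(C). That point does no harm when H ≠ 0: the diagonal entries of C tend to zero
and have nonempty spectra, so the spectral bound is at least 0 (`exists_no_modelResolvent`). When H
= 0 both bounds are −∞. The backward statement is the forward one for −L, which has the same form.
-/

noncomputable section

set_option linter.unusedSectionVars false

namespace MixedProblem

/-! ### Block Hilbert–Schmidt matrices on `ℓ²(ℤ, H)` -/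

section BlockMatrices

/-- The space `ℓ²(ℤ, H)`. -/
abbrev SeqL2 (H : Type*) [NormedAddCommGroup H] : Type _ := lp (fun _ : ℤ => H) 2

/-- Matrices `ℤ × ℤ → B(H)` with square summable operator norms of the entries. -/
abbrev BlockHS (H : Type*) [NormedAddCommGroup H] [InnerProductSpace ℂ H] : Type _ :=
  lp (fun _ : ℤ × ℤ => H →L[ℂ] H) 2

/-! ### Square summable families and the Cauchy–Schwarz inequality -/

section CauchySchwarz

variable {ι : Type*} {E F : Type*} [NormedAddCommGroup E] [NormedAddCommGroup F]

lemma memLp_two_iff {f : ι → E} :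
    Memℓp (E := fun _ => E) f 2 ↔ Summable fun i => ‖f i‖ ^ 2 := by
  rw [memℓp_gen_iff (by norm_num)]
  simp

lemma summable_norm_sq (f : lp (fun _ : ι => E) 2) : Summable fun i => ‖f i‖ ^ 2 :=
  memLp_two_iff.1 (lp.memℓp f)

lemma lp_norm_sq (f : lp (fun _ : ι => E) 2) : ‖f‖ ^ 2 = ∑' i, ‖f i‖ ^ 2 := by
  have := lp.norm_rpow_eq_tsum (p := 2) (by norm_num) f
  simpa using this

lemma lp_norm_le_of_sq {f : lp (fun _ : ι => E) 2} {C : ℝ} (hC : 0 ≤ C)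
    (h : ∑' i, ‖f i‖ ^ 2 ≤ C ^ 2) : ‖f‖ ≤ C := by
  rw [← lp_norm_sq] at h
  exact (sq_le_sq₀ (norm_nonneg _) hC).1 h

lemma summable_mul_norm {f : ι → E} {g : ι → F} (hf : Summable fun i => ‖f i‖ ^ 2)
    (hg : Summable fun i => ‖g i‖ ^ 2) : Summable fun i => ‖f i‖ * ‖g i‖ :=
  (hf.add hg).of_nonneg_of_le (fun i => by positivity)
    (fun i => by nlinarith [sq_nonneg (‖f i‖ - ‖g i‖), sq_nonneg (‖f i‖), sq_nonneg (‖g i‖)])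

lemma tsum_mul_norm_sq_le {f : ι → E} {g : ι → F} (hf : Summable fun i => ‖f i‖ ^ 2)
    (hg : Summable fun i => ‖g i‖ ^ 2) :
    (∑' i, ‖f i‖ * ‖g i‖) ^ 2 ≤ (∑' i, ‖f i‖ ^ 2) * ∑' i, ‖g i‖ ^ 2 := by
  have hf' : Summable fun i => ‖‖f i‖‖ ^ 2 := by simpa using hf
  have hg' : Summable fun i => ‖‖g i‖‖ ^ 2 := by simpa using hg
  have h := lp.tsum_mul_le_mul_norm' (p := 2) (q := 2) (α := ι)
    (by norm_num; exact Real.HolderConjugate.two_two)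
    ⟨fun i => ‖f i‖, memLp_two_iff.2 hf'⟩ ⟨fun i => ‖g i‖, memLp_two_iff.2 hg'⟩
  simp only [norm_norm] at h
  refine (pow_le_pow_left₀ (tsum_nonneg fun i => by positivity) h 2).trans_eq ?_
  rw [mul_pow, lp_norm_sq, lp_norm_sq]
  simp

end CauchySchwarz

variable {H : Type*} [NormedAddCommGroup H] [InnerProductSpace ℂ H]

lemma BlockHS.summable_row (a : BlockHS H) (j : ℤ) : Summable fun n => ‖a (j, n)‖ ^ 2 :=
  (summable_norm_sq a).comp_injective (i := fun n : ℤ => (j, n)) fun _ _ h => by simpa using h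

lemma BlockHS.summable_col (a : BlockHS H) (l : ℤ) : Summable fun n => ‖a (n, l)‖ ^ 2 :=
  (summable_norm_sq a).comp_injective (i := fun n : ℤ => (n, l)) fun _ _ h => by simpa using h

variable [CompleteSpace H]

lemma summable_row_apply {r : ℤ → H →L[ℂ] H} (hr : Summable fun n => ‖r n‖ ^ 2)
    {x : ℤ → H} (hx : Summable fun n => ‖x n‖ ^ 2) : Summable fun n => r n (x n) :=
  (summable_mul_norm hr hx).of_norm_bounded fun n => (r n).le_opNorm (x n)

lemma norm_tsum_row_apply_le {r : ℤ → H →L[ℂ] H} (hr : Summable fun n => ‖r n‖ ^ 2)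
    {x : ℤ → H} (hx : Summable fun n => ‖x n‖ ^ 2) :
    ‖∑' n, r n (x n)‖ ^ 2 ≤ (∑' n, ‖r n‖ ^ 2) * ∑' n, ‖x n‖ ^ 2 := by
  refine le_trans (pow_le_pow_left₀ (norm_nonneg _) ?_ 2) (tsum_mul_norm_sq_le hr hx)
  exact tsum_of_norm_bounded (summable_mul_norm hr hx).hasSum fun n => (r n).le_opNorm (x n)

/-- The functional `x ↦ ∑ r(n) x(n)` given by a square summable row of operators. -/
def rowOp (r : ℤ → H →L[ℂ] H) (hr : Summable fun n => ‖r n‖ ^ 2) : SeqL2 H →L[ℂ] H :=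
  LinearMap.mkContinuous
    { toFun := fun x => ∑' n, r n (x n)
      map_add' := fun x y => by
        rw [← (summable_row_apply hr (summable_norm_sq x)).tsum_add
          (summable_row_apply hr (summable_norm_sq y))]
        simp
      map_smul' := fun c x => by
        rw [RingHom.id_apply, ← (summable_row_apply hr (summable_norm_sq x)).tsum_const_smul]
        simp }
    (Real.sqrt (∑' n, ‖r n‖ ^ 2)) fun x => by
      refine le_of_sq_le_sq ?_ (by positivity)
      rw [mul_pow, Real.sq_sqrt (tsum_nonneg fun _ => by positivity), lp_norm_sq]
      exact norm_tsum_row_apply_le hr (summable_norm_sq x)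

lemma rowOp_apply (r : ℤ → H →L[ℂ] H) (hr : Summable fun n => ‖r n‖ ^ 2) (x : SeqL2 H) :
    rowOp r hr x = ∑' n, r n (x n) := rfl

lemma rowOp_single (r : ℤ → H →L[ℂ] H) (hr : Summable fun n => ‖r n‖ ^ 2) (l : ℤ) (h : H) :
    rowOp r hr (lp.single 2 l h) = r l h := by
  rw [rowOp_apply, tsum_eq_single l]
  · simp
  · intro n hn
    rw [lp.single_apply_ne _ _ _ hn, map_zero]

lemma memLp_op (a : BlockHS H) (x : SeqL2 H) :
    Summable fun j => ‖∑' n, a (j, n) (x n)‖ ^ 2 :=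
  ((summable_norm_sq a).prod.mul_right (‖x‖ ^ 2)).of_nonneg_of_le (fun _ => by positivity)
    fun j => by
      rw [lp_norm_sq]
      exact norm_tsum_row_apply_le (a.summable_row j) (summable_norm_sq x)

/-- The bounded operator on `ℓ²(ℤ, H)` with matrix `a`. -/
def BlockHS.op (a : BlockHS H) : SeqL2 H →L[ℂ] SeqL2 H :=
  LinearMap.mkContinuous
    { toFun := fun x => ⟨fun j => ∑' n, a (j, n) (x n), memLp_two_iff.2 (memLp_op a x)⟩
      map_add' := fun x y => lp.ext <| funext fun j => (rowOp _ (a.summable_row j)).map_add x y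
      map_smul' := fun c x => lp.ext <| funext fun j => (rowOp _ (a.summable_row j)).map_smul c x }
    ‖a‖ fun x => by
      refine lp_norm_le_of_sq (by positivity) ?_
      rw [mul_pow, lp_norm_sq a, lp_norm_sq x, (summable_norm_sq a).tsum_prod, ← tsum_mul_right]
      exact (memLp_op a x).tsum_le_tsum
        (fun j => norm_tsum_row_apply_le (a.summable_row j) (summable_norm_sq x))
        ((summable_norm_sq a).prod.mul_right _)

lemma BlockHS.op_apply (a : BlockHS H) (x : SeqL2 H) (j : ℤ) :
    a.op x j = ∑' n, a (j, n) (x n) := rfl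

lemma BlockHS.hasSum_op (a : BlockHS H) (x : SeqL2 H) (j : ℤ) :
    HasSum (fun n => a (j, n) (x n)) (a.op x j) :=
  (summable_row_apply (a.summable_row j) (summable_norm_sq x)).hasSum

lemma BlockHS.op_single (a : BlockHS H) (l : ℤ) (h : H) (j : ℤ) :
    a.op (lp.single 2 l h) j = a (j, l) h := rowOp_single _ (a.summable_row j) l h

lemma BlockHS.norm_op_le (a : BlockHS H) : ‖a.op‖ ≤ ‖a‖ :=
  LinearMap.mkContinuous_norm_le _ (norm_nonneg _) _

/-- Finitely supported sequences are dense in ℓ², so bounded operators are determined by their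
columns. Most operator identities below reduce to matrix entries in this way. -/
lemma SeqL2.clm_ext {F : Type*} [NormedAddCommGroup F] [NormedSpace ℂ F]
    {S T : SeqL2 H →L[ℂ] F} (h : ∀ l x, S (lp.single 2 l x) = T (lp.single 2 l x)) : S = T := by
  refine lp.ext_continuousLinearMap (by norm_num) fun l => ?_
  ext x
  exact h l x

lemma SeqL2.clm_ext' {S T : SeqL2 H →L[ℂ] SeqL2 H}
    (h : ∀ l x j, S (lp.single 2 l x) j = T (lp.single 2 l x) j) : S = T :=
  SeqL2.clm_ext fun l x => lp.ext <| funext fun j => h l x j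

lemma BlockHS.op_add (a b : BlockHS H) : (a + b).op = a.op + b.op :=
  SeqL2.clm_ext' fun l x j => by
    simp [BlockHS.op_single]

lemma BlockHS.op_neg (a : BlockHS H) : (-a).op = -a.op :=
  SeqL2.clm_ext' fun l x j => by
    simp [BlockHS.op_single]

lemma BlockHS.op_sub (a b : BlockHS H) : (a - b).op = a.op - b.op := by
  rw [sub_eq_add_neg, op_add, op_neg, sub_eq_add_neg]

lemma summable_mul_col (a b : BlockHS H) (j l : ℤ) :
    Summable fun n => a (j, n) * b (n, l) :=
  (summable_mul_norm (a.summable_row j) (b.summable_col l)).of_norm_bounded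
    fun _ => norm_mul_le _ _

lemma norm_mulFun_le (a b : BlockHS H) (p : ℤ × ℤ) :
    ‖∑' n, a (p.1, n) * b (n, p.2)‖ ^ 2
      ≤ (∑' n, ‖a (p.1, n)‖ ^ 2) * ∑' n, ‖b (n, p.2)‖ ^ 2 := by
  refine le_trans (pow_le_pow_left₀ (norm_nonneg _) ?_ 2)
    (tsum_mul_norm_sq_le (a.summable_row p.1) (b.summable_col p.2))
  exact tsum_of_norm_bounded (summable_mul_norm (a.summable_row p.1) (b.summable_col p.2)).hasSum
    fun n => norm_mul_le _ _

lemma summable_norm_sq_swap (b : BlockHS H) : Summable fun q : ℤ × ℤ => ‖b (q.2, q.1)‖ ^ 2 :=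
  (summable_norm_sq b).prod_symm

lemma summable_rows_mul_cols (a b : BlockHS H) : Summable fun p : ℤ × ℤ =>
    (∑' n, ‖a (p.1, n)‖ ^ 2) * ∑' n, ‖b (n, p.2)‖ ^ 2 :=
  (summable_norm_sq a).prod.mul_of_nonneg (summable_norm_sq_swap b).prod
    (fun _ => tsum_nonneg fun _ => by positivity) (fun _ => tsum_nonneg fun _ => by positivity)

/-- The product of block Hilbert–Schmidt matrices. -/
def BlockHS.prod (a b : BlockHS H) : BlockHS H :=
  ⟨fun p => ∑' n, a (p.1, n) * b (n, p.2), memLp_two_iff.2 <|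
    (summable_rows_mul_cols a b).of_nonneg_of_le (fun _ => by positivity) (norm_mulFun_le a b)⟩

lemma BlockHS.prod_apply (a b : BlockHS H) (p : ℤ × ℤ) :
    a.prod b p = ∑' n, a (p.1, n) * b (n, p.2) := rfl

/-- Cauchy–Schwarz in the inner index bounds an entry by a row sum of `a` times a column sum of `b`;
summed over both outer indices, the two factors separate. -/
lemma BlockHS.norm_prod_le (a b : BlockHS H) : ‖a.prod b‖ ≤ ‖a‖ * ‖b‖ := by
  refine lp_norm_le_of_sq (by positivity) ?_
  have hb : ∑' p, ‖b p‖ ^ 2 = ∑' q : ℤ × ℤ, ‖b (q.2, q.1)‖ ^ 2 :=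
    ((Equiv.prodComm ℤ ℤ).tsum_eq (fun p => ‖b p‖ ^ 2)).symm
  rw [mul_pow, lp_norm_sq a, lp_norm_sq b, (summable_norm_sq a).tsum_prod,
    hb, (summable_norm_sq_swap b).tsum_prod,
    (summable_norm_sq a).prod.tsum_mul_tsum (summable_norm_sq_swap b).prod
      (summable_rows_mul_cols a b)]
  exact Summable.tsum_le_tsum (norm_mulFun_le a b) (summable_norm_sq (a.prod b))
    (summable_rows_mul_cols a b)

lemma BlockHS.add_prod (a b c : BlockHS H) : (a + b).prod c = a.prod c + b.prod c :=
  lp.ext <| funext fun p => by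
    simp only [prod_apply, lp.coeFn_add, Pi.add_apply, add_mul]
    exact (summable_mul_col a c p.1 p.2).tsum_add (summable_mul_col b c p.1 p.2)

lemma BlockHS.prod_add (a b c : BlockHS H) : a.prod (b + c) = a.prod b + a.prod c :=
  lp.ext <| funext fun p => by
    simp only [prod_apply, lp.coeFn_add, Pi.add_apply, mul_add]
    exact (summable_mul_col a b p.1 p.2).tsum_add (summable_mul_col a c p.1 p.2)

lemma BlockHS.prod_neg (a b : BlockHS H) : a.prod (-b) = -a.prod b :=
  lp.ext <| funext fun p => by
    simp only [prod_apply, lp.coeFn_neg, Pi.neg_apply, mul_neg]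
    exact tsum_neg

lemma BlockHS.neg_prod (a b : BlockHS H) : (-a).prod b = -a.prod b :=
  lp.ext <| funext fun p => by
    simp only [prod_apply, lp.coeFn_neg, Pi.neg_apply, neg_mul]
    exact tsum_neg

lemma BlockHS.prod_sub (a b c : BlockHS H) : a.prod (b - c) = a.prod b - a.prod c := by
  rw [sub_eq_add_neg, prod_add, prod_neg, sub_eq_add_neg]

lemma BlockHS.sub_prod (a b c : BlockHS H) : (a - b).prod c = a.prod c - b.prod c := by
  rw [sub_eq_add_neg, add_prod, neg_prod, sub_eq_add_neg]

lemma BlockHS.op_prod (a b : BlockHS H) : (a.prod b).op = a.op * b.op :=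
  SeqL2.clm_ext' fun l x j => by
    rw [op_single, prod_apply, mul_apply_eq_comp, op_apply]
    simp only [op_single]
    exact (ContinuousLinearMap.apply ℂ H x).map_tsum (summable_mul_col a b j l)

/-- The Schur (entrywise) product of a block matrix with a bounded scalar matrix. -/
def BlockHS.schur (γ : ℤ × ℤ → ℂ) (hγ : ∃ K : ℝ, ∀ p, ‖γ p‖ ≤ K) (a : BlockHS H) : BlockHS H :=
  ⟨fun p => γ p • a p, memLp_two_iff.2 <| by
    obtain ⟨K, hK⟩ := hγ
    refine ((summable_norm_sq a).mul_left (K ^ 2)).of_nonneg_of_le (fun _ => by positivity)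
      fun p => ?_
    rw [norm_smul, mul_pow]
    gcongr
    exact hK p⟩

lemma BlockHS.schur_apply (γ : ℤ × ℤ → ℂ) (hγ : ∃ K : ℝ, ∀ p, ‖γ p‖ ≤ K) (a : BlockHS H)
    (p : ℤ × ℤ) : a.schur γ hγ p = γ p • a p := rfl

lemma BlockHS.norm_schur_le {γ : ℤ × ℤ → ℂ} (hγ : ∃ K : ℝ, ∀ p, ‖γ p‖ ≤ K) {K : ℝ} (hK0 : 0 ≤ K)
    (hK : ∀ p, ‖γ p‖ ≤ K) (a : BlockHS H) : ‖a.schur γ hγ‖ ≤ K * ‖a‖ := by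
  refine lp_norm_le_of_sq (by positivity) ?_
  rw [mul_pow, lp_norm_sq a, ← tsum_mul_left]
  refine Summable.tsum_le_tsum (fun p => ?_) (summable_norm_sq (a.schur γ hγ))
    ((summable_norm_sq a).mul_left _)
  rw [schur_apply, norm_smul, mul_pow]
  gcongr
  exact hK p

lemma BlockHS.schur_sub (γ : ℤ × ℤ → ℂ) (hγ : ∃ K : ℝ, ∀ p, ‖γ p‖ ≤ K) (a b : BlockHS H) :
    (a - b).schur γ hγ = a.schur γ hγ - b.schur γ hγ :=
  lp.ext <| funext fun p => by
    simp only [schur_apply, lp.coeFn_sub, Pi.sub_apply, smul_sub]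

/-- Multiplication by a bounded scalar sequence on `ℓ²(ℤ, H)`. -/
def diagOp (H : Type*) [NormedAddCommGroup H] [InnerProductSpace ℂ H]
    (φ : ℤ → ℂ) (hφ : ∃ K : ℝ, ∀ n, ‖φ n‖ ≤ K) : SeqL2 H →L[ℂ] SeqL2 H :=
  LinearMap.mkContinuousOfExistsBound
    { toFun := fun x => ⟨fun n => φ n • x n, memLp_two_iff.2 <| by
        obtain ⟨K, hK⟩ := hφ
        refine ((summable_norm_sq x).mul_left (K ^ 2)).of_nonneg_of_le (fun _ => by positivity)
          fun p => ?_
        rw [norm_smul, mul_pow]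
        gcongr
        exact hK p⟩
      map_add' := fun x y => lp.ext <| funext fun n => smul_add _ _ _
      map_smul' := fun c x => lp.ext <| funext fun n => smul_comm _ _ _ } <| by
    obtain ⟨K, hK⟩ := hφ
    refine ⟨K, fun x => ?_⟩
    have hK0 : 0 ≤ K := (norm_nonneg _).trans (hK 0)
    refine lp_norm_le_of_sq (by positivity) ?_
    rw [mul_pow, lp_norm_sq x, ← tsum_mul_left]
    refine Summable.tsum_le_tsum (fun p => ?_) (summable_norm_sq (E := H) ⟨_, _⟩)
      ((summable_norm_sq x).mul_left _)
    change ‖φ p • x p‖ ^ 2 ≤ _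
    rw [norm_smul, mul_pow]
    gcongr
    exact hK p

lemma diagOp_apply (φ : ℤ → ℂ) (hφ : ∃ K : ℝ, ∀ n, ‖φ n‖ ≤ K) (x : SeqL2 H) (n : ℤ) :
    diagOp H φ hφ x n = φ n • x n := rfl

lemma norm_diagOp_apply_le {φ : ℤ → ℂ} (hφ : ∃ K : ℝ, ∀ n, ‖φ n‖ ≤ K) {K : ℝ}
    (hK0 : 0 ≤ K) (hK : ∀ n, ‖φ n‖ ≤ K) (x : SeqL2 H) : ‖diagOp H φ hφ x‖ ≤ K * ‖x‖ := by
  refine lp_norm_le_of_sq (by positivity) ?_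
  rw [mul_pow, lp_norm_sq x, ← tsum_mul_left]
  refine Summable.tsum_le_tsum (fun p => ?_) (summable_norm_sq (diagOp H φ hφ x))
    ((summable_norm_sq x).mul_left _)
  rw [diagOp_apply, norm_smul, mul_pow]
  gcongr
  exact hK p

lemma norm_diagOp_le {φ : ℤ → ℂ} (hφ : ∃ K : ℝ, ∀ n, ‖φ n‖ ≤ K) {K : ℝ}
    (hK0 : 0 ≤ K) (hK : ∀ n, ‖φ n‖ ≤ K) : ‖diagOp H φ hφ‖ ≤ K :=
  ContinuousLinearMap.opNorm_le_bound _ hK0 (norm_diagOp_apply_le hφ hK0 hK)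

/-- A block matrix supported on `{φ n = φ l}` commutes with multiplication by `φ`. -/
lemma BlockHS.op_comm_diagOp (a : BlockHS H) {φ : ℤ → ℂ} (hφ : ∃ K : ℝ, ∀ n, ‖φ n‖ ≤ K)
    (h : ∀ p : ℤ × ℤ, φ p.1 ≠ φ p.2 → a p = 0) : Commute a.op (diagOp H φ hφ) := by
  ext x : 1
  refine lp.ext <| funext fun n => ?_
  simp only [mul_apply_eq_comp]
  rw [diagOp_apply, op_apply, op_apply,
    ← (summable_row_apply (a.summable_row n) (summable_norm_sq x)).tsum_const_smul]
  refine tsum_congr fun l => ?_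
  rw [diagOp_apply, map_smul]
  by_cases hn : φ n = φ l
  · rw [hn]
  · simp [h (n, l) hn]

end BlockMatrices

/-! ### Growth of the exponential of a bounded operator -/

section BoundedGrowth

variable {A : Type*} [NormedRing A] [NormedAlgebra ℂ A] [CompleteSpace A]

lemma exp_add_smul (x : A) (s t : ℂ) :
    NormedSpace.exp ((s + t) • x) = NormedSpace.exp (s • x) * NormedSpace.exp (t • x) := by
  let _ : NormedAlgebra ℚ A := NormedAlgebra.restrictScalars ℚ ℂ A
  rw [add_smul]
  exact NormedSpace.exp_add_of_commute (((Commute.refl x).smul_left s).smul_right t)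

lemma exp_natCast_mul_smul (x : A) (h : ℂ) (n : ℕ) :
    NormedSpace.exp ((n * h) • x) = NormedSpace.exp (h • x) ^ n := by
  induction n with
  | zero => simp
  | succ n ih => rw [Nat.cast_succ, add_mul, one_mul, exp_add_smul, ih, pow_succ]

lemma continuous_exp_smul (x : A) : Continuous fun t : ℝ => NormedSpace.exp ((t : ℂ) • x) := by
  have h : ∀ t : ℂ, HasDerivAt (fun u : ℂ => NormedSpace.exp (u • x))
    (NormedSpace.exp (t • x) * x) t := hasDerivAt_exp_smul_const x
  exact (continuous_iff_continuousAt.2 fun t => (h t).continuousAt).comp Complex.continuous_ofReal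

lemma mem_spectrum_of_one_add_smul {x : A} {h w : ℂ} (hh : h ≠ 0)
    (hw : w ∈ _root_.spectrum ℂ (1 + h • x)) : (w - 1) / h ∈ _root_.spectrum ℂ x := by
  by_contra hz
  rw [spectrum.notMem_iff] at hz
  apply hw
  have e : algebraMap ℂ A w - (1 + h • x) = h • (algebraMap ℂ A ((w - 1) / h) - x) := by
    rw [smul_sub, Algebra.algebraMap_eq_smul_one, Algebra.algebraMap_eq_smul_one, smul_smul,
      mul_div_cancel₀ _ hh, sub_smul, one_smul]
    abel
  rw [spectrum.mem_resolventSet_iff, e]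
  exact hz.smul (Units.mk0 h hh)

/-- In |1 + hz|² = 1 + 2h Re z + h²|z|² the linear term gains 2hδ and the quadratic term costs at
most hδ because hR² ≤ δ. What remains, 1 − hδ, is below (1 − hδ/2)². -/
lemma norm_one_add_mul_le {δ R h : ℝ} (hh : 0 < h) (hhR : h * R ^ 2 ≤ δ)
    (hhδ : h * δ ≤ 1) {z : ℂ} (hz : z.re ≤ -δ) (hzR : ‖z‖ ≤ R) : ‖1 + h * z‖ ≤ 1 - h * δ / 2 := by
  refine le_of_sq_le_sq ?_ (by linarith)
  have h1 : ‖(1 : ℂ) + h * z‖ ^ 2 = 1 + 2 * h * z.re + h ^ 2 * ‖z‖ ^ 2 := by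
    rw [← Complex.normSq_eq_norm_sq, ← Complex.normSq_eq_norm_sq, Complex.normSq_apply,
      Complex.normSq_apply]
    simp
    ring
  have h2 : ‖z‖ ^ 2 ≤ R ^ 2 := pow_le_pow_left₀ (norm_nonneg _) hzR 2
  rw [h1]
  have h3 : h ^ 2 * ‖z‖ ^ 2 ≤ h * δ := by
    calc h ^ 2 * ‖z‖ ^ 2 ≤ h ^ 2 * R ^ 2 := by gcongr
      _ = h * (h * R ^ 2) := by ring
      _ ≤ h * δ := by gcongr
  have h4 : h * z.re ≤ h * -δ := by gcongr
  nlinarith [sq_nonneg (h * δ)]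

variable [NormOneClass A]

/-- `exp(h x) = q(h) (1 + h x)` with `‖q(h)‖ ≤ 1 + ε h` for small `h > 0`. -/
lemma eventually_exp_factor (x : A) {ε : ℝ} (hε : 0 < ε) :
    ∀ᶠ h : ℝ in 𝓝[>] 0, ∃ q : A, ‖q‖ ≤ 1 + ε * h ∧ Commute q (1 + (h : ℂ) • x) ∧
      NormedSpace.exp ((h : ℂ) • x) = q * (1 + (h : ℂ) • x) := by
  have hu : HasDerivAt (fun h : ℂ => 1 + h • x) x 0 := by
    simpa using ((hasDerivAt_id (0 : ℂ)).smul_const x).const_add 1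
  have hinv : HasDerivAt (fun h : ℂ => Ring.inverse (1 + h • x)) (-x) 0 := by
    have h1 := hasFDerivAt_ringInverse (𝕜 := ℂ) (1 : Aˣ)
    have h2 : HasFDerivAt Ring.inverse (-ContinuousLinearMap.mulLeftRight ℂ A ↑(1 : Aˣ)⁻¹ ↑(1 : Aˣ)⁻¹)
        (1 + (0 : ℂ) • x) := by simpa using h1
    have h3 := h2.comp_hasDerivAt (0 : ℂ) hu
    simp only [inv_one, Units.val_one, neg_apply,
      ContinuousLinearMap.mulLeftRight_apply, one_mul, mul_one] at h3
    exact h3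
  have hexp : HasDerivAt (fun h : ℂ => NormedSpace.exp (h • x)) x 0 := by
    simpa using hasDerivAt_exp_smul_const x (0 : ℂ)
  -- The factor q(h) = exp(hx)(1 + hx)⁻¹ has value 1 and derivative x − x = 0 at the origin, so q(h)
  -- − 1 = o(h).
  have hq : HasDerivAt (fun h : ℂ => NormedSpace.exp (h • x) * Ring.inverse (1 + h • x)) 0 0 := by
    have h3 := hexp.mul hinv
    simp only [zero_smul, add_zero, Ring.inverse_one, mul_one, NormedSpace.exp_zero, one_mul,
      add_neg_cancel] at h3
    exact h3
  have hlit := hq.isLittleO.def hε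
  simp only [zero_smul, NormedSpace.exp_zero, add_zero, Ring.inverse_one, mul_one, sub_zero,
    smul_zero] at hlit
  have hunit : ∀ᶠ h : ℂ in 𝓝 0, IsUnit (1 + h • x) := by
    have : Tendsto (fun h : ℂ => 1 + h • x) (𝓝 0) (𝓝 1) := by
      have := hu.continuousAt.tendsto
      simpa using this
    exact this (Units.isOpen.mem_nhds isUnit_one)
  have hof : Tendsto (fun h : ℝ => (h : ℂ)) (𝓝[>] 0) (𝓝 0) := by
    have := Complex.continuous_ofReal.tendsto 0
    simp only [Complex.ofReal_zero] at this
    exact this.mono_left nhdsWithin_le_nhds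
  filter_upwards [hof.eventually hlit, hof.eventually hunit, self_mem_nhdsWithin] with h h1 h2 h3
  refine ⟨NormedSpace.exp ((h : ℂ) • x) * Ring.inverse (1 + (h : ℂ) • x), ?_, ?_, ?_⟩
  · have h4 : ‖(h : ℂ)‖ = h := by
      rw [Complex.norm_real, Real.norm_of_nonneg (le_of_lt h3)]
    rw [h4] at h1
    have := norm_le_norm_add_norm_sub' (NormedSpace.exp ((h : ℂ) • x) *
      Ring.inverse (1 + (h : ℂ) • x)) 1
    rw [norm_one] at this
    linarith
  · have c1 : Commute (NormedSpace.exp ((h : ℂ) • x)) (1 + (h : ℂ) • x) :=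
      ((Commute.one_right _).add_right (Commute.refl _)).exp_left
    refine c1.mul_left ?_
    obtain ⟨u, hu⟩ := h2
    rw [← hu, Ring.inverse_unit]
    exact u.commute_inv_coe
  · rw [mul_assoc, Ring.inverse_mul_cancel _ h2, mul_one]

/-- Gelfand's formula for the spectral radius; the strict inequality ρ < ρ' absorbs the passage to
the limit. -/
lemma eventually_norm_pow_le (y : A) {ρ ρ' : ℝ} (hρ0 : 0 ≤ ρ) (hρ : ρ < ρ')
    (h : ∀ w ∈ _root_.spectrum ℂ y, ‖w‖ ≤ ρ) : ∀ᶠ n : ℕ in atTop, ‖y ^ n‖ ≤ ρ' ^ n := by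
  have h1 : spectralRadius ℂ y < ENNReal.ofReal ρ' := by
    refine lt_of_le_of_lt ?_ ((ENNReal.ofReal_lt_ofReal_iff (hρ0.trans_lt hρ)).2 hρ)
    refine iSup₂_le fun w hw => ?_
    rw [← enorm_eq_nnnorm, ← ofReal_norm]
    exact ENNReal.ofReal_le_ofReal (h w hw)
  have h2 := (spectrum.pow_norm_pow_one_div_tendsto_nhds_spectralRadius y).eventually
    (gt_mem_nhds h1)
  filter_upwards [h2, eventually_gt_atTop 0] with n hn hn0
  have h3 := ((ENNReal.ofReal_lt_ofReal_iff (hρ0.trans_lt hρ)).1 hn).le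
  have h4 : (‖y ^ n‖ ^ (1 / (n : ℝ))) ^ n = ‖y ^ n‖ := by
    rw [one_div, Real.rpow_inv_natCast_pow (norm_nonneg _) hn0.ne']
  rw [← h4]
  exact pow_le_pow_left₀ (by positivity) h3 n

/-- One Euler step 1 + hx has its spectrum in a disc of radius less than 1, and exp(hx) differs from
it by a factor of norm at most 1 + εh. Thus only the spectrum of an affine function of x is needed,
not that of exp(hx). -/
lemma exists_norm_exp_le_of_spectrum_neg (x : A) {δ : ℝ} (hδ : 0 < δ)
    (hx : ∀ z ∈ _root_.spectrum ℂ x, z.re ≤ -δ) :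
    ∃ M : ℝ, ∀ t : ℝ, 0 ≤ t → ‖NormedSpace.exp ((t : ℂ) • x)‖ ≤ M := by
  have hsmall : ∀ᶠ h : ℝ in 𝓝[>] 0, h * ‖x‖ ^ 2 ≤ δ ∧ h * δ ≤ 1 := by
    have t1 : Tendsto (fun h : ℝ => h * ‖x‖ ^ 2) (𝓝[>] 0) (𝓝 0) := by
      have : Continuous fun h : ℝ => h * ‖x‖ ^ 2 := by fun_prop
      simpa using (this.tendsto 0).mono_left nhdsWithin_le_nhds
    have t2 : Tendsto (fun h : ℝ => h * δ) (𝓝[>] 0) (𝓝 0) := by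
      have : Continuous fun h : ℝ => h * δ := by fun_prop
      simpa using (this.tendsto 0).mono_left nhdsWithin_le_nhds
    exact (t1.eventually_le_const hδ).and (t2.eventually_le_const one_pos)
  obtain ⟨h, ⟨q, hq1, hqc, hq2⟩, ⟨hh1, hh2⟩, hh⟩ :=
    ((eventually_exp_factor x (ε := δ / 4) (by positivity)).and
      (hsmall.and self_mem_nhdsWithin)).exists
  replace hh : 0 < h := hh
  have hhδ : 0 < h * δ := by positivity
  -- The spectrum of 1 + hx lies in the disc of radius 1 − hδ/2. Enlarging it to 1 − hδ/4 leaves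
  -- room for Gelfand's formula and still compensates the factor q, since (1 + hδ/4)(1 − hδ/4) ≤ 1.
  have hpow := eventually_norm_pow_le (1 + (h : ℂ) • x) (ρ := 1 - h * δ / 2) (ρ' := 1 - h * δ / 4)
    (by linarith) (by linarith) fun w hw => by
      have hh0 : (h : ℂ) ≠ 0 := by exact_mod_cast hh.ne'
      have hz := mem_spectrum_of_one_add_smul hh0 hw
      have := norm_one_add_mul_le hh hh1 hh2 (hx _ hz) (spectrum.norm_le_norm_of_mem hz)
      rwa [mul_div_cancel₀ _ hh0, add_sub_cancel] at this
  have hstep : ∀ᶠ n : ℕ in atTop, ‖NormedSpace.exp ((h : ℂ) • x) ^ n‖ ≤ 1 := by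
    filter_upwards [hpow] with n hn
    rw [hq2, hqc.mul_pow]
    calc ‖q ^ n * (1 + (h : ℂ) • x) ^ n‖ ≤ ‖q ^ n‖ * ‖(1 + (h : ℂ) • x) ^ n‖ := norm_mul_le _ _
      _ ≤ (1 + δ / 4 * h) ^ n * (1 - h * δ / 4) ^ n := by
        gcongr
        exact (norm_pow_le _ _).trans (pow_le_pow_left₀ (norm_nonneg _) hq1 n)
      _ = ((1 + δ / 4 * h) * (1 - h * δ / 4)) ^ n := (mul_pow _ _ _).symm
      _ ≤ 1 := pow_le_one₀ (mul_nonneg (by positivity) (by linarith))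
          (by nlinarith [sq_nonneg (h * δ)])
  obtain ⟨N, hN⟩ := eventually_atTop.1 hstep
  -- The interval [0, (N + 1)h] contains the early times, at which the powers are not yet
  -- controlled, and also every remainder t − nh in [0, h).
  obtain ⟨M, hM⟩ := (isCompact_Icc (a := (0 : ℝ)) (b := (N + 1) * h)).exists_bound_of_continuousOn
    (continuous_exp_smul x).continuousOn
  refine ⟨M, fun t ht => ?_⟩
  by_cases htN : t ≤ (N + 1) * h
  · exact hM t ⟨ht, htN⟩
  have h0 : 0 ≤ t / h := by positivity
  set n := ⌊t / h⌋₊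
  have hn1 : n * h ≤ t := (le_div_iff₀ hh).1 (Nat.floor_le h0)
  have hn2 : t < (n + 1) * h := (div_lt_iff₀ hh).1 (Nat.lt_floor_add_one _)
  have hnN : N ≤ n := by
    refine Nat.le_floor ((le_div_iff₀ hh).2 ?_)
    push Not at htN
    nlinarith
  have e : (t : ℂ) = n * (h : ℂ) + ((t - n * h : ℝ) : ℂ) := by push_cast; ring
  rw [e, exp_add_smul, exp_natCast_mul_smul]
  have hr : ‖NormedSpace.exp (((t - n * h : ℝ) : ℂ) • x)‖ ≤ M := by
    refine hM _ ⟨by linarith, ?_⟩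
    have : (0 : ℝ) ≤ N * h := by positivity
    nlinarith
  calc _ ≤ ‖NormedSpace.exp ((h : ℂ) • x) ^ n‖ * ‖NormedSpace.exp (((t - n * h : ℝ) : ℂ) • x)‖ :=
        norm_mul_le _ _
    _ ≤ 1 * M := by gcongr; exact hN n hnN
    _ = M := one_mul M

/-- The growth bound of `exp(t x)` is at most the spectral abscissa of `x`. -/
lemma exists_norm_exp_le_of_spectrum_le (x : A) {a b : ℝ} (hab : b < a)
    (hx : ∀ z ∈ _root_.spectrum ℂ x, z.re ≤ b) :
    ∃ M : ℝ, ∀ t : ℝ, 0 ≤ t → ‖NormedSpace.exp ((t : ℂ) • x)‖ ≤ M * Real.exp (a * t) := by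
  obtain ⟨M, hM⟩ := exists_norm_exp_le_of_spectrum_neg (x - algebraMap ℂ A a) (δ := a - b)
    (by linarith) fun z hz => by
      have h1 : z + a ∈ _root_.spectrum ℂ x := by
        have := spectrum.add_mem_add_iff (R := ℂ) (s := (a : ℂ)) (r := z)
          (a := x - algebraMap ℂ A a)
        rw [add_sub_cancel] at this
        exact this.2 hz
      have := hx _ h1
      simp at this
      linarith
  refine ⟨M, fun t ht => ?_⟩
  let _ : NormedAlgebra ℚ A := NormedAlgebra.restrictScalars ℚ ℂ A
  have e : (t : ℂ) • x = algebraMap ℂ A (a * t) + (t : ℂ) • (x - algebraMap ℂ A a) := by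
    rw [smul_sub, Algebra.algebraMap_eq_smul_one, Algebra.algebraMap_eq_smul_one, smul_smul,
      mul_comm]
    abel
  rw [e, NormedSpace.exp_add_of_commute (Algebra.commute_algebraMap_left _ _), 
    ← NormedSpace.algebraMap_exp_comm (𝕂 := ℂ)]
  refine (norm_mul_le _ _).trans ?_
  rw [norm_algebraMap', ← Complex.exp_eq_exp_ℂ, mul_comm]
  gcongr
  · exact (norm_nonneg _).trans (hM t ht)
  · exact hM t ht
  · rw [Complex.norm_exp]
    simp

/-- The inclusion exp(tσ(x)) ⊆ σ(exp(tx)) gives exp(t Re z) ≤ M exp(at) for all t > 0, which is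
impossible for large t if Re z > a. -/
lemma re_le_of_norm_exp_le (x : A) {a M : ℝ}
    (h : ∀ t : ℝ, 0 ≤ t → ‖NormedSpace.exp ((t : ℂ) • x)‖ ≤ M * Real.exp (a * t))
    {z : ℂ} (hz : z ∈ _root_.spectrum ℂ x) : z.re ≤ a := by
  by_contra hlt
  push Not at hlt
  have h1 : ∀ t : ℝ, 0 < t → Real.exp ((z.re - a) * t) ≤ M := fun t ht => by
    have ht0 : (t : ℂ) ≠ 0 := by exact_mod_cast ht.ne'
    have h2 : (t : ℂ) * z ∈ _root_.spectrum ℂ ((t : ℂ) • x) :=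
      (spectrum.smul_mem_smul_iff (r := Units.mk0 (t : ℂ) ht0)).2 hz
    have h3 := (spectrum.norm_le_norm_of_mem (spectrum.exp_mem_exp _ h2)).trans (h t ht.le)
    rw [← Complex.exp_eq_exp_ℂ, Complex.norm_exp] at h3
    simp only [Complex.mul_re, Complex.ofReal_re, Complex.ofReal_im, zero_mul, sub_zero] at h3
    rw [sub_mul, Real.exp_sub, div_le_iff₀ (Real.exp_pos _), mul_comm z.re]
    exact h3
  have h4 : Tendsto (fun t : ℝ => Real.exp ((z.re - a) * t)) atTop atTop :=
    Real.tendsto_exp_atTop.comp (tendsto_id.const_mul_atTop (sub_pos.2 hlt))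
  obtain ⟨t, ht1, ht2⟩ := ((h4.eventually_gt_atTop M).and (eventually_gt_atTop 0)).exists
  exact absurd (h1 t ht2) (not_le.2 ht1)

end BoundedGrowth

/-! ### Block diagonal model operators `iκν(n) + C` on `ℓ²(ℤ, H)` -/

section DominatedConvergence

variable {ι : Type*} {E : Type*} [NormedAddCommGroup E]

/-- Dominated convergence in `ℓ²`. -/
lemma tendsto_lp_of_dominated {α : Type*} {l : Filter α} {f : α → lp (fun _ : ι => E) 2}
    {g : lp (fun _ : ι => E) 2} {b : ι → ℝ} (hb : Summable fun i => b i ^ 2)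
    (hfb : ∀ᶠ t in l, ∀ i, ‖f t i - g i‖ ≤ b i)
    (hf : ∀ i, Tendsto (fun t => f t i) l (𝓝 (g i))) : Tendsto f l (𝓝 g) := by
  rw [tendsto_iff_norm_sub_tendsto_zero]
  have h1 : Tendsto (fun t => ∑' i, ‖(f t - g) i‖ ^ 2) l (𝓝 (∑' _ : ι, 0)) := by
    refine tendsto_tsum_of_dominated_convergence hb (fun i => ?_) ?_
    · have := (tendsto_iff_norm_sub_tendsto_zero.1 (hf i)).pow 2
      simpa using this
    · filter_upwards [hfb] with t ht i
      rw [norm_pow, norm_norm]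
      exact pow_le_pow_left₀ (norm_nonneg _) (ht i) 2
  have h2 : Tendsto (fun t => ‖f t - g‖ ^ 2) l (𝓝 0) := by
    simpa only [lp_norm_sq, tsum_zero] using h1
  have h3 := h2.sqrt
  simpa only [Real.sqrt_sq (norm_nonneg _), Real.sqrt_zero] using h3

end DominatedConvergence

/-! ### The model group and its generator -/

section Model

variable {H : Type*} [NormedAddCommGroup H] [InnerProductSpace ℂ H] [CompleteSpace H]

/-- Multipliers converging pointwise to zero kill a block Hilbert–Schmidt matrix in the limit. -/
lemma tendsto_norm_schur {α : Type*} {l : Filter α} (a : BlockHS H) {γ : α → ℤ × ℤ → ℂ} {K : ℝ}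
    (hγ : ∀ t, ∃ K : ℝ, ∀ p, ‖γ t p‖ ≤ K) (hK : ∀ t p, ‖γ t p‖ ≤ K)
    (h0 : ∀ p, Tendsto (fun t => γ t p) l (𝓝 0)) :
    Tendsto (fun t => ‖a.schur (γ t) (hγ t)‖) l (𝓝 0) := by
  have : Tendsto (fun t => a.schur (γ t) (hγ t)) l (𝓝 0) := by
    refine tendsto_lp_of_dominated (b := fun p => K * ‖a p‖) ?_ ?_ ?_
    · simpa only [mul_pow] using (summable_norm_sq a).mul_left (K ^ 2)
    · refine Eventually.of_forall fun t p => ?_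
      rw [BlockHS.schur_apply, lp.coeFn_zero, Pi.zero_apply, sub_zero, norm_smul]
      gcongr
      exact hK t p
    · intro p
      simpa [BlockHS.schur_apply] using (h0 p).smul_const (a p)
  simpa using this.norm

/-- The frequencies of the model operator: `0` on the central block `|n| ≤ m`, and `n` outside. -/
def modelFreq (m : ℕ) (n : ℤ) : ℤ := if |n| ≤ m then 0 else n

lemma modelFreq_of_lt {m : ℕ} {n : ℤ} (h : (m : ℤ) < |n|) : modelFreq m n = n :=
  if_neg (not_le.2 h)

/-- An index outside the central block is nonzero and shares its frequency with no other index, so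
the blocks there are single entries. -/
lemma modelFreq_ne {m : ℕ} {n j : ℤ} (h : (m : ℤ) < |n|) (hj : j ≠ n) :
    modelFreq m j ≠ modelFreq m n := by
  rw [modelFreq_of_lt h, modelFreq]
  split_ifs
  · rintro rfl
    simp at h
    omega
  · exact hj

/-- The phase `e^{iκν(n)t}`. -/
def modelPhase (κ : ℝ) (m : ℕ) (t : ℝ) (n : ℤ) : ℂ :=
  Complex.exp (Complex.I * ((κ * modelFreq m n * t : ℝ) : ℂ))

lemma norm_modelPhase (κ : ℝ) (m : ℕ) (t : ℝ) (n : ℤ) : ‖modelPhase κ m t n‖ = 1 := by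
  rw [modelPhase, mul_comm]
  exact Complex.norm_exp_ofReal_mul_I _

/-- The unitary group `x(n) ↦ e^{iκν(n)t} x(n)`. -/
def modelUnitary (H : Type*) [NormedAddCommGroup H] [InnerProductSpace ℂ H]
    (κ : ℝ) (m : ℕ) (t : ℝ) : SeqL2 H →L[ℂ] SeqL2 H :=
  diagOp H (modelPhase κ m t) ⟨1, fun n => (norm_modelPhase κ m t n).le⟩

lemma modelUnitary_apply (κ : ℝ) (m : ℕ) (t : ℝ) (x : SeqL2 H) (n : ℤ) :
    modelUnitary H κ m t x n = modelPhase κ m t n • x n := rfl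

lemma modelUnitary_zero (κ : ℝ) (m : ℕ) : modelUnitary H κ m 0 = 1 := by
  ext x : 1
  refine lp.ext <| funext fun n => ?_
  simp [modelUnitary_apply, modelPhase]

lemma modelUnitary_add (κ : ℝ) (m : ℕ) (s t : ℝ) :
    modelUnitary H κ m (s + t) = modelUnitary H κ m s * modelUnitary H κ m t := by
  ext x : 1
  refine lp.ext <| funext fun n => ?_
  rw [mul_apply_eq_comp, modelUnitary_apply, modelUnitary_apply, modelUnitary_apply,
    smul_smul, modelPhase, modelPhase, modelPhase, ← Complex.exp_add]
  congr 2
  push_cast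
  ring

lemma modelUnitary_neg (κ : ℝ) (m : ℕ) (t : ℝ) :
    modelUnitary H (-κ) m t = modelUnitary H κ m (-t) := by
  ext x : 1
  refine lp.ext <| funext fun n => ?_
  rw [modelUnitary_apply, modelUnitary_apply, modelPhase, modelPhase]
  congr 4
  ring

lemma norm_modelUnitary_apply (κ : ℝ) (m : ℕ) (t : ℝ) (x : SeqL2 H) :
    ‖modelUnitary H κ m t x‖ = ‖x‖ := by
  have h : ‖modelUnitary H κ m t x‖ ^ 2 = ‖x‖ ^ 2 := by
    rw [lp_norm_sq, lp_norm_sq]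
    simp [modelUnitary_apply, norm_smul, norm_modelPhase]
  exact (sq_eq_sq₀ (norm_nonneg _) (norm_nonneg _)).1 h

lemma continuous_modelUnitary (κ : ℝ) (m : ℕ) (x : SeqL2 H) :
    Continuous fun t => modelUnitary H κ m t x := by
  refine continuous_iff_continuousAt.2 fun t => ?_
  refine tendsto_lp_of_dominated (b := fun n => 2 * ‖x n‖) ?_ ?_ ?_
  · simpa only [mul_pow] using (summable_norm_sq x).mul_left (2 ^ 2)
  · refine Eventually.of_forall fun s n => ?_
    refine (norm_sub_le _ _).trans ?_
    rw [modelUnitary_apply, modelUnitary_apply, norm_smul, norm_smul, norm_modelPhase,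
      norm_modelPhase]
    linarith
  · intro n
    simp only [modelUnitary_apply]
    have : Continuous fun s => modelPhase κ m s n • x n := by
      unfold modelPhase
      fun_prop
    exact this.tendsto t

lemma tendsto_modelPhase_sub_one (κ : ℝ) (m : ℕ) (n : ℤ) :
    Tendsto (fun t : ℝ => (t : ℂ)⁻¹ * (modelPhase κ m t n - 1)) (𝓝[≠] 0)
      (𝓝 (Complex.I * (κ * modelFreq m n : ℝ))) := by
  have h : HasDerivAt (fun t : ℝ => modelPhase κ m t n)
      (Complex.I * (κ * modelFreq m n : ℝ)) 0 := by
    have h1 : HasDerivAt (fun t : ℝ => Complex.I * ((κ * modelFreq m n * t : ℝ) : ℂ))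
        (Complex.I * (κ * modelFreq m n : ℝ)) 0 := by
      have := ((hasDerivAt_id (0 : ℝ)).const_mul (κ * modelFreq m n)).ofReal_comp.const_mul
        Complex.I
      simpa using this
    simpa [modelPhase] using h1.cexp
  have h2 := hasDerivAt_iff_tendsto_slope.1 h
  refine h2.congr fun t => ?_
  simp [slope_def_module, modelPhase]

lemma norm_modelPhase_sub_one_le (κ : ℝ) (m : ℕ) (t : ℝ) (n : ℤ) :
    ‖(t : ℂ)⁻¹ * (modelPhase κ m t n - 1)‖ ≤ ‖Complex.I * (κ * modelFreq m n : ℝ)‖ := by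
  rcases eq_or_ne t 0 with rfl | ht
  · simp only [Complex.ofReal_zero, inv_zero, zero_mul, norm_zero]
    positivity
  rw [norm_mul, norm_inv, Complex.norm_real, inv_mul_le_iff₀ (norm_pos_iff.2 ht), norm_mul,
    Complex.norm_I, one_mul, Complex.norm_real, ← norm_mul, mul_comm t]
  exact Real.norm_exp_I_mul_ofReal_sub_one_le

/-- Since |(exp(iθt) − 1)/t| ≤ |θ|, the difference quotients are dominated by `w` itself, and
coordinatewise convergence suffices. -/
lemma tendsto_modelUnitary_sub (κ : ℝ) (m : ℕ) {x w : SeqL2 H}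
    (hw : ∀ n, w n = (Complex.I * (κ * modelFreq m n : ℝ)) • x n) :
    Tendsto (fun t : ℝ => (t : ℂ)⁻¹ • (modelUnitary H κ m t x - x)) (𝓝[≠] 0) (𝓝 w) := by
  have e : ∀ (t : ℝ) n, ((t : ℂ)⁻¹ • (modelUnitary H κ m t x - x) : SeqL2 H) n
      = ((t : ℂ)⁻¹ * (modelPhase κ m t n - 1)) • x n := fun t n => by
    simp only [lp.coeFn_smul, Pi.smul_apply, lp.coeFn_sub, Pi.sub_apply, modelUnitary_apply]
    rw [mul_smul, sub_smul, one_smul]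
  refine tendsto_lp_of_dominated (b := fun n => 2 * ‖w n‖) ?_ ?_ ?_
  · simpa only [mul_pow] using (summable_norm_sq w).mul_left (2 ^ 2)
  · refine Eventually.of_forall fun t n => (norm_sub_le _ _).trans ?_
    have : ‖((t : ℂ)⁻¹ * (modelPhase κ m t n - 1)) • x n‖ ≤ ‖w n‖ := by
      rw [hw, norm_smul, norm_smul]
      gcongr
      exact norm_modelPhase_sub_one_le κ m t n
    rw [e]
    linarith
  · intro n
    simp only [e]
    rw [hw]
    exact (tendsto_modelPhase_sub_one κ m n).smul_const (x n)

variable (κ : ℝ) (m : ℕ) (c : BlockHS H)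

/-- The matrix `c` only couples indices with the same model frequency. -/
def IsBlockDiag (m : ℕ) (c : BlockHS H) : Prop :=
  ∀ p : ℤ × ℤ, modelFreq m p.1 ≠ modelFreq m p.2 → c p = 0

/-- The group `e^{iκν(n)t} exp(tC)` generated by the model operator. -/
def modelGroup (t : ℝ) : SeqL2 H →L[ℂ] SeqL2 H :=
  modelUnitary H κ m t * NormedSpace.exp ((t : ℂ) • c.op)

variable {m c} in
lemma IsBlockDiag.comm_unitary (hc : IsBlockDiag m c) (t : ℝ) :
    Commute c.op (modelUnitary H κ m t) :=
  c.op_comm_diagOp _ fun p hp => hc p fun h => hp (by rw [modelPhase, modelPhase, h])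

lemma modelGroup_apply (t : ℝ) (x : SeqL2 H) :
    modelGroup κ m c t x = modelUnitary H κ m t (NormedSpace.exp ((t : ℂ) • c.op) x) := rfl

lemma modelGroup_zero : modelGroup κ m c 0 = 1 := by
  simp [modelGroup, modelUnitary_zero]

lemma modelGroup_neg (t : ℝ) : modelGroup (-κ) m (-c) t = modelGroup κ m c (-t) := by
  simp [modelGroup, modelUnitary_neg, BlockHS.op_neg]

variable {m c} in
lemma modelGroup_add (hc : IsBlockDiag m c) (s t : ℝ) :
    modelGroup κ m c (s + t) = modelGroup κ m c s * modelGroup κ m c t := by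
  have h : Commute (NormedSpace.exp ((s : ℂ) • c.op)) (modelUnitary H κ m t) :=
    ((hc.comm_unitary κ t).smul_left (s : ℂ)).exp_left
  have he : NormedSpace.exp (((s : ℂ) + t) • c.op)
      = NormedSpace.exp ((s : ℂ) • c.op) * NormedSpace.exp ((t : ℂ) • c.op) := exp_add_smul c.op s t
  unfold modelGroup
  rw [modelUnitary_add, Complex.ofReal_add, he]
  simp only [mul_assoc]
  rw [← mul_assoc (NormedSpace.exp ((s : ℂ) • c.op)), h.eq, mul_assoc]

lemma tendsto_modelUnitary {α : Type*} {l : Filter α} {τ : α → ℝ} {t : ℝ} (hτ : Tendsto τ l (𝓝 t))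
    {y : α → SeqL2 H} {x : SeqL2 H} (hy : Tendsto y l (𝓝 x)) :
    Tendsto (fun s => modelUnitary H κ m (τ s) (y s)) l (𝓝 (modelUnitary H κ m t x)) := by
  have h1 : Tendsto (fun s => modelUnitary H κ m (τ s) x) l (𝓝 (modelUnitary H κ m t x)) :=
    ((continuous_modelUnitary κ m x).tendsto t).comp hτ
  rw [tendsto_iff_norm_sub_tendsto_zero]
  refine squeeze_zero (fun _ => norm_nonneg _) (g := fun s => ‖y s - x‖ +
    ‖modelUnitary H κ m (τ s) x - modelUnitary H κ m t x‖) (fun s => ?_) ?_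
  · rw [← norm_modelUnitary_apply κ m (τ s) (y s - x), map_sub]
    exact norm_sub_le_norm_sub_add_norm_sub _ _ _
  · simpa using (tendsto_iff_norm_sub_tendsto_zero.1 hy).add
      (tendsto_iff_norm_sub_tendsto_zero.1 h1)

lemma continuous_modelGroup (x : SeqL2 H) : Continuous fun t => modelGroup κ m c t x := by
  refine continuous_iff_continuousAt.2 fun t => ?_
  have h := ((continuous_exp_smul c.op).clm_apply (continuous_const (y := x))).tendsto t
  exact tendsto_modelUnitary κ m tendsto_id h

variable {κ m c} in
/-- The generator of the model group. -/
lemma modelGroup_generator (x z : SeqL2 H) :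
    (∀ n, z n = (Complex.I * (κ * modelFreq m n : ℝ)) • x n + c.op x n) ↔
      Tendsto (fun t : ℝ => (t : ℂ)⁻¹ • (modelGroup κ m c t x - x)) (𝓝[≠] 0) (𝓝 z) := by
  have hexp : Tendsto (fun t : ℝ => (t : ℂ)⁻¹ • (NormedSpace.exp ((t : ℂ) • c.op) x - x))
      (𝓝[≠] 0) (𝓝 (c.op x)) := by
    have h0 : HasDerivAt (fun u : ℂ => NormedSpace.exp (u • c.op)) c.op ((0 : ℝ) : ℂ) := by
      simpa using hasDerivAt_exp_smul_const c.op (0 : ℂ)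
    have h1 := h0.scomp_of_eq (0 : ℝ) (Complex.ofRealCLM.hasDerivAt (x := (0 : ℝ))) rfl
    have h2 : HasDerivAt (fun t : ℝ => NormedSpace.exp ((t : ℂ) • c.op) x) (c.op x) 0 := by
      have := ((ContinuousLinearMap.apply ℂ (SeqL2 H) x).restrictScalars ℝ).hasFDerivAt.comp_hasDerivAt
        (0 : ℝ) h1
      simpa [Function.comp_def] using this
    refine (hasDerivAt_iff_tendsto_slope.1 h2).congr fun t => ?_
    simp only [slope_def_module, sub_zero, Complex.ofReal_zero, zero_smul, NormedSpace.exp_zero,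
      one_apply_eq_self]
    rw [← Complex.ofReal_inv]
    rfl
  have hU : Tendsto (fun t : ℝ => modelUnitary H κ m t
      ((t : ℂ)⁻¹ • (NormedSpace.exp ((t : ℂ) • c.op) x - x))) (𝓝[≠] 0) (𝓝 (c.op x)) := by
    have := tendsto_modelUnitary κ m (t := 0) (tendsto_id.mono_left nhdsWithin_le_nhds) hexp
    simpa [modelUnitary_zero] using this
  -- The quotient of exp(tC) converges for every x, so after this splitting the domain is decided by
  -- the unitary part alone.
  have e : ∀ t : ℝ, (t : ℂ)⁻¹ • (modelGroup κ m c t x - x) = modelUnitary H κ m t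
      ((t : ℂ)⁻¹ • (NormedSpace.exp ((t : ℂ) • c.op) x - x))
      + (t : ℂ)⁻¹ • (modelUnitary H κ m t x - x) := fun t => by
    rw [map_smul, map_sub, modelGroup_apply, ← smul_add]
    congr 1
    abel
  constructor
  · intro h
    have h1 : Tendsto (fun t : ℝ => (t : ℂ)⁻¹ • (modelUnitary H κ m t x - x)) (𝓝[≠] 0)
        (𝓝 (z - c.op x)) := tendsto_modelUnitary_sub κ m fun n => by
      rw [lp.coeFn_sub, Pi.sub_apply, h n, add_sub_cancel_right]
    simpa [e] using hU.add h1
  · intro h n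
    have h1 := h.sub hU
    simp only [e, add_sub_cancel_left] at h1
    -- Norm convergence implies convergence of each coordinate, and coordinatewise the limit of the
    -- unitary quotients is already known.
    have h2 := ((lp.evalCLM ℂ (fun _ : ℤ => H) 2 n).continuous.tendsto _).comp h1
    have h3 := (tendsto_modelPhase_sub_one κ m n).smul_const (x n)
    have h4 := tendsto_nhds_unique (h2.congr fun t => ?_) h3
    · rw [← h4]
      change z n = (z - c.op x : SeqL2 H) n + _
      rw [lp.coeFn_sub, Pi.sub_apply, sub_add_cancel]
    · change ((t : ℂ)⁻¹ • (modelUnitary H κ m t x - x) : SeqL2 H) n = _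
      simp only [lp.coeFn_smul, Pi.smul_apply, lp.coeFn_sub, Pi.sub_apply, modelUnitary_apply]
      rw [mul_smul, sub_smul, one_smul]

end Model

/-! ### Spectrum of the model operator -/

section ModelSpectrum

variable {H : Type*} [NormedAddCommGroup H] [InnerProductSpace ℂ H] [CompleteSpace H]

/-- `R` is the bounded inverse of `z - (iκν + C)` on `ℓ²(ℤ, H)`. -/
def IsModelResolvent (κ : ℝ) (m : ℕ) (c : BlockHS H) (z : ℂ) (R : SeqL2 H →L[ℂ] SeqL2 H) : Prop :=
  (∀ x n, (z - Complex.I * (κ * modelFreq m n : ℝ)) • R x n - c.op (R x) n = x n) ∧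
  ∀ u w : SeqL2 H, (∀ n, w n = (z - Complex.I * (κ * modelFreq m n : ℝ)) • u n - c.op u n) → R w = u

variable {κ : ℝ} {m : ℕ} {c : BlockHS H}

lemma isModelResolvent_of_injective {z : ℂ} {R : SeqL2 H →L[ℂ] SeqL2 H}
    (h : ∀ x n, (z - Complex.I * (κ * modelFreq m n : ℝ)) • R x n - c.op (R x) n = x n)
    (hinj : ∀ u : SeqL2 H,
      (∀ n, (z - Complex.I * (κ * modelFreq m n : ℝ)) • u n - c.op u n = 0) → u = 0) :
    IsModelResolvent κ m c z R := by
  refine ⟨h, fun u w hw => sub_eq_zero.1 (hinj _ fun n => ?_)⟩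
  have h1 := h w n
  rw [map_sub, lp.coeFn_sub, lp.coeFn_sub, Pi.sub_apply, Pi.sub_apply, smul_sub]
  rw [hw n] at h1
  rw [sub_sub_sub_comm, h1, sub_self]

/-- The projection onto the block of frequency `k`. -/
def blockProj (H : Type*) [NormedAddCommGroup H] [InnerProductSpace ℂ H] (m : ℕ) (k : ℤ) :
    SeqL2 H →L[ℂ] SeqL2 H :=
  diagOp H (fun n => if modelFreq m n = k then 1 else 0) ⟨1, fun n => by split_ifs <;> simp⟩

lemma blockProj_apply (k : ℤ) (x : SeqL2 H) (n : ℤ) :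
    blockProj H m k x n = if modelFreq m n = k then x n else 0 := by
  rw [blockProj, diagOp_apply]
  split_ifs <;> simp

lemma IsBlockDiag.op_blockProj (hc : IsBlockDiag m c) (k : ℤ) (x : SeqL2 H) :
    c.op (blockProj H m k x) = blockProj H m k (c.op x) :=
  congrArg (fun T : SeqL2 H →L[ℂ] SeqL2 H => T x)
    (c.op_comm_diagOp (φ := fun n => if modelFreq m n = k then 1 else 0) _
      fun p hp => hc p fun h => hp (by simp only [h])).eq

/-- A kernel vector of `z - (iκν + C)` has all its block components in kernels. -/
lemma IsBlockDiag.eq_zero_of_blocks (hc : IsBlockDiag m c) {u : SeqL2 H} {f : ℤ → ℂ}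
    (hu : ∀ n, f (modelFreq m n) • u n - c.op u n = 0)
    (h : ∀ k (v : SeqL2 H), (∀ n, v n ≠ 0 → modelFreq m n = k) →
      (∀ n, f k • v n - c.op v n = 0) → v = 0) : u = 0 := by
  refine lp.ext <| funext fun n => ?_
  have h1 := h (modelFreq m n) (blockProj H m (modelFreq m n) u) (fun j hj => ?_) (fun j => ?_)
  · have h2 := congrArg (fun v : SeqL2 H => v n) h1
    simpa [blockProj_apply] using h2
  · by_contra hne
    exact hj (by rw [blockProj_apply, if_neg hne])
  · rw [hc.op_blockProj, blockProj_apply, blockProj_apply]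
    split_ifs with hj
    · rw [← hj]
      exact hu j
    · simp

lemma exists_large_freq (hκ : κ ≠ 0) (z : ℂ) (B : ℝ) :
    ∃ N : ℕ, ∀ k : ℤ, (N : ℤ) < |k| → B ≤ ‖z - Complex.I * (κ * k : ℝ)‖ := by
  obtain ⟨N, hN⟩ := exists_nat_ge ((B + ‖z‖) / |κ|)
  refine ⟨N, fun k hk => ?_⟩
  have h1 : (N : ℝ) < |(k : ℝ)| := by exact_mod_cast hk
  have h2 : B + ‖z‖ ≤ |κ| * |(k : ℝ)| := by
    rw [div_le_iff₀' (abs_pos.2 hκ)] at hN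
    exact hN.trans (by gcongr)
  have h3 := norm_sub_norm_le (Complex.I * (κ * k : ℝ)) z
  rw [norm_sub_rev, norm_mul, Complex.norm_I, one_mul, Complex.norm_real, Real.norm_eq_abs,
    abs_mul] at h3
  linarith

lemma isUnit_iff_notMem_spectrum {z : ℂ} : z ∉ _root_.spectrum ℂ c.op ↔
    IsUnit (algebraMap ℂ (SeqL2 H →L[ℂ] SeqL2 H) z - c.op) := spectrum.notMem_iff

lemma algebraMap_sub_op_apply (z : ℂ) (u : SeqL2 H) (n : ℤ) :
    (algebraMap ℂ (SeqL2 H →L[ℂ] SeqL2 H) z - c.op) u n = z • u n - c.op u n := by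
  rw [Algebra.algebraMap_eq_smul_one]
  rfl

lemma sub_op_inverse_apply {z : ℂ} (hz : z ∉ _root_.spectrum ℂ c.op) (x : SeqL2 H) (n : ℤ) :
    z • Ring.inverse (algebraMap ℂ (SeqL2 H →L[ℂ] SeqL2 H) z - c.op) x n
      - c.op (Ring.inverse (algebraMap ℂ (SeqL2 H →L[ℂ] SeqL2 H) z - c.op) x) n = x n := by
  have h := congrArg (fun T : SeqL2 H →L[ℂ] SeqL2 H => T x n)
    (Ring.mul_inverse_cancel _ (isUnit_iff_notMem_spectrum.1 hz))
  rwa [mul_apply_eq_comp, algebraMap_sub_op_apply] at h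

lemma eq_zero_of_notMem_spectrum {z : ℂ} (hz : z ∉ _root_.spectrum ℂ c.op) {u : SeqL2 H}
    (hu : ∀ n, z • u n - c.op u n = 0) : u = 0 := by
  have h := congrArg (fun T : SeqL2 H →L[ℂ] SeqL2 H => T u)
    (Ring.inverse_mul_cancel _ (isUnit_iff_notMem_spectrum.1 hz))
  have h1 : (algebraMap ℂ (SeqL2 H →L[ℂ] SeqL2 H) z - c.op) u = 0 := lp.ext <| funext fun n =>
    (algebraMap_sub_op_apply z u n).trans (hu n)
  rw [mul_apply_eq_comp, h1, map_zero] at h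
  exact h.symm

/-- Gluing a vector from finitely many blocks and a remainder. -/
def glueBlocks (m N : ℕ) (y : ℤ → SeqL2 H →L[ℂ] SeqL2 H) (D : SeqL2 H →L[ℂ] SeqL2 H) :
    SeqL2 H →L[ℂ] SeqL2 H :=
  ∑ k ∈ Finset.Icc (-N : ℤ) N, blockProj H m k * y k + D

lemma mem_Icc_iff_not_lt_abs {N : ℕ} {k : ℤ} : k ∈ Finset.Icc (-N : ℤ) N ↔ ¬ (N : ℤ) < |k| := by
  rw [Finset.mem_Icc, not_lt, abs_le]

lemma glueBlocks_apply (N : ℕ) (y : ℤ → SeqL2 H →L[ℂ] SeqL2 H) (D : SeqL2 H →L[ℂ] SeqL2 H)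
    (x : SeqL2 H) (n : ℤ) (hD : ¬ (N : ℤ) < |modelFreq m n| → D x n = 0) :
    glueBlocks m N y D x n =
      if (N : ℤ) < |modelFreq m n| then D x n else y (modelFreq m n) x n := by
  have h : ∀ s : Finset ℤ, (∑ k ∈ s, blockProj H m k * y k) x n
      = if modelFreq m n ∈ s then y (modelFreq m n) x n else 0 := fun s => by
    rw [_root_.sum_apply, lp.coeFn_sum, Finset.sum_apply]
    simp only [mul_apply_eq_comp, blockProj_apply]
    rw [Finset.sum_ite_eq]
  rw [glueBlocks, _root_.add_apply, lp.coeFn_add, Pi.add_apply, h]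
  simp only [mem_Icc_iff_not_lt_abs]
  by_cases hn : (N : ℤ) < |modelFreq m n|
  · simp [hn]
  · simp [hn, hD hn]

/-- C commutes with every block projection, so it acts on a glued vector piece by piece. -/
lemma op_glueBlocks_apply (hc : IsBlockDiag m c) (N : ℕ) (y : ℤ → SeqL2 H →L[ℂ] SeqL2 H)
    (D : SeqL2 H →L[ℂ] SeqL2 H) (x : SeqL2 H) (n : ℤ)
    (hD : ¬ (N : ℤ) < |modelFreq m n| → c.op (D x) n = 0) :
    c.op (glueBlocks m N y D x) n =
      if (N : ℤ) < |modelFreq m n| then c.op (D x) n else c.op (y (modelFreq m n) x) n := by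
  have h : c.op (glueBlocks m N y D x)
      = glueBlocks m N (fun k => c.op * y k) (c.op * D) x := by
    simp only [glueBlocks, _root_.add_apply, _root_.sum_apply, map_add, map_sum,
      mul_apply_eq_comp, hc.op_blockProj]
  rw [h, glueBlocks_apply N (fun k => c.op * y k) (c.op * D) x n hD]
  rfl

/-- The projection onto the blocks of frequency larger than `N`. -/
def tailProj (H : Type*) [NormedAddCommGroup H] [InnerProductSpace ℂ H] (m N : ℕ) :
    SeqL2 H →L[ℂ] SeqL2 H :=
  diagOp H (fun n => if (N : ℤ) < |modelFreq m n| then 1 else 0)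
    ⟨1, fun n => by split_ifs <;> simp⟩

lemma tailProj_apply (N : ℕ) (x : SeqL2 H) (n : ℤ) :
    tailProj H m N x n = if (N : ℤ) < |modelFreq m n| then x n else 0 := by
  rw [tailProj, diagOp_apply]
  split_ifs <;> simp

lemma IsBlockDiag.op_tailProj (hc : IsBlockDiag m c) (N : ℕ) (x : SeqL2 H) :
    c.op (tailProj H m N x) = tailProj H m N (c.op x) :=
  congrArg (fun T : SeqL2 H →L[ℂ] SeqL2 H => T x)
    (c.op_comm_diagOp (φ := fun n => if (N : ℤ) < |modelFreq m n| then 1 else 0) _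
      fun p hp => hc p fun h => hp (by simp only [h])).eq

/-- Removing the columns of small frequency leaves the tail of a square summable family. This
smallness is what the Hilbert–Schmidt property provides and boundedness alone would not. -/
lemma exists_norm_op_tailProj_lt (m : ℕ) (c : BlockHS H) {ε : ℝ} (hε : 0 < ε) :
    ∃ N : ℕ, ‖c.op * tailProj H m N‖ < ε := by
  have hb : ∀ (N : ℕ) (p : ℤ × ℤ),
      ‖(if (N : ℤ) < |modelFreq m p.2| then 1 else 0 : ℂ)‖ ≤ 1 := fun N p => by
    split_ifs <;> simp
  have h := tendsto_norm_schur (l := atTop) c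
    (γ := fun (N : ℕ) p => if (N : ℤ) < |modelFreq m p.2| then 1 else 0) (K := 1)
    (fun N => ⟨1, hb N⟩) hb fun p => by
      refine tendsto_const_nhds.congr' ?_
      filter_upwards [eventually_ge_atTop (|modelFreq m p.2|).toNat] with N hN
      rw [if_neg]
      omega
  obtain ⟨N, hN⟩ := (h.eventually (gt_mem_nhds hε)).exists
  refine ⟨N, lt_of_le_of_lt ?_ hN⟩
  refine le_trans (le_of_eq ?_) (BlockHS.norm_op_le _)
  congr 1
  refine SeqL2.clm_ext' fun l x j => ?_
  have e : tailProj H m N (lp.single 2 l x) 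
      = (if (N : ℤ) < |modelFreq m l| then (1 : ℂ) else 0) • lp.single 2 l x := by
    refine lp.ext <| funext fun i => ?_
    rw [tailProj_apply, lp.coeFn_smul, Pi.smul_apply]
    rcases eq_or_ne i l with rfl | hi
    · split_ifs <;> simp
    · rw [lp.single_apply_ne _ _ _ hi]
      simp
  rw [mul_apply_eq_comp, e, map_smul, lp.coeFn_smul, Pi.smul_apply, BlockHS.op_single,
    BlockHS.op_single, BlockHS.schur_apply]
  rfl

/-- `z` is in the resolvent set of `iκν + C` if all `z - iκk` are in the resolvent set of `C`. -/
lemma exists_isModelResolvent (hκ : κ ≠ 0) (hc : IsBlockDiag m c) {z : ℂ}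
    (hz : ∀ k : ℤ, z - Complex.I * (κ * k : ℝ) ∉ _root_.spectrum ℂ c.op) :
    ∃ R, IsModelResolvent κ m c z R := by
  -- With this constant the diagonal inverse D on the tail has norm at most 1/(2(‖C‖ + 1)), whence
  -- ‖CD‖ < 1 and 1 − CD is inverted by a Neumann series.
  obtain ⟨N, hN⟩ := exists_large_freq hκ z (2 * (‖c.op‖ + 1))
  set f : ℤ → ℂ := fun k => z - Complex.I * (κ * k : ℝ) with hf
  set φ : ℤ → ℂ := fun n =>
    if (N : ℤ) < |modelFreq m n| then (f (modelFreq m n))⁻¹ else 0 with hφ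
  have hpos : 0 < 2 * (‖c.op‖ + 1) := by positivity
  have hφb : ∀ n, ‖φ n‖ ≤ (2 * (‖c.op‖ + 1))⁻¹ := fun n => by
    rw [hφ]
    dsimp only
    split_ifs with h
    · rw [norm_inv]
      exact inv_anti₀ hpos (hN _ h)
    · rw [norm_zero]
      positivity
  set D := diagOp H φ ⟨_, hφb⟩
  have hcomm : ∀ x, c.op (D x) = D (c.op x) := fun x =>
    congrArg (fun T : SeqL2 H →L[ℂ] SeqL2 H => T x)
      (c.op_comm_diagOp _ fun p hp => hc p fun h => hp (by simp only [hφ, h])).eq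
  have hD : ∀ x n, D x n = φ n • x n := fun x n => diagOp_apply φ _ x n
  have hsmall : ‖c.op * D‖ < 1 := by
    have h1 : ‖c.op * D‖ ≤ ‖c.op‖ * (2 * (‖c.op‖ + 1))⁻¹ :=
      (norm_mul_le _ _).trans (by gcongr; exact norm_diagOp_le _ (by positivity) hφb)
    refine h1.trans_lt ?_
    rw [← div_eq_mul_inv, div_lt_one hpos]
    linarith [norm_nonneg c.op]
  have hunit := isUnit_one_sub_of_norm_lt_one hsmall
  set G := Ring.inverse (1 - c.op * D)
  have hG : ∀ x, G x - c.op (D (G x)) = x := fun x =>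
    congrArg (fun T : SeqL2 H →L[ℂ] SeqL2 H => T x) (Ring.mul_inverse_cancel _ hunit)
  have hzero : ∀ n, ¬ (N : ℤ) < |modelFreq m n| → φ n = 0 := fun n hn => if_neg hn
  -- On block k with |k| ≤ N the resolvent is (z − iκk − C)⁻¹; on the tail it is D(1 − CD)⁻¹.
  refine ⟨glueBlocks m N (fun k => Ring.inverse (algebraMap ℂ _ (f k) - c.op)) (D * G),
    isModelResolvent_of_injective (fun x n => ?_) fun u hu => ?_⟩
  · rw [glueBlocks_apply _ _ _ _ _ fun h => by rw [mul_apply_eq_comp, hD, hzero n h, zero_smul],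
      op_glueBlocks_apply hc _ _ _ _ _ fun h => by
        rw [mul_apply_eq_comp, hcomm, hD, hzero n h, zero_smul]]
    split_ifs with h
    · have h1 := congrArg (fun v : SeqL2 H => v n) (hG x)
      rw [lp.coeFn_sub, Pi.sub_apply] at h1
      have h2 : φ n = (f (modelFreq m n))⁻¹ := if_pos h
      have h3 : f (modelFreq m n) ≠ 0 := norm_pos_iff.1 (hpos.trans_le (hN _ h))
      rw [mul_apply_eq_comp, hD, h2, smul_smul, mul_inv_cancel₀ h3, one_smul]
      exact h1
    · exact sub_op_inverse_apply (hz _) x n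
  · refine hc.eq_zero_of_blocks (f := f) hu fun k v _ hv => ?_
    exact eq_zero_of_notMem_spectrum (hz k) hv

/-- `z ≠ 0` is in the resolvent set of `C` if all `z + iκk` are in that of `iκν + C`. -/
lemma notMem_spectrum_of_isModelResolvent (hc : IsBlockDiag m c) {z : ℂ} (hz0 : z ≠ 0)
    (hz : ∀ k : ℤ, ∃ R, IsModelResolvent κ m c (z + Complex.I * (κ * k : ℝ)) R) :
    z ∉ _root_.spectrum ℂ c.op := by
  rw [isUnit_iff_notMem_spectrum, ContinuousLinearMap.isUnit_iff_bijective]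
  have happ := algebraMap_sub_op_apply (c := c) z
  choose R hR1 hR2 using hz
  constructor
  · rw [injective_iff_map_eq_zero]
    intro u hu
    refine hc.eq_zero_of_blocks (f := fun _ => z) (fun n => ?_) fun k v hvk hv => ?_
    · rw [← happ, hu]
      rfl
    -- On a vector supported in block k the shift iκk cancels the frequency, so a kernel vector of z
    -- − C is one of z + iκk − (iκν + C).
    · rw [← hR2 k v 0 fun n => ?_, map_zero]
      rw [lp.coeFn_zero, Pi.zero_apply, ← hv n]
      by_cases hn : v n = 0
      · rw [hn, smul_zero, smul_zero]
      · rw [hvk n hn, add_sub_cancel_right]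
  · intro y
    -- The resolvents `R k` come without a uniform bound, so only finitely many of them are glued.
    -- On the tail z⁻¹C has norm below 1 and z − C is inverted by a Neumann series; this is where z
    -- ≠ 0 is needed.
    obtain ⟨N, hN⟩ := exists_norm_op_tailProj_lt m (z⁻¹ • c) one_pos
    have hop : (z⁻¹ • c).op = z⁻¹ • c.op := SeqL2.clm_ext' fun l x j => by
      simp [BlockHS.op_single]
    rw [hop] at hN
    have hunit := isUnit_one_sub_of_norm_lt_one hN
    set G := Ring.inverse (1 - z⁻¹ • c.op * tailProj H m N)
    have hG : G (z⁻¹ • y) - z⁻¹ • c.op (tailProj H m N (G (z⁻¹ • y))) = z⁻¹ • y :=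
      congrArg (fun T : SeqL2 H →L[ℂ] SeqL2 H => T (z⁻¹ • y)) (Ring.mul_inverse_cancel _ hunit)
    refine ⟨glueBlocks m N (fun k => R k * blockProj H m k)
      (tailProj H m N * (z⁻¹ • G)) y, lp.ext <| funext fun n => ?_⟩
    rw [happ, glueBlocks_apply _ _ _ _ _ fun h => by
        rw [mul_apply_eq_comp, tailProj_apply, if_neg h],
      op_glueBlocks_apply hc _ _ _ _ _ fun h => by
        rw [mul_apply_eq_comp, hc.op_tailProj, tailProj_apply, if_neg h]]
    split_ifs with h
    · rw [mul_apply_eq_comp, _root_.smul_apply, ← map_smul]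
      have h1 := congrArg (fun v : SeqL2 H => z • v n) hG
      simp only [lp.coeFn_sub, Pi.sub_apply, lp.coeFn_smul, Pi.smul_apply, smul_sub, smul_smul,
        mul_inv_cancel₀ hz0, one_smul] at h1
      rw [tailProj_apply, if_pos h]
      exact h1
    · have h1 := hR1 (modelFreq m n) (blockProj H m (modelFreq m n) y) n
      rw [add_sub_cancel_right, blockProj_apply, if_pos rfl] at h1
      exact h1

/-- The diagonal entries produce spectrum of `iκν + C` arbitrarily close to the imaginary axis. -/
lemma exists_no_modelResolvent [Nontrivial H] (κ : ℝ) (hc : IsBlockDiag m c) {ε : ℝ}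
    (hε : 0 < ε) : ∃ z : ℂ, -ε ≤ z.re ∧ ¬ ∃ R, IsModelResolvent κ m c z R := by
  have h1 : Tendsto (fun n : ℤ => ‖c (n, n)‖) cofinite (𝓝 0) := by
    have h : Summable fun n : ℤ => ‖c (n, n)‖ ^ 2 :=
      (summable_norm_sq c).comp_injective (i := fun n : ℤ => (n, n)) fun _ _ h => by simpa using h
    simpa [Real.sqrt_sq (norm_nonneg _)] using h.tendsto_cofinite_zero.sqrt
  have h2 : ∀ᶠ n : ℤ in cofinite, (m : ℤ) < |n| := by
    have : {n : ℤ | ¬ (m : ℤ) < |n|}.Finite :=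
      (Finset.Icc (-m : ℤ) m).finite_toSet.subset fun n hn => by
        rw [Finset.mem_coe]
        exact mem_Icc_iff_not_lt_abs.2 hn
    exact this
  -- Beyond the central block the n-th coordinate is decoupled from the others, so any w in the
  -- spectrum of `c (n, n)`, necessarily with |w| < ε, yields the spectral point w + iκn.
  obtain ⟨n, hn1, hn2⟩ := ((h1.eventually (gt_mem_nhds hε)).and h2).exists
  obtain ⟨w, hw⟩ := _root_.spectrum.nonempty (c (n, n))
  have hcol : ∀ j, j ≠ n → c (j, n) = 0 := fun j hj => hc _ (modelFreq_ne hn2 hj)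
  have hrow : ∀ j, j ≠ n → c (n, j) = 0 := fun j hj => hc _ (modelFreq_ne hn2 hj).symm
  refine ⟨w + Complex.I * (κ * n : ℝ), ?_, ?_⟩
  · have h3 := (Complex.abs_re_le_norm w).trans (spectrum.norm_le_norm_of_mem hw)
    have h4 := neg_abs_le w.re
    simp
    linarith
  · rintro ⟨R, hR1, hR2⟩
    apply hw
    rw [spectrum.mem_resolventSet_iff, ContinuousLinearMap.isUnit_iff_bijective]
    have happ : ∀ x, (algebraMap ℂ (H →L[ℂ] H) w - c (n, n)) x = w • x - c (n, n) x := fun x => by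
      simp [Algebra.algebraMap_eq_smul_one]
    constructor
    · rw [injective_iff_map_eq_zero]
      intro h hh
      rw [happ] at hh
      have h5 : lp.single 2 n h = (0 : SeqL2 H) := by
        rw [← hR2 (lp.single 2 n h) 0 fun j => ?_, map_zero]
        rw [BlockHS.op_single]
        rcases eq_or_ne j n with rfl | hj
        · rw [lp.single_apply_self, modelFreq_of_lt hn2, add_sub_cancel_right, hh]
          rfl
        · rw [hcol j hj, lp.single_apply_ne _ _ _ hj]
          simp
      simpa using congrArg (fun v : SeqL2 H => v n) h5
    · intro y
      have h6 := hR1 (lp.single 2 n y) n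
      refine ⟨R (lp.single 2 n y) n, ?_⟩
      rw [happ]
      rw [lp.single_apply_self, modelFreq_of_lt hn2, add_sub_cancel_right, BlockHS.op_apply,
        tsum_eq_single n fun j hj => by rw [hrow j hj]; rfl] at h6
      exact h6

end ModelSpectrum

/-! ### Operators similar to a model operator -/

section Similar

variable {H : Type*} [NormedAddCommGroup H] [InnerProductSpace ℂ H] [CompleteSpace H]
variable {E : Type*} [NormedAddCommGroup E] [NormedSpace ℂ E]

/-- `Ψ` transforms the operator `A` into the model operator `iκν + C`. -/
def IsModeledBy (Ψ : E ≃L[ℂ] SeqL2 H) (κ : ℝ) (m : ℕ) (c : BlockHS H) (A : E →ₗ.[ℂ] E) : Prop :=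
  ∀ x w : E, (x, w) ∈ A.graph ↔
    ∀ n, Ψ w n = (Complex.I * (κ * modelFreq m n : ℝ)) • Ψ x n + c.op (Ψ x) n

/-- The group on `E` corresponding to the model group. -/
def similarGroup (Ψ : E ≃L[ℂ] SeqL2 H) (κ : ℝ) (m : ℕ) (c : BlockHS H) (t : ℝ) : E →L[ℂ] E :=
  (Ψ.symm : SeqL2 H →L[ℂ] E) ∘L modelGroup κ m c t ∘L (Ψ : E →L[ℂ] SeqL2 H)

variable {Ψ : E ≃L[ℂ] SeqL2 H} {κ : ℝ} {m : ℕ} {c : BlockHS H} {A : E →ₗ.[ℂ] E}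

lemma similarGroup_apply (t : ℝ) (x : E) :
    similarGroup Ψ κ m c t x = Ψ.symm (modelGroup κ m c t (Ψ x)) := rfl

lemma similarGroup_neg (t : ℝ) : similarGroup Ψ (-κ) m (-c) t = similarGroup Ψ κ m c (-t) := by
  rw [similarGroup, similarGroup, modelGroup_neg]

lemma IsBlockDiag.neg (hc : IsBlockDiag m c) : IsBlockDiag m (-c) := fun p hp => by
  rw [lp.coeFn_neg, Pi.neg_apply, hc p hp, neg_zero]

/-- Negation preserves the model form; together with `similarGroup_neg` it reduces the backward
semigroup to the forward one. -/
lemma IsModeledBy.neg (hA : IsModeledBy Ψ κ m c A) : IsModeledBy Ψ (-κ) m (-c) (-A) := by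
  intro x w
  have h : (x, w) ∈ (-A).graph ↔ (x, -w) ∈ A.graph := by
    simp only [LinearPMap.mem_graph_iff]
    constructor
    · rintro ⟨y, hy1, hy2⟩
      refine ⟨y, hy1, ?_⟩
      rw [← hy2, LinearPMap.neg_apply]
      exact (neg_neg _).symm
    · rintro ⟨y, hy1, hy2⟩
      refine ⟨y, hy1, ?_⟩
      rw [LinearPMap.neg_apply]
      exact neg_eq_iff_eq_neg.2 hy2
  rw [h, hA]
  refine forall_congr' fun n => ?_
  rw [map_neg, lp.coeFn_neg, Pi.neg_apply, neg_eq_iff_eq_neg, neg_add, BlockHS.op_neg,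
    _root_.neg_apply, lp.coeFn_neg, Pi.neg_apply, ← neg_smul]
  push_cast
  ring_nf

lemma isC0Group_similarGroup (hc : IsBlockDiag m c) : IsC0Group (similarGroup Ψ κ m c) where
  zero := by
    ext x
    simp [similarGroup_apply, modelGroup_zero]
  add s t := by
    ext x
    rw [mul_apply_eq_comp, similarGroup_apply, similarGroup_apply, similarGroup_apply,
      modelGroup_add κ hc, mul_apply_eq_comp, Ψ.apply_symm_apply]
  cont x := Ψ.symm.continuous.comp (continuous_modelGroup κ m c (Ψ x))

lemma isGenerator_similarGroup (hA : IsModeledBy Ψ κ m c A) :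
    IsGenerator (similarGroup Ψ κ m c) A := by
  intro x z
  rw [hA, modelGroup_generator]
  have e : ∀ t : ℝ, (t : ℂ)⁻¹ • (similarGroup Ψ κ m c t x - x)
      = Ψ.symm ((t : ℂ)⁻¹ • (modelGroup κ m c t (Ψ x) - Ψ x)) := fun t => by
    rw [map_smul, map_sub, Ψ.symm_apply_apply, similarGroup_apply]
  simp only [e]
  constructor
  · intro h
    have := (Ψ.symm.continuous.tendsto _).comp h
    rwa [Ψ.symm_apply_apply] at this
  · intro h
    refine ((Ψ.continuous.tendsto _).comp h).congr fun t => ?_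
    exact Ψ.apply_symm_apply _

lemma IsModeledBy.mem_resolventSet_iff (hA : IsModeledBy Ψ κ m c A) (z : ℂ) :
    z ∈ resolventSet A ↔ ∃ R, IsModelResolvent κ m c z R := by
  constructor
  · rintro ⟨R, hR1, hR2⟩
    refine ⟨(Ψ : E →L[ℂ] SeqL2 H) ∘L R ∘L (Ψ.symm : SeqL2 H →L[ℂ] E), fun x n => ?_,
      fun u w hw => ?_⟩
    · obtain ⟨h1, h2⟩ := hR1 (Ψ.symm x)
      have h3 := (hA _ _).1 (A.mem_graph ⟨R (Ψ.symm x), h1⟩) n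
      have h4 := congrArg (fun y => Ψ y n) h2
      simp only [map_sub, map_smul, lp.coeFn_sub, Pi.sub_apply, lp.coeFn_smul, Pi.smul_apply,
        Ψ.apply_symm_apply] at h4
      rw [h3] at h4
      rw [← h4]
      change (_ - _) • Ψ (R (Ψ.symm x)) n - c.op (Ψ (R (Ψ.symm x))) n = _
      rw [sub_smul, sub_sub]
    · have h1 : (Ψ.symm u, Ψ.symm (z • u - w)) ∈ A.graph := (hA _ _).2 fun n => by
        rw [Ψ.apply_symm_apply, Ψ.apply_symm_apply, lp.coeFn_sub, Pi.sub_apply, hw n, sub_smul,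
          lp.coeFn_smul, Pi.smul_apply]
        abel
      obtain ⟨y, hy1, hy2⟩ := (LinearPMap.mem_graph_iff A).1 h1
      have h2 := hR2 y
      simp only at hy1 hy2
      rw [hy2, hy1, ← map_smul Ψ.symm, ← map_sub Ψ.symm, sub_sub_cancel] at h2
      change Ψ (R (Ψ.symm w)) = u
      rw [h2, Ψ.apply_symm_apply]
  · rintro ⟨R, hR1, hR2⟩
    refine ⟨(Ψ.symm : SeqL2 H →L[ℂ] E) ∘L R ∘L (Ψ : E →L[ℂ] SeqL2 H), fun x => ?_, fun y => ?_⟩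
    · have h1 : (Ψ.symm (R (Ψ x)), z • Ψ.symm (R (Ψ x)) - x) ∈ A.graph := (hA _ _).2 fun n => by
        rw [map_sub, map_smul, Ψ.apply_symm_apply, lp.coeFn_sub, Pi.sub_apply, ← hR1 (Ψ x) n,
          sub_smul, lp.coeFn_smul, Pi.smul_apply]
        abel
      obtain ⟨y, hy1, hy2⟩ := (LinearPMap.mem_graph_iff A).1 h1
      simp only at hy1 hy2
      refine ⟨hy1 ▸ y.2, ?_⟩
      have h3 : (⟨Ψ.symm (R (Ψ x)), hy1 ▸ y.2⟩ : A.domain) = y := Subtype.ext hy1.symm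
      change z • Ψ.symm (R (Ψ x)) - A ⟨Ψ.symm (R (Ψ x)), _⟩ = x
      rw [h3, hy2, sub_sub_cancel]
    · have h1 := (hA _ _).1 (A.mem_graph y)
      have h2 := hR2 (Ψ y) (Ψ (z • (y : E) - A y)) fun n => by
        rw [map_sub, map_smul, lp.coeFn_sub, Pi.sub_apply, h1 n, sub_smul, lp.coeFn_smul,
          Pi.smul_apply]
        abel
      change Ψ.symm (R (Ψ (z • (y : E) - A y))) = y
      rw [h2, Ψ.symm_apply_apply]

/-- The unitary factor does not affect norms. With the reverse estimate `norm_exp_le_similarGroup`,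
the growth bound becomes that of exp(tC). -/
lemma norm_similarGroup_le (t : ℝ) : ‖similarGroup Ψ κ m c t‖
    ≤ ‖(Ψ.symm : SeqL2 H →L[ℂ] E)‖ * ‖(Ψ : E →L[ℂ] SeqL2 H)‖
      * ‖NormedSpace.exp ((t : ℂ) • c.op)‖ := by
  have h : ‖modelGroup κ m c t‖ ≤ ‖NormedSpace.exp ((t : ℂ) • c.op)‖ :=
    ContinuousLinearMap.opNorm_le_bound _ (norm_nonneg _) fun x => by
      rw [modelGroup_apply, norm_modelUnitary_apply]
      exact ContinuousLinearMap.le_opNorm _ _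
  calc _ ≤ ‖(Ψ.symm : SeqL2 H →L[ℂ] E)‖ * (‖modelGroup κ m c t‖ * ‖(Ψ : E →L[ℂ] SeqL2 H)‖) :=
        (ContinuousLinearMap.opNorm_comp_le _ _).trans
          (by gcongr; exact ContinuousLinearMap.opNorm_comp_le _ _)
    _ ≤ ‖(Ψ.symm : SeqL2 H →L[ℂ] E)‖ * (‖NormedSpace.exp ((t : ℂ) • c.op)‖
          * ‖(Ψ : E →L[ℂ] SeqL2 H)‖) := by gcongr
    _ = _ := by ring

lemma norm_exp_le_similarGroup (t : ℝ) : ‖NormedSpace.exp ((t : ℂ) • c.op)‖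
    ≤ ‖(Ψ : E →L[ℂ] SeqL2 H)‖ * ‖(Ψ.symm : SeqL2 H →L[ℂ] E)‖ * ‖similarGroup Ψ κ m c t‖ := by
  refine ContinuousLinearMap.opNorm_le_bound _ (by positivity) fun x => ?_
  have h1 : ‖NormedSpace.exp ((t : ℂ) • c.op) x‖ = ‖Ψ (similarGroup Ψ κ m c t (Ψ.symm x))‖ := by
    rw [similarGroup_apply, Ψ.apply_symm_apply, Ψ.apply_symm_apply, modelGroup_apply,
      norm_modelUnitary_apply]
  rw [h1]
  calc _ ≤ ‖(Ψ : E →L[ℂ] SeqL2 H)‖ * ‖similarGroup Ψ κ m c t (Ψ.symm x)‖ :=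
        (Ψ : E →L[ℂ] SeqL2 H).le_opNorm _
    _ ≤ ‖(Ψ : E →L[ℂ] SeqL2 H)‖ * (‖similarGroup Ψ κ m c t‖
          * (‖(Ψ.symm : SeqL2 H →L[ℂ] E)‖ * ‖x‖)) := by
        gcongr
        exact (ContinuousLinearMap.le_opNorm _ _).trans
          (by gcongr; exact (Ψ.symm : SeqL2 H →L[ℂ] E).le_opNorm _)
    _ = _ := by ring

lemma spectralBound_eq_bot_of_subsingleton [Subsingleton E] (A : E →ₗ.[ℂ] E) :
    spectralBound A = ⊥ := by
  have h : spectrum A = ∅ := by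
    refine compl_empty_iff.2 (eq_univ_of_forall fun z => ⟨0, fun x => ⟨?_, ?_⟩, fun y => ?_⟩)
    · exact A.domain.zero_mem
    · exact Subsingleton.elim _ _
    · exact Subsingleton.elim _ _
  simp [spectralBound, h]

lemma growthBound_eq_bot_of_subsingleton [Subsingleton E] (T : ℝ → E →L[ℂ] E) :
    growthBound T = ⊥ := by
  have h : {a : ℝ | ∃ M : ℝ, ∀ t : ℝ, 0 ≤ t → ‖T t‖ ≤ M * Real.exp (a * t)} = univ := by
    refine eq_univ_of_forall fun a => ⟨0, fun t _ => ?_⟩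
    rw [Subsingleton.elim (T t) 0]
    simp
  rw [growthBound, h, eq_bot_iff]
  refine le_of_forall_gt_imp_ge_of_dense fun b hb => ?_
  induction b with
  | bot => exact absurd hb (lt_irrefl _)
  | top => exact le_top
  | coe b => exact sInf_le ⟨b, mem_univ _, rfl⟩

/-- This makes the point 0 of σ(C) harmless; it is the one point that
`notMem_spectrum_of_isModelResolvent` cannot reach. -/
lemma IsModeledBy.zero_le_spectralBound [Nontrivial H] (hA : IsModeledBy Ψ κ m c A)
    (hc : IsBlockDiag m c) : 0 ≤ spectralBound A := by
  refine le_of_forall_lt fun b hb => ?_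
  obtain ⟨ε, hε1, hε2⟩ := EReal.lt_iff_exists_real_btwn.1 hb
  obtain ⟨z, hz1, hz2⟩ := exists_no_modelResolvent κ hc (ε := -ε)
    (by have : ε < 0 := by exact_mod_cast hε2
        linarith)
  rw [neg_neg] at hz1
  refine hε1.trans_le ((EReal.coe_le_coe_iff.2 hz1).trans (le_sSup ⟨z, ?_, rfl⟩))
  exact fun h => hz2 ((hA.mem_resolventSet_iff z).1 h)

/-- The spectral bound of an operator similar to a model operator is the growth bound of its
group. -/
theorem IsModeledBy.spectralBound_eq_growthBound (hκ : κ ≠ 0) (hA : IsModeledBy Ψ κ m c A)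
    (hc : IsBlockDiag m c) : spectralBound A = growthBound (similarGroup Ψ κ m c) := by
  -- For H = 0 the spectrum is empty and every real rate is admissible, so both bounds are −∞.
  rcases subsingleton_or_nontrivial H with hH | hH
  · have hX : Subsingleton (SeqL2 H) :=
      ⟨fun a b => lp.ext <| funext fun n => Subsingleton.elim _ _⟩
    have hE : Subsingleton E := Ψ.injective.subsingleton
    rw [spectralBound_eq_bot_of_subsingleton, growthBound_eq_bot_of_subsingleton]
  have hX : Nontrivial (SeqL2 H) := by
    obtain ⟨h, hh⟩ := exists_ne (0 : H)
    refine ⟨⟨lp.single 2 0 h, 0, fun h0 => hh ?_⟩⟩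
    simpa using congrArg (fun v : SeqL2 H => v 0) h0
  apply le_antisymm
  · refine le_sInf ?_
    rintro _ ⟨a, ⟨M, hM⟩, rfl⟩
    refine sSup_le ?_
    rintro _ ⟨z, hz, rfl⟩
    refine EReal.coe_le_coe_iff.2 ?_
    by_contra hlt
    push Not at hlt
    -- All the points z − iκk have real part Re z > a, hence lie outside σ(C), and z would be in the
    -- resolvent set.
    refine hz ((hA.mem_resolventSet_iff z).2 (exists_isModelResolvent hκ hc fun k hk => ?_))
    have h1 := re_le_of_norm_exp_le c.op (a := a)
      (M := ‖(Ψ : E →L[ℂ] SeqL2 H)‖ * ‖(Ψ.symm : SeqL2 H →L[ℂ] E)‖ * M) (fun t ht => by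
        refine (norm_exp_le_similarGroup (Ψ := Ψ) (κ := κ) (m := m) t).trans ?_
        rw [mul_assoc (_ * _) M]
        gcongr
        exact hM t ht) hk
    simp at h1
    linarith
  · refine le_of_forall_gt_imp_ge_of_dense fun b hb => ?_
    obtain ⟨b₁, hb1, hb2⟩ := EReal.lt_iff_exists_real_btwn.1 hb
    -- Two intermediate numbers: b₂, above the spectral bound, will bound the real parts in σ(C),
    -- and the gap b₂ < b₁ is the loss in the exponential estimate.
    obtain ⟨b₂, hb3, hb4⟩ := EReal.lt_iff_exists_real_btwn.1 hb1
    have hpos : 0 ≤ b₂ := EReal.coe_le_coe_iff.1 ((hA.zero_le_spectralBound hc).trans hb3.le)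
    obtain ⟨M, hM⟩ := exists_norm_exp_le_of_spectrum_le c.op (a := b₁) (b := b₂)
      (EReal.coe_lt_coe_iff.1 hb4) fun w hw => by
        by_contra hlt
        push Not at hlt
        refine notMem_spectrum_of_isModelResolvent (κ := κ) hc ?_ (fun k => ?_) hw
        · rintro rfl
          simp at hlt
          linarith
        · rw [← hA.mem_resolventSet_iff]
          by_contra hk
          have h2 : (((w + Complex.I * (κ * k : ℝ)).re : ℝ) : EReal) ≤ spectralBound A :=
            le_sSup ⟨_, hk, rfl⟩
          have h3 := EReal.coe_lt_coe_iff.1 (h2.trans_lt hb3)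
          simp at h3
          linarith
    refine le_trans (sInf_le ⟨b₁, ⟨‖(Ψ.symm : SeqL2 H →L[ℂ] E)‖ * ‖(Ψ : E →L[ℂ] SeqL2 H)‖ * M,
      fun t ht => ?_⟩, rfl⟩) hb2.le
    refine (norm_similarGroup_le t).trans ?_
    rw [mul_assoc (_ * _) M]
    gcongr
    exact hM t ht

end Similar

/-! ### Uniqueness of the group with a given generator -/

section Uniqueness

variable {E : Type*} [NormedAddCommGroup E] [NormedSpace ℂ E] [CompleteSpace E]

/-- Orbits are bounded on compact intervals by continuity; the uniform boundedness principle makes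
the bound uniform in the vector. -/
lemma IsC0Group.exists_bound {T : ℝ → E →L[ℂ] E} (hT : IsC0Group T) (r : ℝ) :
    ∃ C, ∀ t ∈ Icc (-r) r, ‖T t‖ ≤ C := by
  obtain ⟨C, hC⟩ := banach_steinhaus (g := fun t : Icc (-r) r => T t) fun x => by
    obtain ⟨C, hC⟩ := (isCompact_Icc (a := -r) (b := r)).exists_bound_of_continuousOn
      (hT.cont x).continuousOn
    exact ⟨C, fun t => hC t t.2⟩
  exact ⟨C, fun t ht => hC ⟨t, ht⟩⟩

/-- Joint continuity of a strongly continuous group. -/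
lemma IsC0Group.tendsto_apply {T : ℝ → E →L[ℂ] E} (hT : IsC0Group T) {α : Type*} {l : Filter α}
    {τ : α → ℝ} {t : ℝ} (hτ : Tendsto τ l (𝓝 t)) {y : α → E} {x : E} (hy : Tendsto y l (𝓝 x)) :
    Tendsto (fun s => T (τ s) (y s)) l (𝓝 (T t x)) := by
  obtain ⟨C, hC⟩ := hT.exists_bound (|t| + 1)
  have h1 := ((hT.cont x).tendsto t).comp hτ
  rw [tendsto_iff_norm_sub_tendsto_zero]
  refine squeeze_zero' (Eventually.of_forall fun _ => norm_nonneg _)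
    (g := fun s => C * ‖y s - x‖ + ‖T (τ s) x - T t x‖) ?_ ?_
  · have h2 : ∀ᶠ s in l, τ s ∈ Icc (-(|t| + 1)) (|t| + 1) := by
      refine hτ.eventually (Icc_mem_nhds ?_ ?_)
      · linarith [neg_abs_le t]
      · linarith [le_abs_self t]
    filter_upwards [h2] with s hs
    refine (norm_sub_le_norm_sub_add_norm_sub _ (T (τ s) x) _).trans ?_
    gcongr
    rw [← map_sub]
    exact ((T (τ s)).le_opNorm _).trans (by gcongr; exact hC _ hs)
  · simpa using ((tendsto_iff_norm_sub_tendsto_zero.1 hy).const_mul C).add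
      (tendsto_iff_norm_sub_tendsto_zero.1 h1)

lemma IsC0Group.comm {T : ℝ → E →L[ℂ] E} (hT : IsC0Group T) (s t : ℝ) (x : E) :
    T s (T t x) = T t (T s x) := by
  rw [← mul_apply_eq_comp, ← mul_apply_eq_comp, ← hT.add, ← hT.add, add_comm]

/-- The difference quotients of an orbit starting in the domain of the generator. -/
lemma IsC0Group.tendsto_orbit {T : ℝ → E →L[ℂ] E} (hT : IsC0Group T) {A : E →ₗ.[ℂ] E}
    (hA : IsGenerator T A) {x z : E} (hx : (x, z) ∈ A.graph) (t : ℝ) :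
    (T t x, T t z) ∈ A.graph := by
  rw [hA]
  refine (((T t).continuous.tendsto z).comp ((hA x z).1 hx)).congr fun h => ?_
  simp only [Function.comp_apply, map_smul, map_sub]
  rw [hT.comm]

/-- Two groups with the same generator agree on its domain. -/
lemma IsC0Group.eq_of_mem_graph {S T : ℝ → E →L[ℂ] E} (hS : IsC0Group S) (hT : IsC0Group T)
    {A : E →ₗ.[ℂ] E} (hSA : IsGenerator S A) (hTA : IsGenerator T A) {x z : E}
    (hx : (x, z) ∈ A.graph) (t : ℝ) : S t x = T t x := by
  have hderiv : ∀ s : ℝ, HasDerivAt (fun s => S (-s) (T s x)) 0 s := by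
    intro s
    rw [hasDerivAt_iff_tendsto_slope_zero]
    have h1 := hT.tendsto_orbit hTA hx s
    -- The difference quotient of S(−s)T(s)x is S(−(s + h)) applied to the difference of the
    -- quotients of T and S at T(s)x. Both tend to the generator's value there, so the derivative
    -- vanishes.
    have h2 : Tendsto (fun h : ℝ => S (-(s + h)) ((h : ℂ)⁻¹ • (T h (T s x) - T s x)
        - (h : ℂ)⁻¹ • (S h (T s x) - T s x))) (𝓝[≠] 0) (𝓝 (S (-s) (T s z - T s z))) := by
      refine hS.tendsto_apply ?_ (((hTA _ _).1 h1).sub ((hSA _ _).1 h1))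
      have : Continuous fun h : ℝ => -(s + h) := by fun_prop
      simpa using (this.tendsto 0).mono_left nhdsWithin_le_nhds
    rw [sub_self, map_zero] at h2
    refine h2.congr fun h => ?_
    rw [← smul_sub, sub_sub_sub_cancel_right, map_smul, map_sub]
    have e1 : T (s + h) x = T h (T s x) := by
      rw [add_comm, hT.add, mul_apply_eq_comp]
    have e2 : S (-(s + h)) (S h (T s x)) = S (-s) (T s x) := by
      rw [← mul_apply_eq_comp, ← hS.add]
      congr 2
      ring
    rw [e1, e2, ← Complex.ofReal_inv]
    rfl
  have h3 : ∀ s, S (-s) (T s x) = S (-0) (T 0 x) := fun s =>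
    is_const_of_deriv_eq_zero (fun u => (hderiv u).differentiableAt) (fun u => (hderiv u).deriv) s 0
  have h4 := congrArg (S t) (h3 t)
  rw [← mul_apply_eq_comp, ← hS.add, add_neg_cancel, neg_zero, hS.zero, hT.zero] at h4
  exact h4.symm

end Uniqueness

/-! ### Uniqueness of the group for operators similar to a model -/

section SimilarUnique

variable {H : Type*} [NormedAddCommGroup H] [InnerProductSpace ℂ H] [CompleteSpace H]
variable {E : Type*} [NormedAddCommGroup E] [NormedSpace ℂ E] [CompleteSpace E]
variable {Ψ : E ≃L[ℂ] SeqL2 H} {κ : ℝ} {m : ℕ} {c : BlockHS H} {A : E →ₗ.[ℂ] E}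

/-- Sequences with a single nonzero entry lie in the domain of the model operator and span a dense
subspace, so agreement on the domain determines the group. -/
lemma IsModeledBy.eq_similarGroup (hA : IsModeledBy Ψ κ m c A) (hc : IsBlockDiag m c)
    {T : ℝ → E →L[ℂ] E} (hT : IsC0Group T) (hTA : IsGenerator T A) :
    T = similarGroup Ψ κ m c := by
  funext t
  have h : T t ∘L (Ψ.symm : SeqL2 H →L[ℂ] E)
      = similarGroup Ψ κ m c t ∘L (Ψ.symm : SeqL2 H →L[ℂ] E) := by
    refine SeqL2.clm_ext fun l x => ?_
    refine hT.eq_of_mem_graph (isC0Group_similarGroup hc) hTA (isGenerator_similarGroup hA)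
      (z := Ψ.symm ((Complex.I * (κ * modelFreq m l : ℝ)) • lp.single 2 l x
        + c.op (lp.single 2 l x))) ?_ t
    refine (hA _ _).2 fun n => ?_
    change Ψ (Ψ.symm _) n = _ • Ψ (Ψ.symm (lp.single 2 l x)) n + c.op (Ψ (Ψ.symm _)) n
    rw [Ψ.apply_symm_apply, Ψ.apply_symm_apply, lp.coeFn_add, Pi.add_apply, lp.coeFn_smul,
      Pi.smul_apply]
    congr 1
    rcases eq_or_ne n l with rfl | hn
    · rfl
    · rw [lp.single_apply_ne _ _ _ hn, smul_zero, smul_zero]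
  ext y
  have := congrArg (fun S : SeqL2 H →L[ℂ] E => S (Ψ y)) h
  simpa using this

/-- Generation, uniqueness and equality of bounds for operators similar to a model operator. -/
theorem IsModeledBy.generation (hκ : κ ≠ 0) (hA : IsModeledBy Ψ κ m c A) (hc : IsBlockDiag m c) :
    (∃! T : ℝ → E →L[ℂ] E, IsC0Group T ∧ IsGenerator T A) ∧
    ∀ T : ℝ → E →L[ℂ] E, IsC0Group T → IsGenerator T A →
      spectralBound A = growthBound T ∧ spectralBound (-A) = growthBound (fun t => T (-t)) := by
  refine ⟨⟨similarGroup Ψ κ m c, ⟨isC0Group_similarGroup hc, isGenerator_similarGroup hA⟩,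
    fun T hT => hA.eq_similarGroup hc hT.1 hT.2⟩, fun T hT hTA => ?_⟩
  rw [hA.eq_similarGroup hc hT hTA]
  refine ⟨hA.spectralBound_eq_growthBound hκ hc, ?_⟩
  rw [hA.neg.spectralBound_eq_growthBound (neg_ne_zero.2 hκ) hc.neg]
  congr 1
  funext t
  exact similarGroup_neg t

end SimilarUnique

/-! ### Block diagonalization of a Hilbert–Schmidt perturbation -/

section FixedPoint

variable {E : Type*} [NormedAddCommGroup E] [CompleteSpace E]

lemma exists_fixedPoint_of_lipschitz_on_ball {F : E → E} {r L : ℝ} (hr : 0 ≤ r) (hL : L < 1)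
    (hF : ∀ x, ‖x‖ ≤ r → ‖F x‖ ≤ r)
    (hLip : ∀ x y, ‖x‖ ≤ r → ‖y‖ ≤ r → ‖F x - F y‖ ≤ L * ‖x - y‖) : ∃ x, ‖x‖ ≤ r ∧ F x = x := by
  have hmaps : MapsTo F (Metric.closedBall 0 r) (Metric.closedBall 0 r) := fun x hx => by
    rw [mem_closedBall_zero_iff] at hx ⊢
    exact hF x hx
  have hc : ContractingWith L.toNNReal (hmaps.restrict F _ _) := by
    refine ⟨by rw [← NNReal.coe_lt_coe, NNReal.coe_one, Real.coe_toNNReal']; simp [hL],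
      LipschitzWith.of_dist_le_mul fun x y => ?_⟩
    have h := hLip x y (mem_closedBall_zero_iff.1 x.2) (mem_closedBall_zero_iff.1 y.2)
    rw [Subtype.dist_eq, Subtype.dist_eq, dist_eq_norm, dist_eq_norm]
    exact h.trans (by gcongr; exact Real.le_coe_toNNReal L)
  obtain ⟨x, hx, hfix, -⟩ := hc.exists_fixedPoint' Metric.isClosed_closedBall.isComplete hmaps
    (x := 0) (by simpa using hr) (edist_ne_top _ _)
  exact ⟨x, mem_closedBall_zero_iff.1 hx, hfix⟩

end FixedPoint

/-! ### The commutator equation and a weighted quadratic equation -/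

section BlockDiagonalization

variable {H : Type*} [NormedAddCommGroup H] [InnerProductSpace ℂ H] [CompleteSpace H]

/-- The scalar matrix `1 / (iκ(n - l))` outside the blocks of equal model frequency. -/
def blockGamma (κ : ℝ) (m : ℕ) (p : ℤ × ℤ) : ℂ :=
  if modelFreq m p.1 = modelFreq m p.2 then 0
  else (Complex.I * (κ * ((p.1 : ℝ) - p.2) : ℝ))⁻¹

lemma norm_freq_sub (κ : ℝ) (a b : ℝ) :
    ‖Complex.I * (κ * (a - b) : ℝ)‖ = |κ| * |a - b| := by
  rw [norm_mul, Complex.norm_I, one_mul, Complex.norm_real, Real.norm_eq_abs, abs_mul]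

lemma abs_le_of_blockGamma_ne {m : ℕ} {p : ℤ × ℤ} (h : modelFreq m p.1 ≠ modelFreq m p.2) :
    (m : ℤ) < |p.1| ∨ (m : ℤ) < |p.2| := by
  by_contra hcon
  push Not at hcon
  exact h (by rw [modelFreq, modelFreq, if_pos hcon.1, if_pos hcon.2])

lemma norm_blockGamma_le {κ : ℝ} (m : ℕ) (p : ℤ × ℤ) : ‖blockGamma κ m p‖ ≤ |κ|⁻¹ := by
  rw [blockGamma]
  split_ifs with h
  · rw [norm_zero]
    positivity
  · rw [norm_inv, norm_freq_sub, mul_inv]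
    have hne : p.1 ≠ p.2 := fun h' => h (by rw [h'])
    have h1 : (1 : ℝ) ≤ |(p.1 : ℝ) - p.2| := by
      exact_mod_cast Int.one_le_abs (sub_ne_zero.2 hne)
    calc |κ|⁻¹ * |(p.1 : ℝ) - p.2|⁻¹ ≤ |κ|⁻¹ * 1 := by
          gcongr
          exact inv_le_one_of_one_le₀ h1
      _ = _ := mul_one _

/-- A nonzero entry has an index of modulus greater than m. If the other one has modulus at most N,
the two differ by at least m − N. -/
lemma norm_blockGamma_le_of_far {κ : ℝ} {N m : ℕ} (hNm : N < m) {p : ℤ × ℤ}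
    (hp : |p.1| ≤ N ∨ |p.2| ≤ N) : ‖blockGamma κ m p‖ ≤ |κ|⁻¹ * ((m : ℝ) - N)⁻¹ := by
  have h0 : (0 : ℝ) < m - N := sub_pos.2 (by exact_mod_cast hNm)
  rw [blockGamma]
  split_ifs with h
  · rw [norm_zero]
    positivity
  · rw [norm_inv, norm_freq_sub, mul_inv]
    have h1 : (m : ℤ) - N ≤ |p.1 - p.2| := by
      rcases abs_le_of_blockGamma_ne h with h2 | h2 <;> rcases hp with h3 | h3
      · omega
      · have := abs_sub_abs_le_abs_sub p.1 p.2
        omega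
      · have := abs_sub_abs_le_abs_sub p.2 p.1
        rw [abs_sub_comm] at this
        omega
      · omega
    have h4 : (m : ℝ) - N ≤ |(p.1 : ℝ) - p.2| := by exact_mod_cast h1
    gcongr

/-- The two-valued weight, `1` for `|n| ≤ N` and `K` for `|n| > N`. -/
def blockWeight (K : ℝ) (N : ℕ) (n : ℤ) : ℝ := if |n| ≤ N then 1 else K

lemma one_le_blockWeight {K : ℝ} (hK : 1 ≤ K) (N : ℕ) (n : ℤ) : 1 ≤ blockWeight K N n := by
  rw [blockWeight]
  split_ifs <;> simp [hK]

lemma blockWeight_le {K : ℝ} (hK : 1 ≤ K) (N : ℕ) (n : ℤ) : blockWeight K N n ≤ K := by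
  rw [blockWeight]
  split_ifs <;> simp [hK]

/-- With weights on either side, `blockGamma` becomes uniformly small. -/
lemma norm_blockGamma_div_le {κ K η : ℝ} {N m : ℕ} (hK : 1 ≤ K) (hη1 : |κ|⁻¹ / K ^ 2 ≤ η)
    (hNm : N < m) (hη2 : |κ|⁻¹ * ((m : ℝ) - N)⁻¹ ≤ η) (p : ℤ × ℤ) {i j : ℤ}
    (hi : i = p.1 ∨ i = p.2) (hj : j = p.1 ∨ j = p.2) :
    ‖blockGamma κ m p / (blockWeight K N i * blockWeight K N j : ℝ)‖ ≤ η := by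
  have hwi := one_le_blockWeight hK N i
  have hwj := one_le_blockWeight hK N j
  rw [norm_div, Complex.norm_real, Real.norm_of_nonneg (by positivity)]
  by_cases hp : |p.1| ≤ N ∨ |p.2| ≤ N
  · refine (div_le_self (norm_nonneg _) ?_).trans ((norm_blockGamma_le_of_far hNm hp).trans hη2)
    nlinarith
  · push Not at hp
    have hwK : ∀ l, l = p.1 ∨ l = p.2 → blockWeight K N l = K := by
      rintro l (rfl | rfl)
      · exact if_neg (not_le.2 hp.1)
      · exact if_neg (not_le.2 hp.2)
    rw [hwK i hi, hwK j hj, ← sq]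
    refine le_trans ?_ hη1
    gcongr
    exact norm_blockGamma_le m p

/-- The matrix wBw − B comes from multipliers bounded by K² that vanish on any given entry once N is
large. Hence, however large K is, weighting only a distant tail adds at most 1 to the norm. -/
lemma exists_weight_cutoff (B : BlockHS H) {K : ℝ} (hK : 1 ≤ K) :
    ∃ N : ℕ, ∃ B' : BlockHS H, ‖B'‖ ≤ ‖B‖ + 1 ∧
      ∀ p, B' p = ((blockWeight K N p.1 * blockWeight K N p.2 : ℝ) : ℂ) • B p := by
  have hb : ∀ (N : ℕ) (p : ℤ × ℤ),
      ‖((blockWeight K N p.1 * blockWeight K N p.2 - 1 : ℝ) : ℂ)‖ ≤ K * K := fun N p => by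
    have h1 := one_le_blockWeight hK N p.1
    have h2 := one_le_blockWeight hK N p.2
    have h3 := mul_le_mul (blockWeight_le hK N p.1) (blockWeight_le hK N p.2)
      (by linarith) (by linarith)
    rw [Complex.norm_real, Real.norm_of_nonneg (by nlinarith)]
    linarith
  have h := tendsto_norm_schur (l := atTop) B
    (γ := fun (N : ℕ) p => ((blockWeight K N p.1 * blockWeight K N p.2 - 1 : ℝ) : ℂ))
    (fun N => ⟨_, hb N⟩) hb fun p => by
      refine tendsto_const_nhds.congr' ?_
      filter_upwards [eventually_ge_atTop (|p.1|).toNat, eventually_ge_atTop (|p.2|).toNat]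
        with N h1 h2
      rw [blockWeight, blockWeight, if_pos (by omega), if_pos (by omega)]
      simp
  obtain ⟨N, hN⟩ := (h.eventually (gt_mem_nhds one_pos)).exists
  refine ⟨N, B + B.schur _ ⟨_, hb N⟩, (norm_add_le _ _).trans (by gcongr), fun p => ?_⟩
  rw [lp.coeFn_add, Pi.add_apply, BlockHS.schur_apply]
  push_cast
  rw [sub_smul, one_smul]
  abel

/-- The scalar indicator of the blocks of equal model frequency. -/
def blockInd (m : ℕ) (p : ℤ × ℤ) : ℂ := if modelFreq m p.1 = modelFreq m p.2 then 1 else 0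

lemma norm_blockInd_le (m : ℕ) (p : ℤ × ℤ) : ‖blockInd m p‖ ≤ 1 := by
  rw [blockInd]
  split_ifs <;> simp

lemma one_sub_blockInd {κ : ℝ} (hκ : κ ≠ 0) (m : ℕ) (p : ℤ × ℤ) :
    1 - blockInd m p = Complex.I * (κ * ((p.1 : ℝ) - p.2) : ℝ) * blockGamma κ m p := by
  rw [blockInd, blockGamma]
  split_ifs with h
  · simp
  · rw [mul_inv_cancel₀, sub_zero]
    have hne : ((p.1 : ℝ) - p.2) ≠ 0 := sub_ne_zero.2 fun h' => h (by
      have : p.1 = p.2 := by exact_mod_cast h'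
      rw [this])
    exact mul_ne_zero Complex.I_ne_zero (by exact_mod_cast mul_ne_zero hκ hne)

/-- The quadratic equation of the method of similar operators, in weighted form. -/
lemma exists_quadratic_solution (B : BlockHS H) {β η : ℝ} (hB : ‖B‖ ≤ β) (hβη : β * η ≤ 1 / 12)
    (hβ : 0 ≤ β) (hη : 0 ≤ η) {γ₁ γ₂ ι : ℤ × ℤ → ℂ} (h1 : ∀ p, ‖γ₁ p‖ ≤ η) (h2 : ∀ p, ‖γ₂ p‖ ≤ η)
    (hι : ∀ p, ‖ι p‖ ≤ 1) : ∃ Z : BlockHS H, ‖Z‖ ≤ 2 * β ∧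
      B + B.prod (Z.schur γ₁ ⟨η, h1⟩) - (Z.schur γ₂ ⟨η, h2⟩).prod (Z.schur ι ⟨1, hι⟩) = Z := by
  have e1 := fun Z : BlockHS H => Z.norm_schur_le ⟨η, h1⟩ hη h1
  have e2 := fun Z : BlockHS H => Z.norm_schur_le ⟨η, h2⟩ hη h2
  have e3 := fun Z : BlockHS H => Z.norm_schur_le ⟨1, hι⟩ zero_le_one hι
  simp only [one_mul] at e3
  refine exists_fixedPoint_of_lipschitz_on_ball (L := 1 / 2) (by positivity) (by norm_num)
    (fun Z hZ => ?_) fun Z W hZ hW => ?_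
  -- On the ball of radius 2β the right side is at most β + 6β(βη) ≤ 3β/2.
  · calc _ ≤ ‖B‖ + ‖B‖ * (η * ‖Z‖) + (η * ‖Z‖) * ‖Z‖ := by
          refine (norm_sub_le _ _).trans (add_le_add ((norm_add_le _ _).trans ?_) ?_)
          · gcongr
            exact (BlockHS.norm_prod_le _ _).trans (by gcongr; exact e1 Z)
          · exact (BlockHS.norm_prod_le _ _).trans (by gcongr; exacts [e2 Z, e3 Z])
      _ ≤ β + β * (η * (2 * β)) + (η * (2 * β)) * (2 * β) := by gcongr
      _ ≤ 2 * β := by nlinarith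
  · have e : B + B.prod (Z.schur γ₁ ⟨η, h1⟩) - (Z.schur γ₂ ⟨η, h2⟩).prod (Z.schur ι ⟨1, hι⟩)
        - (B + B.prod (W.schur γ₁ ⟨η, h1⟩) - (W.schur γ₂ ⟨η, h2⟩).prod (W.schur ι ⟨1, hι⟩))
        = B.prod ((Z - W).schur γ₁ ⟨η, h1⟩)
          - (((Z - W).schur γ₂ ⟨η, h2⟩).prod (Z.schur ι ⟨1, hι⟩)
            + (W.schur γ₂ ⟨η, h2⟩).prod ((Z - W).schur ι ⟨1, hι⟩)) := by
      rw [BlockHS.schur_sub, BlockHS.schur_sub, BlockHS.schur_sub, BlockHS.prod_sub,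
        BlockHS.prod_sub, BlockHS.sub_prod]
      abel
    rw [e]
    -- The linear term contributes βη and the quadratic one 4βη to the Lipschitz constant, and 5/12
    -- ≤ 1/2.
    calc _ ≤ ‖B‖ * (η * ‖Z - W‖) + ((η * ‖Z - W‖) * ‖Z‖ + (η * ‖W‖) * ‖Z - W‖) := by
          refine (norm_sub_le _ _).trans (add_le_add ?_ ((norm_add_le _ _).trans
            (add_le_add ?_ ?_)))
          · exact (BlockHS.norm_prod_le _ _).trans (by gcongr; exact e1 _)
          · exact (BlockHS.norm_prod_le _ _).trans (by gcongr; exacts [e2 _, e3 _])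
          · exact (BlockHS.norm_prod_le _ _).trans (by gcongr; exacts [e2 _, e3 _])
      _ ≤ β * (η * ‖Z - W‖) + ((η * ‖Z - W‖) * (2 * β) + (η * (2 * β)) * ‖Z - W‖) := by gcongr
      _ = (5 * (β * η)) * ‖Z - W‖ := by ring
      _ ≤ 1 / 2 * ‖Z - W‖ := by
        gcongr
        linarith

/-- Block diagonalization: for every block Hilbert–Schmidt `B` there are `Y`, `X` and a block
diagonal `b` solving the equations that make `diag(iκn) - B` similar to `diag(iκn) - b`. -/
lemma exists_blockDiagonalization {κ : ℝ} (hκ : κ ≠ 0) (B : BlockHS H) :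
    ∃ (m : ℕ) (X Y b : BlockHS H), ‖Y‖ < 1 ∧ IsBlockDiag m b ∧
      (∀ p : ℤ × ℤ, X p - b p = (Complex.I * (κ * ((p.1 : ℝ) - p.2) : ℝ)) • Y p) ∧
      X + Y.prod b = B + B.prod Y := by
  -- Away from the central block the multiplier Γ = `blockGamma` is bounded only by 1/|κ|, while ‖B‖
  -- is arbitrary, so the plain equation need not be a contraction. A weight w equal to K beyond N
  -- repairs this: β bounds ‖wBw‖, and after division by two weights Γ is at most η, by K² far out
  -- and by m − N near the centre.
  set β := ‖B‖ + 1 with hβ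
  have hβ0 : 0 < β := by positivity
  set η := (12 * β)⁻¹ with hη
  have hη0 : 0 < η := by positivity
  have hκ' : 0 < |κ| := abs_pos.2 hκ
  obtain ⟨K, hK1, hK⟩ : ∃ K : ℝ, 1 ≤ K ∧ |κ|⁻¹ / K ^ 2 ≤ η := by
    refine ⟨1 + |κ|⁻¹ / η, by simp; positivity, ?_⟩
    have h0 : 0 ≤ |κ|⁻¹ / η := by positivity
    rw [div_le_iff₀ (by positivity), ← div_le_iff₀' hη0]
    nlinarith
  obtain ⟨N, B', hB', hB'p⟩ := exists_weight_cutoff B hK1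
  obtain ⟨m, hNm, hm⟩ : ∃ m : ℕ, N < m ∧ |κ|⁻¹ * ((m : ℝ) - N)⁻¹ ≤ η := by
    obtain ⟨k, hk⟩ := exists_nat_ge (|κ|⁻¹ / η)
    refine ⟨N + k + 1, by omega, ?_⟩
    have h0 : 0 ≤ |κ|⁻¹ / η := by positivity
    push_cast
    rw [add_assoc, add_sub_cancel_left, ← div_eq_mul_inv, div_le_iff₀ (by positivity),
      ← div_le_iff₀' hη0]
    linarith
  set w : ℤ → ℝ := blockWeight K N
  have hw : ∀ n, 1 ≤ w n := one_le_blockWeight hK1 N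
  have hwc : ∀ n, (w n : ℂ) ≠ 0 := fun n => by exact_mod_cast (zero_lt_one.trans_le (hw n)).ne'
  have hg := norm_blockGamma_div_le hK1 hK hNm hm
  have hι : ∀ p : ℤ × ℤ, ‖(1 : ℂ) / (w p.1 * w p.2 : ℝ)‖ ≤ 1 := fun p => by
    have h1 : 1 ≤ w p.1 * w p.2 := by nlinarith [hw p.1, hw p.2]
    rw [norm_div, norm_one, Complex.norm_real, Real.norm_of_nonneg (by linarith)]
    exact div_le_one_of_le₀ h1 (by linarith)
  have hι' : ∀ p : ℤ × ℤ, ‖blockInd m p / (w p.1 * w p.2 : ℝ)‖ ≤ 1 := fun p => by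
    rw [div_eq_mul_one_div, norm_mul]
    exact mul_le_one₀ (norm_blockInd_le m p) (norm_nonneg _) (hι p)
  -- The equation X + Yb = B + BY, with Y = Γ·X and b the block part of X, is multiplied by w on
  -- both sides and solved for Z = wXw. Then w⁻¹Yw and wYw⁻¹ carry the multipliers Γ/w² with the
  -- weight of the row and of the column respectively, and wbw is the block part of Z.
  obtain ⟨Z, hZ, hZeq⟩ := exists_quadratic_solution B' hB' (β := β) (η := η)
    (by rw [hη]; field_simp; norm_num) hβ0.le hη0.le
    (γ₁ := fun p => blockGamma κ m p / (w p.1 * w p.1 : ℝ))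
    (γ₂ := fun p => blockGamma κ m p / (w p.2 * w p.2 : ℝ))
    (fun p => hg p (Or.inl rfl) (Or.inl rfl)) (fun p => hg p (Or.inr rfl) (Or.inr rfl))
    (norm_blockInd_le m)
  have hgY : ∀ p : ℤ × ℤ, ‖blockGamma κ m p / (w p.1 * w p.2 : ℝ)‖ ≤ η :=
    fun p => hg p (Or.inl rfl) (Or.inr rfl)
  refine ⟨m, Z.schur _ ⟨1, hι⟩, Z.schur _ ⟨η, hgY⟩, Z.schur _ ⟨1, hι'⟩, ?_, ?_, ?_, ?_⟩
  · refine (BlockHS.norm_schur_le _ hη0.le hgY Z).trans_lt ?_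
    calc η * ‖Z‖ ≤ η * (2 * β) := by gcongr
      _ = 1 / 6 := by rw [hη]; field_simp; norm_num
      _ < 1 := by norm_num
  · intro p hp
    rw [BlockHS.schur_apply, blockInd, if_neg hp, zero_div, zero_smul]
  · intro p
    rw [BlockHS.schur_apply, BlockHS.schur_apply, BlockHS.schur_apply, ← sub_smul, smul_smul,
      ← sub_div, one_sub_blockInd hκ, mul_div_assoc]
  · refine lp.ext <| funext fun p => ?_
    have hww : ((w p.1 * w p.2 : ℝ) : ℂ) ≠ 0 := by
      rw [Complex.ofReal_mul]
      exact mul_ne_zero (hwc _) (hwc _)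
    have h1 := congrArg (fun V : BlockHS H => V p) hZeq
    simp only [lp.coeFn_add, lp.coeFn_sub, Pi.add_apply, Pi.sub_apply] at h1 ⊢
    have h2 : B'.prod (Z.schur (fun p => blockGamma κ m p / (w p.1 * w p.1 : ℝ))
        ⟨η, fun p => hg p (Or.inl rfl) (Or.inl rfl)⟩) p
        = ((w p.1 * w p.2 : ℝ) : ℂ) • B.prod (Z.schur _ ⟨η, hgY⟩) p := by
      rw [BlockHS.prod_apply, BlockHS.prod_apply, ← (summable_mul_col _ _ _ _).tsum_const_smul]
      refine tsum_congr fun n => ?_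
      rw [BlockHS.schur_apply, BlockHS.schur_apply, hB'p, smul_mul_smul_comm, mul_smul_comm,
        smul_smul]
      congr 1
      have := hwc n
      have := hwc p.2
      push_cast
      field_simp
    have h3 : (Z.schur (fun p => blockGamma κ m p / (w p.2 * w p.2 : ℝ))
        ⟨η, fun p => hg p (Or.inr rfl) (Or.inr rfl)⟩).prod (Z.schur _ ⟨1, norm_blockInd_le m⟩) p
        = ((w p.1 * w p.2 : ℝ) : ℂ) • (Z.schur _ ⟨η, hgY⟩).prod (Z.schur _ ⟨1, hι'⟩) p := by
      rw [BlockHS.prod_apply, BlockHS.prod_apply, ← (summable_mul_col _ _ _ _).tsum_const_smul]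
      refine tsum_congr fun n => ?_
      simp only [BlockHS.schur_apply]
      rw [smul_mul_smul_comm, smul_mul_smul_comm, smul_smul]
      congr 1
      have := hwc n
      have := hwc p.1
      have := hwc p.2
      push_cast
      field_simp
    rw [h2, h3, hB'p] at h1
    have h4 : Z.schur _ ⟨1, hι⟩ p = ((w p.1 * w p.2 : ℝ) : ℂ)⁻¹ • Z p := by
      rw [BlockHS.schur_apply, one_div]
    rw [h4, ← h1, smul_sub, smul_add, smul_smul, smul_smul, smul_smul, inv_mul_cancel₀ hww,
      one_smul, one_smul, one_smul]
    abel

end BlockDiagonalization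

/-! ### Similarity of `diag(iκn) - (𝓥̂(n + l))` to a block diagonal operator -/

section HankelMatrices

variable {H : Type*} [NormedAddCommGroup H] [InnerProductSpace ℂ H] [CompleteSpace H]

/-- `w = diag(iκn) x`. -/
def IsFreqMul (κ : ℝ) (x w : SeqL2 H) : Prop := ∀ n, w n = (Complex.I * (κ * n : ℝ)) • x n

/-- `z = diag(iκn) x - V x`, where `V` has the matrix `v(n + l)`. -/
def IsHankelPair (κ : ℝ) (v : ℤ → H →L[ℂ] H) (x z : SeqL2 H) : Prop :=
  ∃ w, IsFreqMul κ x w ∧ ∀ n, z n = w n - ∑' l, v (n + l) (x l)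

/-- The commutator of `diag(iκn)` with a block Hilbert–Schmidt operator. -/
lemma IsFreqMul.hasSum_commutator {κ : ℝ} {x w : SeqL2 H} (hx : IsFreqMul κ x w) (Y : BlockHS H)
    {a : ℤ × ℤ → H →L[ℂ] H}
    (ha : ∀ p : ℤ × ℤ, a p = (Complex.I * (κ * ((p.1 : ℝ) - p.2) : ℝ)) • Y p) (n : ℤ) :
    HasSum (fun l => a (n, l) (x l)) ((Complex.I * (κ * n : ℝ)) • Y.op x n - Y.op w n) := by
  refine (((Y.hasSum_op x n).const_smul (Complex.I * (κ * n : ℝ))).sub (Y.hasSum_op w n)).congr_fun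
    fun l => ?_
  rw [hx l, map_smul, ha, ← sub_smul, _root_.smul_apply]
  congr 1
  push_cast
  ring

/-- Applied with (n + l, n − l) or (n + l, l), this shows that a Hankel entry times a square
summable factor in the second variable is a Hilbert–Schmidt matrix. -/
lemma summable_mul_reindex {f g : ℤ → ℝ} (hf : Summable f) (hg : Summable g) (hf0 : ∀ n, 0 ≤ f n)
    (hg0 : ∀ n, 0 ≤ g n) {φ ψ : ℤ × ℤ → ℤ} (hφ : Function.Injective fun p => (φ p, ψ p)) :
    Summable fun p => f (φ p) * g (ψ p) :=
  (hf.mul_of_nonneg hg hf0 hg0).comp_injective hφ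

lemma summable_hankel_row {v : ℤ → H →L[ℂ] H} (hv : Summable fun n => ‖v n‖ ^ 2) (j : ℤ) :
    Summable fun n => ‖v (j + n)‖ ^ 2 :=
  hv.comp_injective (add_right_injective j)

lemma norm_sub_freq_sq (κ μ : ℝ) (n : ℤ) :
    ‖(μ : ℂ) - Complex.I * (κ * n : ℝ)‖ ^ 2 = μ ^ 2 + (κ * n) ^ 2 := by
  rw [← Complex.normSq_eq_norm_sq, Complex.normSq_apply]
  simp
  ring

lemma le_norm_sub_freq (κ : ℝ) {μ : ℝ} (n : ℤ) :
    μ ≤ ‖(μ : ℂ) - Complex.I * (κ * n : ℝ)‖ := by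
  refine le_of_sq_le_sq ?_ (norm_nonneg _)
  rw [norm_sub_freq_sq]
  nlinarith [sq_nonneg (κ * n)]

lemma sub_freq_ne_zero (κ : ℝ) {μ : ℝ} (hμ : 0 < μ) (n : ℤ) :
    (μ : ℂ) - Complex.I * (κ * n : ℝ) ≠ 0 :=
  norm_pos_iff.1 (hμ.trans_le (le_norm_sub_freq κ n))

lemma summable_int_sq_inv (κ : ℝ) :
    Summable fun n : ℤ => (|κ|⁻¹ * |(n : ℝ)|⁻¹) ^ 2 := by
  have h : Summable fun n : ℤ => 1 / (n : ℝ) ^ 2 :=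
    Real.summable_one_div_int_pow.2 (by norm_num)
  refine (h.mul_left (|κ|⁻¹ ^ 2)).congr fun n => ?_
  rw [mul_pow, inv_pow |(n : ℝ)|, sq_abs, one_div]

/-- The matrix of `V (μ - diag(iκn))⁻¹`. -/
lemma exists_hankel_resolvent {κ : ℝ} (hκ : κ ≠ 0) {v : ℤ → H →L[ℂ] H}
    (hv : Summable fun n => ‖v n‖ ^ 2) : ∃ R : ℝ → BlockHS H,
      (∀ μ : ℝ, 1 ≤ μ → ∀ p, R μ p = ((μ : ℂ) - Complex.I * (κ * p.2 : ℝ))⁻¹ • v (p.1 + p.2)) ∧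
      Tendsto (fun μ => ‖R μ‖) atTop (𝓝 0) := by
  have hg : Summable fun n : ℤ => ‖((1 : ℝ) : ℂ) - Complex.I * (κ * n : ℝ)‖⁻¹ ^ 2 := by
    refine (((summable_int_sq_inv κ)).add
      (summable_of_hasFiniteSupport (f := fun n : ℤ => if n = 0 then (1 : ℝ) else 0) ?_)).of_nonneg_of_le
      (fun _ => by positivity) fun n => ?_
    · refine (finite_singleton (0 : ℤ)).subset fun n hn => ?_
      by_contra h
      exact hn (if_neg h)
    · rcases eq_or_ne n 0 with rfl | hn
      · simp
      · rw [if_neg hn, add_zero, inv_pow, norm_sub_freq_sq, ← mul_inv, inv_pow, mul_pow, mul_pow,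
          sq_abs, sq_abs]
        have : 0 < κ ^ 2 * (n : ℝ) ^ 2 := by positivity
        gcongr
        linarith
  have hR1 : Summable fun p : ℤ × ℤ =>
      ‖((((1 : ℝ) : ℂ) - Complex.I * (κ * p.2 : ℝ))⁻¹ • v (p.1 + p.2))‖ ^ 2 := by
    refine (summable_mul_reindex hv hg (fun _ => by positivity) (fun _ => by positivity)
      (φ := fun p => p.1 + p.2) (ψ := fun p => p.2) ?_).congr fun p => ?_
    · rintro ⟨a, b⟩ ⟨a', b'⟩ h
      simp only [Prod.mk.injEq] at h ⊢
      omega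
    · rw [norm_smul, mul_pow, norm_inv, mul_comm]
  set R1 : BlockHS H := ⟨fun p => (((1 : ℝ) : ℂ) - Complex.I * (κ * p.2 : ℝ))⁻¹ • v (p.1 + p.2),
    memLp_two_iff.2 hR1⟩ with hR1def
  -- R(μ) is R(1) times the ratios (1 − iκl)/(μ − iκl), which are bounded by 1 and tend to zero
  -- entrywise. The maximum with 1 only makes the bound hold for every real μ.
  set γ : ℝ → ℤ × ℤ → ℂ := fun μ p => (((1 : ℝ) : ℂ) - Complex.I * (κ * p.2 : ℝ)) /
    (((max μ 1 : ℝ) : ℂ) - Complex.I * (κ * p.2 : ℝ)) with hγdef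
  have hγ : ∀ μ p, ‖γ μ p‖ ≤ 1 := fun μ p => by
    rw [hγdef, norm_div]
    refine div_le_one_of_le₀ (le_of_sq_le_sq ?_ (norm_nonneg _)) (norm_nonneg _)
    rw [norm_sub_freq_sq, norm_sub_freq_sq]
    have : 1 ≤ max μ 1 := le_max_right _ _
    gcongr
  refine ⟨fun μ => R1.schur (γ μ) ⟨1, hγ μ⟩, fun μ hμ p => ?_, ?_⟩
  · rw [BlockHS.schur_apply]
    change γ μ p • ((((1 : ℝ) : ℂ) - Complex.I * (κ * p.2 : ℝ))⁻¹ • v (p.1 + p.2)) = _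
    rw [smul_smul, hγdef]
    dsimp only
    rw [max_eq_left hμ, div_mul_eq_mul_div, mul_inv_cancel₀ (sub_freq_ne_zero κ one_pos _), one_div]
  · refine tendsto_norm_schur R1 (fun μ => ⟨1, hγ μ⟩) hγ fun p => ?_
    refine squeeze_zero_norm' (a := fun μ : ℝ =>
      ‖((1 : ℝ) : ℂ) - Complex.I * (κ * p.2 : ℝ)‖ / μ) ?_ (tendsto_const_nhds.div_atTop tendsto_id)
    filter_upwards [eventually_ge_atTop 1] with μ hμ
    rw [hγdef]
    dsimp only
    rw [max_eq_left hμ, norm_div]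
    gcongr
    exact le_norm_sub_freq κ _

/-- On the domain of `diag(iκn)`, `V` is given by `V (μ - diag(iκn))⁻¹`. -/
lemma IsFreqMul.hankel_eq {κ μ : ℝ} (hμ : 1 ≤ μ) {v : ℤ → H →L[ℂ] H} {R : BlockHS H}
    (hR : ∀ p, R p = ((μ : ℂ) - Complex.I * (κ * p.2 : ℝ))⁻¹ • v (p.1 + p.2))
    {x w : SeqL2 H} (hx : IsFreqMul κ x w) (n : ℤ) :
    ∑' l, v (n + l) (x l) = R.op ((μ : ℂ) • x - w) n := by
  rw [BlockHS.op_apply]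
  refine tsum_congr fun l => ?_
  rw [hR, lp.coeFn_sub, Pi.sub_apply, hx l, lp.coeFn_smul, Pi.smul_apply, ← sub_smul,
    _root_.smul_apply, map_smul, smul_smul,
    inv_mul_cancel₀ (sub_freq_ne_zero κ (zero_lt_one.trans_le hμ) _), one_smul]

/-- The data of the first similarity transformation. -/
lemma exists_hankel_reduction {κ : ℝ} (hκ : κ ≠ 0) {v : ℤ → H →L[ℂ] H}
    (hv : Summable fun n => ‖v n‖ ^ 2)
    (hd : Summable fun p : ℤ × ℤ => ‖∑' n : ℤ, if n = p.2 then (0 : H →L[ℂ] H) else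
      (1 / ((p.2 : ℂ) - (n : ℂ))) • (v (p.1 + n) * v (p.2 + n))‖ ^ 2) :
    ∃ Y J W : BlockHS H, ‖Y‖ ≤ 1 / 2 ∧
      (∀ p : ℤ × ℤ, v (p.1 + p.2) - J p = (Complex.I * (κ * ((p.1 : ℝ) - p.2) : ℝ)) • Y p) ∧
      ∀ p : ℤ × ℤ, W p = ∑' n, v (p.1 + n) * Y (n, p.2) := by
  -- the untruncated matrix
  have hY0 : Summable fun p : ℤ × ℤ =>
      ‖(Complex.I * (κ * ((p.1 : ℝ) - p.2) : ℝ))⁻¹ • v (p.1 + p.2)‖ ^ 2 := by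
    refine (summable_mul_reindex hv (summable_int_sq_inv κ) (fun _ => by positivity)
      (fun _ => by positivity) (φ := fun p => p.1 + p.2) (ψ := fun p => p.1 - p.2) ?_).congr
      fun p => ?_
    · rintro ⟨a, b⟩ ⟨a', b'⟩ h
      simp only [Prod.mk.injEq] at h ⊢
      omega
    · rw [norm_smul, mul_pow, norm_inv, norm_freq_sub, mul_inv, mul_comm]
      push_cast
      ring
  set Y0 : BlockHS H := ⟨fun p => (Complex.I * (κ * ((p.1 : ℝ) - p.2) : ℝ))⁻¹ • v (p.1 + p.2),
    memLp_two_iff.2 hY0⟩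
  have hb : ∀ (N : ℕ) (p : ℤ × ℤ), ‖(if (N : ℤ) < |p.2| then 1 else 0 : ℂ)‖ ≤ 1 := fun N p => by
    split_ifs <;> simp
  have hlim := tendsto_norm_schur (l := atTop) Y0
    (γ := fun (N : ℕ) p => if (N : ℤ) < |p.2| then 1 else 0) (K := 1)
    (fun N => ⟨1, hb N⟩) hb fun p => by
      refine tendsto_const_nhds.congr' ?_
      filter_upwards [eventually_ge_atTop (|p.2|).toNat] with N hN
      rw [if_neg]
      omega
  -- Dropping finitely many columns makes Y small enough for 1 + Y to be invertible; the dropped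
  -- columns, with the diagonal, form J.
  obtain ⟨N, hN⟩ := (hlim.eventually (gt_mem_nhds (by norm_num : (0 : ℝ) < 1 / 2))).exists
  set Y := Y0.schur _ ⟨1, hb N⟩
  have hY : ∀ p : ℤ × ℤ, Y p = if (N : ℤ) < |p.2| then
      (Complex.I * (κ * ((p.1 : ℝ) - p.2) : ℝ))⁻¹ • v (p.1 + p.2) else 0 := fun p => by
    rw [BlockHS.schur_apply]
    change _ • ((Complex.I * (κ * ((p.1 : ℝ) - p.2) : ℝ))⁻¹ • v (p.1 + p.2)) = _
    split_ifs
    · rw [one_smul]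
    · rw [zero_smul]
  have hJ : Summable fun p : ℤ × ℤ =>
      ‖if p.1 = p.2 ∨ |p.2| ≤ N then v (p.1 + p.2) else 0‖ ^ 2 := by
    have hfin : ∀ (P : ℤ → Prop) [DecidablePred P], {n | P n}.Finite →
        Summable fun n => if P n then (1 : ℝ) else 0 := fun P _ hP =>
      summable_of_hasFiniteSupport (hP.subset fun n hn => by
        by_contra h
        exact hn (if_neg h))
    have h1 := summable_mul_reindex hv (hfin (fun n => n = 0) (finite_singleton 0))
      (fun _ => by positivity) (fun n => by split_ifs <;> norm_num)
      (φ := fun p => p.1 + p.2) (ψ := fun p => p.1 - p.2) (by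
        rintro ⟨a, b⟩ ⟨a', b'⟩ h
        simp only [Prod.mk.injEq] at h ⊢
        omega)
    have h2 := summable_mul_reindex hv (hfin (fun n => |n| ≤ N)
      ((Finset.Icc (-N : ℤ) N).finite_toSet.subset fun n hn => by
        rw [Finset.mem_coe, Finset.mem_Icc]
        exact abs_le.1 hn))
      (fun _ => by positivity) (fun n => by split_ifs <;> norm_num)
      (φ := fun p => p.1 + p.2) (ψ := fun p => p.2) (by
        rintro ⟨a, b⟩ ⟨a', b'⟩ h
        simp only [Prod.mk.injEq] at h ⊢
        omega)
    refine (h1.add h2).of_nonneg_of_le (fun _ => by positivity) fun p => ?_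
    by_cases c1 : p.1 = p.2 <;> by_cases c2 : |p.2| ≤ N <;> simp [c1, c2, sub_eq_zero]
  -- In a kept column l the sum defining W is −(iκ)⁻¹ times the inner sum of the double-series
  -- hypothesis; the other columns vanish.
  have hW : Summable fun p : ℤ × ℤ => ‖∑' n, v (p.1 + n) * Y (n, p.2)‖ ^ 2 := by
    refine (hd.mul_left (|κ|⁻¹ ^ 2)).of_nonneg_of_le (fun _ => by positivity) fun p => ?_
    rw [← mul_pow]
    refine pow_le_pow_left₀ (norm_nonneg _) ?_ 2
    by_cases hp : (N : ℤ) < |p.2|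
    · have hsum : Summable fun n : ℤ => if n = p.2 then (0 : H →L[ℂ] H) else
          (1 / ((p.2 : ℂ) - (n : ℂ))) • (v (p.1 + n) * v (p.2 + n)) := by
        refine (summable_mul_norm (summable_hankel_row hv p.1)
          (summable_hankel_row hv p.2)).of_norm_bounded fun n => ?_
        split_ifs with hn
        · rw [norm_zero]
          positivity
        · rw [norm_smul]
          have h1 : (1 : ℝ) ≤ ‖(p.2 : ℂ) - n‖ := by
            rw [← Int.cast_sub, Complex.norm_intCast]
            exact_mod_cast Int.one_le_abs (sub_ne_zero.2 (Ne.symm hn))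
          have h2 : ‖(1 : ℂ) / ((p.2 : ℂ) - n)‖ ≤ 1 := by
            rw [norm_div, norm_one]
            exact div_le_one_of_le₀ h1 (norm_nonneg _)
          calc _ ≤ 1 * (‖v (p.1 + n)‖ * ‖v (p.2 + n)‖) := by
                gcongr
                exact norm_mul_le _ _
            _ = _ := one_mul _
      have e : ∑' n, v (p.1 + n) * Y (n, p.2) = (-(Complex.I * κ)⁻¹) •
          ∑' n : ℤ, if n = p.2 then (0 : H →L[ℂ] H) else
            (1 / ((p.2 : ℂ) - (n : ℂ))) • (v (p.1 + n) * v (p.2 + n)) := by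
        rw [← hsum.tsum_const_smul]
        refine tsum_congr fun n => ?_
        rw [hY, if_pos hp, add_comm n p.2]
        -- For n = l the excluded term of the hypothesis matches `Y (l, l) = 0`, a consequence of
        -- the convention 0⁻¹ = 0.
        split_ifs with hn
        · rw [hn]
          simp
        · rw [mul_smul_comm, smul_smul]
          congr 1
          have h1 : (p.2 : ℂ) - n ≠ 0 := sub_ne_zero.2 (by exact_mod_cast Ne.symm hn)
          have h2 : (n : ℂ) - p.2 ≠ 0 := sub_ne_zero.2 (by exact_mod_cast hn)
          have h3 : (κ : ℂ) ≠ 0 := by exact_mod_cast hκ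
          have h4 := Complex.I_ne_zero
          push_cast
          field_simp
          ring
      rw [e, norm_smul, norm_neg, norm_inv, norm_mul, Complex.norm_I, one_mul, Complex.norm_real,
        Real.norm_eq_abs]
    · have e : ∀ n, v (p.1 + n) * Y (n, p.2) = 0 := fun n => by
        rw [hY, if_neg hp, mul_zero]
      simp only [e, tsum_zero, norm_zero]
      positivity
  refine ⟨Y, ⟨_, memLp_two_iff.2 hJ⟩, ⟨_, memLp_two_iff.2 hW⟩, hN.le, fun p => ?_, fun p => rfl⟩
  change v (p.1 + p.2) - (if p.1 = p.2 ∨ |p.2| ≤ N then v (p.1 + p.2) else 0) = _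
  rw [hY]
  by_cases c1 : p.1 = p.2
  · simp [c1]
  · by_cases c2 : |p.2| ≤ N
    · simp [c2, not_lt.2 c2]
    · rw [if_neg (by tauto), if_pos (not_le.1 c2), sub_zero, smul_smul, mul_inv_cancel₀, one_smul]
      have h1 : (p.1 : ℝ) - p.2 ≠ 0 := sub_ne_zero.2 (by exact_mod_cast c1)
      exact mul_ne_zero Complex.I_ne_zero (Complex.ofReal_ne_zero.2 (mul_ne_zero hκ h1))

/-- A bounded perturbation: `Y` and `W` combine into one Hilbert–Schmidt matrix `B` with
`(1 + Y) B = J + W`. -/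
lemma exists_left_division {Y : BlockHS H} (hY : ‖Y‖ ≤ 1 / 2) (C : BlockHS H) :
    ∃ B : BlockHS H, B + Y.prod B = C := by
  obtain ⟨B, -, hB⟩ := exists_fixedPoint_of_lipschitz_on_ball (F := fun B => C - Y.prod B)
    (r := 2 * ‖C‖) (L := 1 / 2) (by positivity) (by norm_num) (fun B hB => by
      refine (norm_sub_le _ _).trans ?_
      have h1 : ‖Y.prod B‖ ≤ 1 / 2 * (2 * ‖C‖) := (Y.norm_prod_le B).trans (by gcongr)
      linarith) fun B B' _ _ => by
      rw [sub_sub_sub_cancel_left, ← BlockHS.prod_sub, norm_sub_rev B]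
      exact (Y.norm_prod_le _).trans (by gcongr)
  exact ⟨B, eq_sub_iff_add_eq.1 hB.symm⟩

/-- First similarity transformation: `(L₀ - V)(1 + Y) = (1 + Y)(L₀ - B)` on the domain of `L₀`. -/
lemma IsFreqMul.hankel_similarity {κ : ℝ} (hκ : κ ≠ 0) {v : ℤ → H →L[ℂ] H}
    (hv : Summable fun n => ‖v n‖ ^ 2) {Y J W B : BlockHS H}
    (hJ : ∀ p : ℤ × ℤ, v (p.1 + p.2) - J p = (Complex.I * (κ * ((p.1 : ℝ) - p.2) : ℝ)) • Y p)
    (hW : ∀ p : ℤ × ℤ, W p = ∑' n, v (p.1 + n) * Y (n, p.2))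
    (hB : B + Y.prod B = J + W) {x w : SeqL2 H} (hx : IsFreqMul κ x w) :
    IsHankelPair κ v ((1 + Y.op) x) ((1 + Y.op) (w - B.op x)) := by
  obtain ⟨R, hR, -⟩ := exists_hankel_resolvent hκ hv
  have hV := hx.hankel_eq le_rfl (hR 1 le_rfl)
  set Vx := (R 1).op (((1 : ℝ) : ℂ) • x - w)
  -- W = VY holds by definition on columns. It extends to all x because each row of V is a bounded
  -- functional, although V itself need not be bounded.
  have hWx : ∀ n, ∑' l, v (n + l) (Y.op x l) = W.op x n := fun n => by
    have h : rowOp _ (summable_hankel_row hv n) ∘L Y.op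
        = lp.evalCLM ℂ (fun _ : ℤ => H) 2 n ∘L W.op := SeqL2.clm_ext fun l h => by
      change ∑' j, v (n + j) (Y.op (lp.single 2 l h) j) = W.op (lp.single 2 l h) n
      simp only [BlockHS.op_single]
      rw [hW]
      exact ((ContinuousLinearMap.apply ℂ H h).map_tsum ((summable_mul_norm
        (summable_hankel_row hv n) (Y.summable_col l)).of_norm_bounded
          fun _ => norm_mul_le _ _)).symm
    exact congrArg (fun T : SeqL2 H →L[ℂ] H => T x) h
  have hopB : B.op x + Y.op (B.op x) = J.op x + W.op x := by
    have := congrArg (fun a : BlockHS H => a.op x) hB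
    simpa only [BlockHS.op_add, BlockHS.op_prod, _root_.add_apply, mul_apply_eq_comp] using this
  -- The commutator L₀Y − YL₀ = V − J, where L₀ = diag(iκn), gives this value for L₀(1 + Y)x.
  -- Subtracting V(1 + Y)x = Vx + Wx leaves (1 + Y)w − (J + W)x, and J + W = (1 + Y)B.
  refine ⟨w + Y.op w + Vx - J.op x, fun n => ?_, fun n => ?_⟩
  · have h1 := (hx.hasSum_commutator Y hJ n).tsum_eq
    have h2 : ∑' l, (v (n + l) - J (n, l)) (x l) = Vx n - J.op x n := by
      rw [← hV n, BlockHS.op_apply, ← (summable_row_apply (summable_hankel_row hv n)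
        (summable_norm_sq x)).tsum_sub (summable_row_apply (J.summable_row n) (summable_norm_sq x))]
      rfl
    rw [h2] at h1
    simp only [lp.coeFn_sub, lp.coeFn_add, Pi.sub_apply, Pi.add_apply, _root_.add_apply,
      one_apply_eq_self, smul_add]
    rw [← hx n, add_sub_assoc, h1]
    abel
  · have h1 : ∑' l, v (n + l) ((1 + Y.op) x l) = Vx n + W.op x n := by
      rw [← hV n, ← hWx n, ← (summable_row_apply (summable_hankel_row hv n)
        (summable_norm_sq x)).tsum_add (summable_row_apply (summable_hankel_row hv n)
        (summable_norm_sq (Y.op x)))]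
      refine tsum_congr fun l => ?_
      rw [← map_add]
      rfl
    have h2 := congrArg (fun y : SeqL2 H => y n) hopB
    rw [h1]
    simp only [lp.coeFn_sub, lp.coeFn_add, Pi.sub_apply, Pi.add_apply, _root_.add_apply,
      one_apply_eq_self, map_sub] at h2 ⊢
    rw [← sub_eq_zero] at h2 ⊢
    refine Eq.trans ?_ (neg_eq_zero.2 h2)
    abel

/-- Second similarity transformation: `(L₀ - B)(1 + Y) = (1 + Y)(L₀ - b)` on the domain of `L₀`. -/
lemma IsFreqMul.block_similarity {κ : ℝ} {X Y B b : BlockHS H}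
    (hX : ∀ p : ℤ × ℤ, X p - b p = (Complex.I * (κ * ((p.1 : ℝ) - p.2) : ℝ)) • Y p)
    (hB : X + Y.prod b = B + B.prod Y) {x w : SeqL2 H} (hx : IsFreqMul κ x w) :
    ∃ w', IsFreqMul κ ((1 + Y.op) x) w' ∧
      w' - B.op ((1 + Y.op) x) = (1 + Y.op) (w - b.op x) := by
  have hop : X.op x + Y.op (b.op x) = B.op x + B.op (Y.op x) := by
    have := congrArg (fun a : BlockHS H => a.op x) hB
    simpa only [BlockHS.op_add, BlockHS.op_prod, _root_.add_apply, mul_apply_eq_comp] using this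
  -- Here the commutator L₀Y − YL₀ is X − b, and X + Yb = B + BY cancels the terms other than (1 +
  -- Y)(w − bx).
  refine ⟨w + Y.op w + X.op x - b.op x, fun n => ?_, ?_⟩
  · have h1 := (hx.hasSum_commutator Y (a := ⇑(X - b)) hX n).unique ((X - b).hasSum_op x n)
    rw [BlockHS.op_sub, _root_.sub_apply, lp.coeFn_sub, Pi.sub_apply] at h1
    simp only [lp.coeFn_sub, lp.coeFn_add, Pi.sub_apply, Pi.add_apply, _root_.add_apply,
      one_apply_eq_self, smul_add]
    rw [← hx n, add_sub_assoc, ← h1]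
    abel
  · simp only [_root_.add_apply, one_apply_eq_self, map_sub, map_add]
    rw [← sub_eq_zero] at hop ⊢
    rw [← hop]
    abel

/-- `μ - (diag(iκn) - b)` is surjective for large real `μ`. -/
lemma exists_freqMul_solution (κ : ℝ) (b : BlockHS H) {μ : ℝ} (hμ : ‖b.op‖ < μ) (y : SeqL2 H) :
    ∃ x w, IsFreqMul κ x w ∧ (μ : ℂ) • x - (w - b.op x) = y := by
  have hμ0 : 0 < μ := (norm_nonneg _).trans_lt hμ
  have hφ : ∀ n : ℤ, ‖((μ : ℂ) - Complex.I * (κ * n : ℝ))⁻¹‖ ≤ μ⁻¹ := fun n => by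
    rw [norm_inv]
    exact inv_anti₀ hμ0 (le_norm_sub_freq κ n)
  set R := diagOp H (fun n : ℤ => ((μ : ℂ) - Complex.I * (κ * n : ℝ))⁻¹) ⟨_, hφ⟩
  have hsmall : ‖-(b.op * R)‖ < 1 := by
    rw [norm_neg]
    calc ‖b.op * R‖ ≤ ‖b.op‖ * μ⁻¹ :=
          (norm_mul_le _ _).trans (by gcongr; exact norm_diagOp_le _ (by positivity) hφ)
      _ < μ * μ⁻¹ := by gcongr
      _ = 1 := mul_inv_cancel₀ hμ0.ne'
  have hunit := isUnit_one_sub_of_norm_lt_one hsmall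
  set s := Ring.inverse (1 - -(b.op * R)) y
  have hs : s + b.op (R s) = y := by
    have h : s - -(b.op (R s)) = y :=
      congrArg (fun T : SeqL2 H →L[ℂ] SeqL2 H => T y) (Ring.mul_inverse_cancel _ hunit)
    rwa [sub_neg_eq_add] at h
  refine ⟨R s, (μ : ℂ) • R s - s, fun n => ?_, ?_⟩
  · have h1 : R s n = ((μ : ℂ) - Complex.I * (κ * n : ℝ))⁻¹ • s n := diagOp_apply _ _ _ _
    have h2 : s n = ((μ : ℂ) - Complex.I * (κ * n : ℝ)) • R s n := by
      rw [h1, smul_smul, mul_inv_cancel₀ (sub_freq_ne_zero κ hμ0 n), one_smul]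
    have h3 : (Complex.I * (κ * n : ℝ)) • R s n
        = (μ : ℂ) • R s n - ((μ : ℂ) - Complex.I * (κ * n : ℝ)) • R s n := by
      rw [sub_smul, sub_sub_cancel]
    rw [h3]
    exact congrArg (fun t => (μ : ℂ) • R s n - t) h2
  · rw [← hs]
    abel

/-- `μ - (diag(iκn) - V)` is injective for large real `μ`. -/
lemma IsHankelPair.eq_zero {κ μ : ℝ} (hμ : 1 ≤ μ) {v : ℤ → H →L[ℂ] H} {R : BlockHS H}
    (hR : ∀ p, R p = ((μ : ℂ) - Complex.I * (κ * p.2 : ℝ))⁻¹ • v (p.1 + p.2))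
    (hR1 : ‖R‖ < 1) {x : SeqL2 H} (hx : IsHankelPair κ v x ((μ : ℂ) • x)) : x = 0 := by
  obtain ⟨w, hw, hz⟩ := hx
  -- The vector u = (μ − L₀)x is a fixed point of −V(μ − L₀)⁻¹, whose norm is below 1, hence u = 0.
  have h1 : (μ : ℂ) • x - w = -R.op ((μ : ℂ) • x - w) := lp.ext <| funext fun n => by
    rw [lp.coeFn_neg, Pi.neg_apply, ← hw.hankel_eq hμ hR n, lp.coeFn_sub, Pi.sub_apply, hz n]
    abel
  have h2 : ‖(μ : ℂ) • x - w‖ ≤ ‖R‖ * ‖(μ : ℂ) • x - w‖ := by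
    nth_rw 1 [h1]
    rw [norm_neg]
    exact (R.op.le_opNorm _).trans (by gcongr; exact R.norm_op_le)
  have h3 : (μ : ℂ) • x - w = 0 := by
    by_contra hne
    have := norm_pos_iff.2 hne
    nlinarith
  refine lp.ext <| funext fun n => ?_
  have h4 := congrArg (fun y : SeqL2 H => y n) h3
  simp only [lp.coeFn_sub, Pi.sub_apply, lp.coeFn_smul, Pi.smul_apply, hw n] at h4
  rw [← sub_smul] at h4
  exact (smul_eq_zero.1 h4).resolve_left (sub_freq_ne_zero κ (zero_lt_one.trans_le hμ) n)

lemma IsHankelPair.sub {κ : ℝ} {v : ℤ → H →L[ℂ] H} (hv : Summable fun n => ‖v n‖ ^ 2)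
    {x z x' z' : SeqL2 H} (h : IsHankelPair κ v x z) (h' : IsHankelPair κ v x' z') :
    IsHankelPair κ v (x - x') (z - z') := by
  obtain ⟨w, hw, hz⟩ := h
  obtain ⟨w', hw', hz'⟩ := h'
  refine ⟨w - w', fun n => ?_, fun n => ?_⟩
  · rw [lp.coeFn_sub, Pi.sub_apply, hw, hw', lp.coeFn_sub, Pi.sub_apply, smul_sub]
  · have h1 : ∑' l, v (n + l) ((x - x' : SeqL2 H) l)
        = ∑' l, v (n + l) (x l) - ∑' l, v (n + l) (x' l) := by
      rw [← (summable_row_apply (summable_hankel_row hv n) (summable_norm_sq x)).tsum_sub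
        (summable_row_apply (summable_hankel_row hv n) (summable_norm_sq x'))]
      simp only [lp.coeFn_sub, Pi.sub_apply, map_sub]
    rw [h1, lp.coeFn_sub, lp.coeFn_sub, Pi.sub_apply, Pi.sub_apply, hz, hz']
    abel

lemma exists_equiv_one_add {Y : BlockHS H} (hY : ‖Y‖ < 1) :
    ∃ U : SeqL2 H ≃L[ℂ] SeqL2 H, ∀ x, U x = (1 + Y.op) x := by
  have h : IsUnit (1 + Y.op) := by
    have := isUnit_one_sub_of_norm_lt_one (x := -Y.op)
      (by rw [norm_neg]; exact Y.norm_op_le.trans_lt hY)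
    rwa [sub_neg_eq_add] at this
  exact ⟨ContinuousLinearEquiv.ofUnit h.unit, fun x => rfl⟩

/-- `diag(iκn) - V` is similar to `diag(iκn) - b` with a block diagonal `b`. -/
theorem exists_hankel_similarity {κ : ℝ} (hκ : κ ≠ 0) {v : ℤ → H →L[ℂ] H}
    (hv : Summable fun n => ‖v n‖ ^ 2)
    (hd : Summable fun p : ℤ × ℤ => ‖∑' n : ℤ, if n = p.2 then (0 : H →L[ℂ] H) else
      (1 / ((p.2 : ℂ) - (n : ℂ))) • (v (p.1 + n) * v (p.2 + n))‖ ^ 2) :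
    ∃ (U : SeqL2 H ≃L[ℂ] SeqL2 H) (m : ℕ) (b : BlockHS H), IsBlockDiag m b ∧
      ∀ x z, IsHankelPair κ v x z ↔
        IsFreqMul κ (U.symm x) (U.symm z + b.op (U.symm x)) := by
  obtain ⟨Y₁, J, W, hY₁, hJ, hW⟩ := exists_hankel_reduction hκ hv hd
  obtain ⟨B, hB⟩ := exists_left_division hY₁ (J + W)
  obtain ⟨m, X, Y₂, b, hY₂, hb, hX, hBX⟩ := exists_blockDiagonalization hκ B
  obtain ⟨U₁, hU₁⟩ := exists_equiv_one_add (hY₁.trans_lt (by norm_num))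
  obtain ⟨U₂, hU₂⟩ := exists_equiv_one_add hY₂
  have hU : ∀ x, (U₂.trans U₁) x = (1 + Y₁.op) ((1 + Y₂.op) x) := fun x => by
    rw [ContinuousLinearEquiv.trans_apply, hU₁, hU₂]
  have hfwd : ∀ u w, IsFreqMul κ u w →
      IsHankelPair κ v ((U₂.trans U₁) u) ((U₂.trans U₁) (w - b.op u)) := fun u w hu => by
    obtain ⟨w', hw', he⟩ := hu.block_similarity hX hBX
    rw [hU, hU, ← he]
    exact hw'.hankel_similarity hκ hv hJ hW hB
  set U := U₂.trans U₁
  refine ⟨U, m, b, hb, fun x z => ⟨fun h => ?_, fun h => ?_⟩⟩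
  -- The intertwining gives only an inclusion of graphs. A pair (x, z) of the larger graph is
  -- compared with a pair from the smaller one having the same image under μ minus the operator: it
  -- exists by surjectivity on the block diagonal side, and equals (x, z) by injectivity of μ − (L₀
  -- − V).
  · obtain ⟨R, hR, hRlim⟩ := exists_hankel_resolvent hκ hv
    obtain ⟨μ, hμ1, hμ2, hμ3⟩ := ((hRlim.eventually (gt_mem_nhds one_pos)).and
      ((eventually_ge_atTop 1).and (eventually_gt_atTop ‖b.op‖))).exists
    obtain ⟨u, w, hu, hy⟩ := exists_freqMul_solution κ b hμ3 (U.symm ((μ : ℂ) • x - z))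
    have h1 := hfwd u w hu
    have h2 : U (w - b.op u) = (μ : ℂ) • U u - ((μ : ℂ) • x - z) := by
      rw [← map_smul U, ← U.apply_symm_apply ((μ : ℂ) • x - z), ← map_sub U, ← hy, sub_sub_cancel]
    have h3 := h.sub hv h1
    have h4 : z - U (w - b.op u) = (μ : ℂ) • (x - U u) := by
      rw [h2, smul_sub]
      abel
    rw [h4] at h3
    have h5 : x = U u := sub_eq_zero.1 (h3.eq_zero hμ2 (hR μ hμ2) hμ1)
    have h6 : z = U (w - b.op u) := by
      rw [← sub_eq_zero, h4, ← h5, sub_self, smul_zero]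
    rw [h6, h5, U.symm_apply_apply, U.symm_apply_apply, sub_add_cancel]
    exact hu
  · have h1 := hfwd _ _ h
    rwa [add_sub_cancel_right, U.apply_symm_apply, U.apply_symm_apply] at h1

/-- The part of `diag(iκn)` on the central block. -/
lemma exists_central_diag (κ : ℝ) (m : ℕ) : ∃ e : BlockHS H, IsBlockDiag m e ∧
    ∀ (x : SeqL2 H) n, e.op x n =
      (Complex.I * (κ * n : ℝ) - Complex.I * (κ * modelFreq m n : ℝ)) • x n := by
  set f : ℤ × ℤ → H →L[ℂ] H := fun p => if p.1 = p.2 then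
    (Complex.I * (κ * p.1 : ℝ) - Complex.I * (κ * modelFreq m p.1 : ℝ)) • 1 else 0 with hf
  have hsum : Summable fun p => ‖f p‖ ^ 2 := by
    refine summable_of_hasFiniteSupport
      ((((Finset.Icc (-m : ℤ) m) ×ˢ (Finset.Icc (-m : ℤ) m)).finite_toSet).subset fun p hp => ?_)
    have h1 : p.1 = p.2 ∧ ¬ (m : ℤ) < |p.1| := by
      constructor
      · by_contra h
        exact hp (by simp [hf, h])
      · intro h
        exact hp (by simp [hf, modelFreq_of_lt h])
    rw [Finset.coe_product]
    have h2 := mem_Icc_iff_not_lt_abs.2 h1.2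
    exact ⟨h2, show p.2 ∈ _ from h1.1 ▸ h2⟩
  refine ⟨⟨f, memLp_two_iff.2 hsum⟩, fun p hp => if_neg fun h => hp (by rw [h]), fun x n => ?_⟩
  rw [BlockHS.op_apply, tsum_eq_single n]
  · change f (n, n) (x n) = _
    rw [hf]
    simp only [if_true]
    rfl
  · intro l hl
    change f (n, l) (x l) = 0
    rw [hf]
    simp only [if_neg hl.symm]
    rfl

/-- `diag(iκn) - V` is similar to a model operator. -/
theorem exists_hankel_model {κ : ℝ} (hκ : κ ≠ 0) {v : ℤ → H →L[ℂ] H}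
    (hv : Summable fun n => ‖v n‖ ^ 2)
    (hd : Summable fun p : ℤ × ℤ => ‖∑' n : ℤ, if n = p.2 then (0 : H →L[ℂ] H) else
      (1 / ((p.2 : ℂ) - (n : ℂ))) • (v (p.1 + n) * v (p.2 + n))‖ ^ 2) :
    ∃ (U : SeqL2 H ≃L[ℂ] SeqL2 H) (m : ℕ) (c : BlockHS H), IsBlockDiag m c ∧
      ∀ x z, IsHankelPair κ v x z ↔ ∀ n, U z n =
        (Complex.I * (κ * modelFreq m n : ℝ)) • U x n + c.op (U x) n := by
  obtain ⟨U, m, b, hb, h⟩ := exists_hankel_similarity hκ hv hd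
  obtain ⟨e, he, hex⟩ := exists_central_diag (H := H) κ m
  -- The central frequencies, finitely many, are moved into the bounded part so that it commutes
  -- with the remaining diagonal operator.
  refine ⟨U.symm, m, e - b, fun p hp => ?_, fun x z => ?_⟩
  · rw [lp.coeFn_sub, Pi.sub_apply, he p hp, hb p hp, sub_zero]
  · rw [h]
    refine forall_congr' fun n => ?_
    rw [BlockHS.op_sub, _root_.sub_apply, lp.coeFn_sub, Pi.sub_apply, hex, lp.coeFn_add,
      Pi.add_apply, ← add_sub_assoc, ← add_smul, add_sub_cancel, eq_sub_iff_add_eq]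

end HankelMatrices

/-! ### Fourier series in `L²([0, ω], H)` -/

section Fourier

variable {H : Type*} [NormedAddCommGroup H] [InnerProductSpace ℂ H]

lemma integral_mu {ω : ℝ} (hω : 0 < ω) (f : ℝ → H) :
    ∫ s, f s ∂(mu ω) = ω⁻¹ • ∫ s in (0 : ℝ)..ω, f s := by
  rw [mu, integral_smul_measure, ENNReal.toReal_ofReal (by positivity),
    intervalIntegral.integral_of_le hω.le, integral_Icc_eq_integral_Ioc]

lemma expNeg_zero (ω s : ℝ) : expNeg ω 0 s = 1 := by simp [expNeg]

lemma expNeg_add (ω : ℝ) (n m : ℤ) (s : ℝ) :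
    expNeg ω (n + m) s = expNeg ω n s * expNeg ω m s := by
  rw [expNeg, expNeg, expNeg, ← Complex.exp_add]
  congr 1
  push_cast
  ring

lemma conj_expNeg (ω : ℝ) (n : ℤ) (s : ℝ) :
    (starRingEnd ℂ) (expNeg ω n s) = expNeg ω (-n) s := by
  rw [expNeg, expNeg, ← Complex.exp_conj, map_mul, Complex.conj_I, ← Complex.ofReal_neg,
    Complex.conj_ofReal]
  congr 1
  push_cast
  ring

lemma continuous_expNeg (ω : ℝ) (n : ℤ) : Continuous (expNeg ω n) := by
  unfold expNeg
  fun_prop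

/-- The exponent of `expNeg` in terms of `κ = 2π/ω`. -/
lemma expNeg_eq (ω : ℝ) (n : ℤ) (s : ℝ) :
    expNeg ω n s = Complex.exp (-(Complex.I * (2 * Real.pi / ω * n : ℝ)) * s) := by
  rw [expNeg]
  congr 1
  push_cast
  ring

lemma freq_ne_zero {ω : ℝ} (hω : 0 < ω) {n : ℤ} (hn : n ≠ 0) :
    Complex.I * (2 * Real.pi / ω * n : ℝ) ≠ 0 := by
  have h : 2 * Real.pi / ω * n ≠ 0 :=
    mul_ne_zero (div_ne_zero (by positivity) hω.ne') (by exact_mod_cast hn)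
  exact mul_ne_zero Complex.I_ne_zero (Complex.ofReal_ne_zero.2 h)

lemma expNeg_period {ω : ℝ} (hω : 0 < ω) (n : ℤ) : expNeg ω n ω = 1 := by
  rw [expNeg, ← Complex.exp_int_mul_two_pi_mul_I (-n)]
  congr 1
  have : (ω : ℂ) ≠ 0 := by exact_mod_cast hω.ne'
  push_cast
  field_simp

lemma integral_expNeg_interval {ω : ℝ} (hω : 0 < ω) {n : ℤ} (hn : n ≠ 0) (τ : ℝ) :
    ∫ s in τ..ω, expNeg ω n s
      = (Complex.I * (2 * Real.pi / ω * n : ℝ))⁻¹ * (expNeg ω n τ - 1) := by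
  have h0 := freq_ne_zero hω hn
  have h1 := expNeg_period hω n
  simp only [expNeg_eq] at h1 ⊢
  rw [integral_exp_mul_complex (neg_ne_zero.2 h0), h1, div_neg, ← neg_div, neg_sub,
    div_eq_inv_mul]

lemma integral_expNeg {ω : ℝ} (hω : 0 < ω) (n : ℤ) :
    ∫ s, expNeg ω n s ∂(mu ω) = if n = 0 then 1 else 0 := by
  rw [integral_mu hω]
  split_ifs with hn
  · subst hn
    simp only [expNeg_zero]
    simp [hω.ne']
  · rw [integral_expNeg_interval hω hn]
    simp [expNeg]

lemma memLp_expNeg_smul {ω : ℝ} (n : ℤ) {f : ℝ → H} (hf : MemLp f 2 (mu ω)) :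
    MemLp (fun s => expNeg ω n s • f s) 2 (mu ω) := by
  refine hf.of_le ((continuous_expNeg ω n).aestronglyMeasurable.smul hf.1)
    (Eventually.of_forall fun s => ?_)
  rw [norm_smul, norm_expNeg, one_mul]

variable [CompleteSpace H]

lemma fourierCoeffL2_apply (ω : ℝ) (n : ℤ) (x : L2 ω H) :
    fourierCoeffL2 ω H n x = ∫ s, expNeg ω n s • x s ∂(mu ω) := rfl

lemma fourierCoeffL2_toLp {ω : ℝ} (n : ℤ) {f : ℝ → H} (hf : MemLp f 2 (mu ω)) :
    fourierCoeffL2 ω H n hf.toLp = ∫ s, expNeg ω n s • f s ∂(mu ω) := by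
  rw [fourierCoeffL2_apply]
  refine integral_congr_ae ?_
  filter_upwards [hf.coeFn_toLp] with s hs
  rw [hs]

/-- The function `s ↦ e^{2πins/ω} x`. -/
def expVec (ω : ℝ) (n : ℤ) (x : H) : L2 ω H :=
  (memLp_expNeg_smul (-n) (memLp_const (μ := mu ω) x)).toLp

lemma coeFn_expVec (ω : ℝ) (n : ℤ) (x : H) :
    expVec ω n x =ᵐ[mu ω] fun s => expNeg ω (-n) s • x := MemLp.coeFn_toLp _

lemma inner_expVec (ω : ℝ) (n : ℤ) (x : H) (y : L2 ω H) :
    inner ℂ (expVec ω n x) y = inner ℂ x (fourierCoeffL2 ω H n y) := by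
  rw [L2.inner_def, fourierCoeffL2_apply,
    ← integral_inner (integrable_expNeg_smul n (Lp.memLp y))]
  refine integral_congr_ae ?_
  filter_upwards [coeFn_expVec ω n x] with s hs
  rw [hs, inner_smul_left, inner_smul_right, conj_expNeg, neg_neg]

lemma fourierCoeffL2_expVec {ω : ℝ} (hω : 0 < ω) (n m : ℤ) (x : H) :
    fourierCoeffL2 ω H n (expVec ω m x) = if n = m then x else 0 := by
  rw [expVec, fourierCoeffL2_toLp]
  simp only [smul_smul, ← expNeg_add]
  rw [integral_smul_const, integral_expNeg hω]
  simp only [← sub_eq_add_neg, sub_eq_zero]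
  split_ifs <;> simp

/-- The isometry `x ↦ e^{2πins/ω} x`. -/
def expIsometry {ω : ℝ} (hω : 0 < ω) (n : ℤ) : H →ₗᵢ[ℂ] L2 ω H where
  toFun := expVec ω n
  map_add' x y := by
    rw [expVec, expVec, expVec, ← MemLp.toLp_add]
    refine (MemLp.toLp_eq_toLp_iff _ _).2 (Eventually.of_forall fun s => ?_)
    simp
  map_smul' c x := by
    rw [RingHom.id_apply, expVec, expVec, ← MemLp.toLp_const_smul]
    refine (MemLp.toLp_eq_toLp_iff _ _).2 (Eventually.of_forall fun s => ?_)
    simp [smul_comm c]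
  norm_map' x := by
    have h : inner ℂ (expVec ω n x) (expVec ω n x) = inner ℂ x x := by
      rw [inner_expVec, fourierCoeffL2_expVec hω, if_pos rfl]
    rw [inner_self_eq_norm_sq_to_K, inner_self_eq_norm_sq_to_K] at h
    have h1 : ‖expVec ω n x‖ ^ 2 = ‖x‖ ^ 2 := by exact_mod_cast h
    exact (sq_eq_sq₀ (norm_nonneg _) (norm_nonneg _)).1 h1

lemma orthogonalFamily_expIsometry {ω : ℝ} (hω : 0 < ω) :
    OrthogonalFamily ℂ (fun _ : ℤ => H) fun n => expIsometry (H := H) hω n := by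
  intro n m hnm x y
  change inner ℂ (expVec ω n x) (expVec ω m y) = 0
  rw [inner_expVec, fourierCoeffL2_expVec hω, if_neg hnm, inner_zero_right]

/-- A function in `L²` is determined by its Fourier coefficients. -/
lemma eq_zero_of_fourierCoeffL2 {ω : ℝ} (hω : 0 < ω) {y : L2 ω H}
    (hy : ∀ n, fourierCoeffL2 ω H n y = 0) : y = 0 := by
  have : Fact (0 < ω) := ⟨hω⟩
  have hyi : Integrable y (mu ω) := (Lp.memLp y).integrable (by norm_num)
  have hint : ∀ F : C(AddCircle ω, ℂ), Integrable (fun s : ℝ => F (s : AddCircle ω) • y s) (mu ω) :=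
    fun F => hyi.bdd_smul ‖F‖
      ((F.continuous.comp (AddCircle.continuous_mk' ω)).aestronglyMeasurable)
      (Eventually.of_forall fun s => F.norm_coe_le_norm _)
  let Λ : C(AddCircle ω, ℂ) →L[ℂ] H := LinearMap.mkContinuous
    { toFun := fun F => ∫ s, F (s : AddCircle ω) • y s ∂(mu ω)
      map_add' := fun F G => by
        rw [← integral_add (hint F) (hint G)]
        simp [add_smul]
      map_smul' := fun c F => by
        rw [RingHom.id_apply, ← integral_smul]
        simp [smul_smul] } (∫ s, ‖y s‖ ∂(mu ω)) fun F => by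
      refine (norm_integral_le_integral_norm _).trans ?_
      rw [mul_comm, ← integral_const_mul]
      refine integral_mono (hint F).norm (hyi.norm.const_mul _) fun s => ?_
      change ‖F (s : AddCircle ω) • y s‖ ≤ ‖F‖ * ‖y s‖
      rw [norm_smul]
      gcongr
      exact F.norm_coe_le_norm _
  -- The functional vanishes on trigonometric monomials, whose span is dense in the continuous
  -- functions on the circle.
  have hΛ : ∀ F, Λ F = 0 := fun F => by
    have h1 : (Submodule.span ℂ (range <| @fourier ω)).topologicalClosure ≤ LinearMap.ker Λ.toLinearMap := by
      refine Submodule.topologicalClosure_minimal _ (Submodule.span_le.2 ?_) Λ.isClosed_ker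
      rintro _ ⟨n, rfl⟩
      change ∫ s : ℝ, fourier n (s : AddCircle ω) • y s ∂(mu ω) = 0
      rw [← hy (-n), fourierCoeffL2_apply]
      congr 1
      funext s
      rw [fourier_coe_apply, expNeg]
      congr 2
      push_cast
      ring
    rw [span_fourier_closure_eq_top] at h1
    exact h1 (Submodule.mem_top (x := F))
  -- A test function supported in (0, ω) vanishes at both endpoints, so it descends to a continuous
  -- function on the circle, and `hΛ` applies.
  have hae : ∀ᵐ s ∂(mu ω), s ∈ Ioo 0 ω → y s = 0 := by
    refine isOpen_Ioo.ae_eq_zero_of_integral_contDiff_smul_eq_zero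
      (hyi.locallyIntegrable.locallyIntegrableOn _) fun g hg _ hgs => ?_
    have hg0 : ∀ s, s ∉ Ioo 0 ω → g s = 0 := fun s hs =>
      image_eq_zero_of_notMem_tsupport fun h => hs (hgs h)
    have hcont : Continuous (AddCircle.liftIco ω 0 fun s => (g s : ℂ)) := by
      refine AddCircle.liftIco_continuous ?_ (by
        have := hg.continuous
        fun_prop)
      rw [hg0 0 (by simp), hg0 (0 + ω) (by simp)]
    have h2 := hΛ ⟨_, hcont⟩
    rw [← h2]
    refine integral_congr_ae ((ae_mu_iff hω).2 ?_)
    filter_upwards [ae_restrict_mem measurableSet_Icc] with s hs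
    change g s • y s = AddCircle.liftIco ω 0 (fun s => (g s : ℂ)) (s : AddCircle ω) • y s
    rcases eq_or_lt_of_le hs.2 with rfl | hlt
    · have e : ((s : ℝ) : AddCircle s) = ((0 : ℝ) : AddCircle s) := by simp
      rw [e, AddCircle.liftIco_coe_apply (by simpa using hω), hg0 s (by simp), hg0 0 (by simp)]
      simp
    · rw [AddCircle.liftIco_coe_apply (by simpa using ⟨hs.1, hlt⟩)]
      exact (Complex.coe_smul _ _).symm
  refine Lp.ext (EventuallyEq.trans ?_ (Lp.coeFn_zero _ _ _).symm)
  refine (ae_mu_iff hω).2 ?_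
  rw [ae_mu_iff hω] at hae
  have h3 : ∀ᵐ s ∂(volume.restrict (Icc 0 ω)), s ∈ Ioo 0 ω := by
    rw [← Measure.restrict_congr_set (Ioo_ae_eq_Icc (a := (0 : ℝ)) (b := ω) (μ := volume))]
    exact ae_restrict_mem measurableSet_Ioo
  filter_upwards [hae, h3] with s h h' using h h'

/-- If y is orthogonal to all exponentials, pairing it with the n-th exponential times its own
coefficient ŷ(n) gives ‖ŷ(n)‖² = 0, and uniqueness of Fourier coefficients yields completeness. -/
lemma isHilbertSum_expIsometry {ω : ℝ} (hω : 0 < ω) :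
    IsHilbertSum ℂ (fun _ : ℤ => H) fun n => expIsometry (H := H) hω n := by
  refine IsHilbertSum.mk (orthogonalFamily_expIsometry hω) (top_le_iff.2 ?_)
  rw [Submodule.topologicalClosure_eq_top_iff, eq_bot_iff]
  intro y hy
  rw [Submodule.mem_bot]
  refine eq_zero_of_fourierCoeffL2 hω fun n => ?_
  have h : inner ℂ (expVec ω n (fourierCoeffL2 ω H n y)) y = 0 :=
    (Submodule.mem_orthogonal _ _).1 hy _
      (Submodule.mem_iSup_of_mem n ⟨fourierCoeffL2 ω H n y, rfl⟩)
  rw [inner_expVec] at h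
  exact inner_self_eq_zero.1 h

/-- The Fourier transform `L²([0, ω], H) ≃ ℓ²(ℤ, H)`. -/
def fourierEquiv {ω : ℝ} (hω : 0 < ω) (H : Type*) [NormedAddCommGroup H] [InnerProductSpace ℂ H]
    [CompleteSpace H] : L2 ω H ≃ₗᵢ[ℂ] SeqL2 H :=
  (isHilbertSum_expIsometry (H := H) hω).linearIsometryEquiv

lemma fourierEquiv_symm_hasSum {ω : ℝ} (hω : 0 < ω) (x : SeqL2 H) :
    HasSum (fun n => expVec ω n (x n)) ((fourierEquiv hω H).symm x) :=
  (isHilbertSum_expIsometry (H := H) hω).hasSum_linearIsometryEquiv_symm x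

lemma fourierEquiv_apply {ω : ℝ} (hω : 0 < ω) (y : L2 ω H) (n : ℤ) :
    fourierEquiv hω H y n = fourierCoeffL2 ω H n y := by
  obtain ⟨x, rfl⟩ := (fourierEquiv hω H).symm.surjective y
  rw [LinearIsometryEquiv.apply_symm_apply]
  have h := (fourierCoeffL2 ω H n).hasSum (fourierEquiv_symm_hasSum hω x)
  simp only [fourierCoeffL2_expVec hω] at h
  have h2 : HasSum (fun m => if n = m then x m else 0) (x n) := by
    have := hasSum_ite_eq n (x n)
    refine this.congr_fun fun m => ?_
    split_ifs with h1 h2 h2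
    · rw [h1]
    · exact absurd h1.symm h2
    · exact absurd h2.symm h1
    · rfl
  exact h2.unique h

end Fourier

/-! ### Differentiation on the Fourier side -/

section Derivative

variable {H : Type*} [NormedAddCommGroup H] [InnerProductSpace ℂ H] [CompleteSpace H]

/-- The primitive `s ↦ ∫₀ˢ g`. -/
def primitive {ω : ℝ} (g : L2 ω H) (s : ℝ) : H := ∫ τ in (0 : ℝ)..s, g τ

lemma continuousOn_primitive {ω : ℝ} (hω : 0 < ω) (g : L2 ω H) :
    ContinuousOn (primitive g) (Icc 0 ω) := by
  have := intervalIntegral.continuousOn_primitive_interval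
    (f := g) (μ := volume) (a := 0) (b := ω) (by
      rw [uIcc_of_le hω.le]
      exact (intervalIntegrable_iff_integrableOn_Icc_of_le hω.le).1
        (intervalIntegrable_L2 hω g (right_mem_Icc.2 hω.le)))
  rwa [uIcc_of_le hω.le] at this

lemma memLp_primitive {ω : ℝ} (hω : 0 < ω) (g : L2 ω H) : MemLp (primitive g) 2 (mu ω) := by
  have hc := continuousOn_primitive hω g
  obtain ⟨C, hC⟩ := isCompact_Icc.exists_bound_of_continuousOn hc
  refine MemLp.of_bound ((hc.aestronglyMeasurable measurableSet_Icc).mono_ac (mu_ac ω)) C ?_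
  refine (ae_mu_iff hω).2 ?_
  filter_upwards [ae_restrict_mem measurableSet_Icc] with s hs using hC s hs

/-- The kernel form of the primitive, over a fixed measure, is what Fubini's theorem requires. -/
lemma primitive_eq {ω : ℝ} (hω : 0 < ω) (g : L2 ω H) {s : ℝ} (hs : s ∈ Icc 0 ω) :
    primitive g s = ω • ∫ τ, (if τ ≤ s then (1 : ℂ) else 0) • g τ ∂(mu ω) := by
  have e : Ioc 0 s = Ioc 0 ω ∩ Iic s := by
    ext τ
    simp only [mem_Ioc, mem_inter_iff, mem_Iic]
    exact ⟨fun h => ⟨⟨h.1, h.2.trans hs.2⟩, h.2⟩, fun h => ⟨h.1.1, h.2⟩⟩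
  rw [integral_mu hω, smul_smul, mul_inv_cancel₀ hω.ne', one_smul, primitive,
    intervalIntegral.integral_of_le hs.1, intervalIntegral.integral_of_le hω.le,
    e, ← setIntegral_indicator measurableSet_Iic]
  congr 1
  funext τ
  by_cases h : τ ≤ s <;> simp [indicator, h]

lemma primitive_end {ω : ℝ} (hω : 0 < ω) (g : L2 ω H) :
    primitive g ω = ω • fourierCoeffL2 ω H 0 g := by
  rw [fourierCoeffL2_apply, integral_mu hω, smul_smul, mul_inv_cancel₀ hω.ne', one_smul]
  simp [primitive, expNeg_zero]

lemma integral_expNeg_indicator {ω : ℝ} (hω : 0 < ω) {n : ℤ} (hn : n ≠ 0) {τ : ℝ}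
    (hτ : τ ∈ Icc 0 ω) : ω • ∫ s, expNeg ω n s * (if τ ≤ s then (1 : ℂ) else 0) ∂(mu ω)
      = (Complex.I * (2 * Real.pi / ω * n : ℝ))⁻¹ * (expNeg ω n τ - 1) := by
  have h : ∀ s, expNeg ω n s * (if τ ≤ s then (1 : ℂ) else 0)
      = (Ici τ).indicator (expNeg ω n) s := fun s => by
    by_cases h : τ ≤ s <;> simp [indicator, h]
  simp only [h]
  rw [mu, integral_smul_measure, ENNReal.toReal_ofReal (by positivity), smul_smul,
    mul_inv_cancel₀ hω.ne', one_smul, setIntegral_indicator measurableSet_Ici,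
    ← integral_expNeg_interval hω hn, intervalIntegral.integral_of_le hτ.2,
    ← integral_Icc_eq_integral_Ioc]
  congr 2
  ext s
  simp only [mem_inter_iff, mem_Icc, mem_Ici]
  constructor
  · rintro ⟨⟨-, h2⟩, h3⟩
    exact ⟨h3, h2⟩
  · rintro ⟨h1, h2⟩
    exact ⟨⟨hτ.1.trans h1, h2⟩, h1⟩

/-- Fourier coefficients of a primitive. -/
lemma integral_expNeg_primitive {ω : ℝ} (hω : 0 < ω) (g : L2 ω H) {n : ℤ} (hn : n ≠ 0) :
    (Complex.I * (2 * Real.pi / ω * n : ℝ)) • ∫ s, expNeg ω n s • primitive g s ∂(mu ω)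
      = fourierCoeffL2 ω H n g - fourierCoeffL2 ω H 0 g := by
  have hg : Integrable g (mu ω) := (Lp.memLp g).integrable (by norm_num)
  have hae : ∀ᵐ s ∂(mu ω), s ∈ Icc 0 ω := (ae_mu_iff hω).2 (ae_restrict_mem measurableSet_Icc)
  have h1 : ∫ s, expNeg ω n s • primitive g s ∂(mu ω)
      = ω • ∫ s, ∫ τ, (expNeg ω n s * (if τ ≤ s then (1 : ℂ) else 0)) • g τ ∂(mu ω) ∂(mu ω) := by
    rw [← integral_smul]
    refine integral_congr_ae ?_
    filter_upwards [hae] with s hs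
    rw [primitive_eq hω g hs, smul_comm, ← integral_smul]
    simp only [smul_smul]
  have hint : Integrable (Function.uncurry fun s τ =>
      (expNeg ω n s * (if τ ≤ s then (1 : ℂ) else 0)) • g τ) ((mu ω).prod (mu ω)) := by
    refine (hg.comp_snd (mu ω)).bdd_smul
      (φ := fun p : ℝ × ℝ => expNeg ω n p.1 * (if p.2 ≤ p.1 then (1 : ℂ) else 0)) 1 ?_ ?_
    · refine Measurable.aestronglyMeasurable ?_
      exact ((continuous_expNeg ω n).measurable.comp measurable_fst).mul
        (Measurable.ite (measurableSet_le measurable_snd measurable_fst) measurable_const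
          measurable_const)
    · refine Eventually.of_forall fun p => ?_
      rw [norm_mul, norm_expNeg, one_mul]
      split_ifs <;> simp
  -- After the interchange the inner integral of the exponential over [τ, ω] is (iκn)⁻¹(exp(−iκnτ) −
  -- 1), which produces the two Fourier coefficients of g.
  rw [h1, integral_integral_swap hint, ← integral_smul, ← integral_smul, fourierCoeffL2_apply,
    fourierCoeffL2_apply, ← integral_sub (integrable_expNeg_smul n (Lp.memLp g))
      (integrable_expNeg_smul 0 (Lp.memLp g))]
  refine integral_congr_ae ?_
  filter_upwards [hae] with τ hτ
  rw [integral_smul_const, ← smul_assoc ω, integral_expNeg_indicator hω hn hτ, smul_smul,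
    mul_inv_cancel_left₀ (freq_ne_zero hω hn), sub_smul, one_smul, expNeg_zero, one_smul]

/-- `L₀` is multiplication by `2πin/ω` on the Fourier side. -/
lemma mem_derivOp_graph_iff {ω : ℝ} (hω : 0 < ω) (y g : L2 ω H) :
    (y, g) ∈ (derivOp ω hω H).graph ↔
      IsFreqMul (2 * Real.pi / ω) (fourierEquiv hω H y) (fourierEquiv hω H g) := by
  rw [mem_derivOp_graph hω]
  simp only [IsFreqMul, fourierEquiv_apply]
  have hF := memLp_primitive hω g
  have hconst : ∀ (a : H) (n : ℤ), ∫ s, expNeg ω n s • (a + primitive g s) ∂(mu ω)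
      = (if n = 0 then a else 0) + ∫ s, expNeg ω n s • primitive g s ∂(mu ω) := fun a n => by
    simp only [smul_add]
    rw [integral_add (integrable_expNeg_smul n (memLp_const a)) (integrable_expNeg_smul n hF),
      integral_smul_const, integral_expNeg hω]
    split_ifs <;> simp
  constructor
  · rintro ⟨f, ⟨hyf, hf⟩, hper⟩ n
    -- The boundary condition says exactly that g has mean zero, which removes the zeroth
    -- coefficient in `integral_expNeg_primitive`.
    have h0 : fourierCoeffL2 ω H 0 g = 0 := by
      have h1 := hf ω (right_mem_Icc.2 hω.le)
      rw [← hper, left_eq_add] at h1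
      have h2 := primitive_end hω g
      rw [primitive, h1] at h2
      exact (smul_eq_zero.1 h2.symm).resolve_left hω.ne'
    rcases eq_or_ne n 0 with rfl | hn
    · rw [h0]
      simp
    · have h1 : fourierCoeffL2 ω H n y = ∫ s, expNeg ω n s • (f 0 + primitive g s) ∂(mu ω) := by
        rw [fourierCoeffL2_apply]
        refine integral_congr_ae ?_
        filter_upwards [hyf, (ae_mu_iff hω).2 (ae_restrict_mem measurableSet_Icc)] with s h2 h3
        rw [h2, hf s h3, primitive]
      rw [h1, hconst, if_neg hn, zero_add, integral_expNeg_primitive hω g hn, h0, sub_zero]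
  · intro h
    have h0 : fourierCoeffL2 ω H 0 g = 0 := by
      rw [h 0]
      simp
    -- The constant of integration is fixed by the zeroth coefficient of y; the others agree by
    -- hypothesis.
    set a := fourierCoeffL2 ω H 0 y - ∫ s, expNeg ω 0 s • primitive g s ∂(mu ω)
    have hfLp : MemLp (fun s => a + primitive g s) 2 (mu ω) := (memLp_const a).add hF
    refine ⟨fun s => a + primitive g s, ⟨?_, fun s hs => ?_⟩, ?_⟩
    · have h1 : y = hfLp.toLp := by
        rw [← sub_eq_zero]
        refine eq_zero_of_fourierCoeffL2 hω fun n => ?_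
        rw [map_sub, fourierCoeffL2_toLp, hconst, sub_eq_zero]
        rcases eq_or_ne n 0 with rfl | hn
        · rw [if_pos rfl, sub_add_cancel]
        · have h2 := integral_expNeg_primitive hω g hn
          rw [h0, sub_zero, h n] at h2
          rw [if_neg hn, zero_add]
          exact (smul_right_injective H (freq_ne_zero hω hn) h2).symm
      rw [h1]
      exact hfLp.coeFn_toLp
    · simp [primitive]
    · change a + primitive g 0 = a + primitive g ω
      rw [primitive_end hω, h0]
      simp [primitive]

end Derivative

/-! ### The potential on the Fourier side -/

section Potential

variable {H : Type*} [NormedAddCommGroup H] [InnerProductSpace ℂ H] [CompleteSpace H]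

/-- Sequences in the domain of `diag(iκn)` are absolutely summable. -/
lemma IsFreqMul.summable_norm {κ : ℝ} (hκ : κ ≠ 0) {x w : SeqL2 H} (hx : IsFreqMul κ x w) :
    Summable fun n => ‖x n‖ := by
  have h1 : Summable fun n : ℤ => ‖(|κ|⁻¹ * |(n : ℝ)|⁻¹ : ℝ)‖ ^ 2 := by
    simpa using summable_int_sq_inv κ
  have h2 : Summable fun n : ℤ => if n = 0 then ‖x 0‖ else 0 :=
    summable_of_hasFiniteSupport ((finite_singleton (0 : ℤ)).subset fun n hn => by
      by_contra h
      exact hn (if_neg h))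
  -- Cauchy–Schwarz applied to x(n) = w(n)/(iκn), with the index 0 treated separately.
  refine ((summable_mul_norm h1 (summable_norm_sq w)).add h2).of_nonneg_of_le
    (fun _ => norm_nonneg _) fun n => ?_
  rcases eq_or_ne n 0 with rfl | hn
  · rw [if_pos rfl]
    exact le_add_of_nonneg_left (by positivity)
  · have hn' : |(n : ℝ)| ≠ 0 := abs_ne_zero.2 (by exact_mod_cast hn)
    have e : ‖Complex.I * (κ * n : ℝ)‖ = |κ| * |(n : ℝ)| := by
      rw [norm_mul, Complex.norm_I, one_mul, Complex.norm_real, Real.norm_eq_abs, abs_mul]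
    rw [if_neg hn, add_zero, hx n, norm_smul, e, Real.norm_of_nonneg (by positivity)]
    refine le_of_eq ?_
    have := abs_ne_zero.2 hκ
    field_simp

lemma tsum_enorm_ne_top {α ι : Type*} {m : MeasurableSpace α} {μ : Measure α}
    {f : ι → Lp H 2 μ} (hf : Summable fun i => ‖f i‖) : ∑' i, ‖f i‖ₑ ≠ ⊤ := by
  have h : Summable fun i => ‖f i‖₊ := by
    rw [← NNReal.summable_coe]
    simpa using hf
  exact ENNReal.tsum_coe_ne_top_iff_summable.2 h

/-- For `y ∈ D(L₀)`, `V y` belongs to `L²` and has the expected Fourier coefficients. -/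
lemma exists_potential_apply {ω : ℝ} (hω : 0 < ω) {𝓥 : ℝ → H →L[ℂ] H} (h𝓥 : StronglyL2 ω 𝓥)
    {y : L2 ω H} (hy : Summable fun n => ‖fourierEquiv hω H y n‖) :
    ∃ h : L2 ω H, (fun s => 𝓥 s (y (ω - s))) =ᵐ[mu ω] h ∧
      ∀ n, fourierEquiv hω H h n
        = ∑' l, fourierCoeffOp h𝓥 (n + l) (fourierEquiv hω H y l) := by
  set x := fourierEquiv hω H y
  have hys : HasSum (fun n => expVec ω n (x n)) y := by
    have := fourierEquiv_symm_hasSum hω x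
    rwa [LinearIsometryEquiv.symm_apply_apply] at this
  have hnorm : ∀ n, ‖expVec ω n (x n)‖ = ‖x n‖ := fun n => (expIsometry hω n).norm_map (x n)
  have hypt := Lp.hasSum_coeFn_tsum (f := fun n => expVec ω n (x n))
    (tsum_enorm_ne_top (by simpa only [hnorm] using hy))
  rw [hys.tsum_eq] at hypt
  let O : H →L[ℂ] L2 ω H := ⟨orbitMap h𝓥, orbitMap_continuous h𝓥⟩
  have hO : ∀ a, (O a : ℝ → H) =ᵐ[mu ω] fun s => 𝓥 s a := fun a => (h𝓥 a).coeFn_toLp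
  -- Under s ↦ ω − s the exponential of index l becomes that of index −l, so V maps the l-th term of
  -- y to exp(−iκls) 𝓥(s) x(l). Multiplied by exp(−iκns), it integrates to the Hankel entry of index
  -- n + l.
  set k : ℤ → L2 ω H := fun l => (memLp_expNeg_smul l (Lp.memLp (O (x l)))).toLp
  have hk : ∀ l, (k l : ℝ → H) =ᵐ[mu ω] fun s => expNeg ω l s • 𝓥 s (x l) := fun l => by
    filter_upwards [(memLp_expNeg_smul l (Lp.memLp (O (x l)))).coeFn_toLp, hO (x l)] with s h1 h2
    rw [h1, h2]
  -- The closed graph theorem has made x ↦ 𝓥(·)x bounded. Absolute summability of x then gives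
  -- convergence of the series both in L² and almost everywhere, which identifies its sum with Vy.
  have hkn : ∀ l, ‖k l‖ ≤ ‖O‖ * ‖x l‖ := fun l => by
    refine le_trans ?_ (O.le_opNorm _)
    refine Lp.norm_le_norm_of_ae_le ?_
    filter_upwards [(memLp_expNeg_smul l (Lp.memLp (O (x l)))).coeFn_toLp] with s h1
    rw [h1, norm_smul, norm_expNeg, one_mul]
  have hks : Summable fun l => ‖k l‖ :=
    (hy.mul_left ‖O‖).of_nonneg_of_le (fun _ => norm_nonneg _) hkn
  have hkpt := Lp.hasSum_coeFn_tsum (tsum_enorm_ne_top hks)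
  refine ⟨∑' l, k l, ?_, fun n => ?_⟩
  · have h1 : ∀ᵐ s ∂(mu ω), ∀ l, (expVec ω l (x l) : ℝ → H) s = expNeg ω (-l) s • x l :=
      ae_all_iff.2 fun l => coeFn_expVec ω l (x l)
    have h2 : ∀ᵐ s ∂(mu ω), ∀ l, (k l : ℝ → H) s = expNeg ω l s • 𝓥 s (x l) :=
      ae_all_iff.2 hk
    filter_upwards [(quasi_reflect ω).ae (hypt.and h1), hkpt, h2] with s hs h3 h4
    have h5 := (𝓥 s).hasSum hs.1
    refine h5.unique (h3.congr_fun fun l => ?_)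
    rw [h4 l, hs.2 l, map_smul]
    congr 1
    rw [expNeg, expNeg, ← mul_one (Complex.exp (-(2 * Real.pi * l * s / ω : ℝ) * Complex.I)),
      ← Complex.exp_int_mul_two_pi_mul_I l, ← Complex.exp_add]
    congr 1
    have : (ω : ℂ) ≠ 0 := by exact_mod_cast hω.ne'
    push_cast
    field_simp
    ring
  · rw [fourierEquiv_apply, (fourierCoeffL2 ω H n).map_tsum hks.of_norm]
    refine tsum_congr fun l => ?_
    rw [fourierCoeffL2_toLp]
    change _ = ∫ s, expNeg ω (n + l) s • (O (x l) : ℝ → H) s ∂(mu ω)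
    simp only [smul_smul, expNeg_add]

lemma derivOp_domain_le {ω : ℝ} (hω : 0 < ω) {𝓥 : ℝ → H →L[ℂ] H} (h𝓥 : StronglyL2 ω 𝓥) :
    (derivOp ω hω H).domain ≤ (potentialOp ω 𝓥).domain := by
  intro y hy
  have h1 := (mem_derivOp_graph_iff hω y _).1 ((derivOp ω hω H).mem_graph ⟨y, hy⟩)
  obtain ⟨h, hh, -⟩ := exists_potential_apply hω h𝓥
    (h1.summable_norm (div_ne_zero (by positivity) hω.ne'))
  exact (memLp_congr_ae hh).2 (Lp.memLp h)

/-- The operator `L` on the Fourier side. -/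
lemma mem_mixedOp_graph_iff {ω : ℝ} (hω : 0 < ω) {𝓥 : ℝ → H →L[ℂ] H} (h𝓥 : StronglyL2 ω 𝓥)
    (y z : L2 ω H) : (y, z) ∈ (mixedOp ω hω 𝓥).graph ↔
      IsHankelPair (2 * Real.pi / ω) (fourierCoeffOp h𝓥) (fourierEquiv hω H y)
        (fourierEquiv hω H z) := by
  have hκ : 2 * Real.pi / ω ≠ 0 := div_ne_zero (by positivity) hω.ne'
  have hpot : ∀ (hy : y ∈ (potentialOp ω 𝓥).domain),
      Summable (fun n => ‖fourierEquiv hω H y n‖) → ∀ n,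
      fourierEquiv hω H (potentialOp ω 𝓥 ⟨y, hy⟩) n
        = ∑' l, fourierCoeffOp h𝓥 (n + l) (fourierEquiv hω H y l) := fun hy hs n => by
    obtain ⟨h, hh, hn⟩ := exists_potential_apply hω h𝓥 hs
    have e : potentialOp ω 𝓥 ⟨y, hy⟩ = h := Lp.ext ((MemLp.coeFn_toLp
      (show MemLp (fun s => 𝓥 s (y (ω - s))) 2 (mu ω) from hy)).trans hh)
    rw [e, hn]
  constructor
  · intro h
    obtain ⟨u, hu1, hu2⟩ := (LinearPMap.mem_graph_iff _).1 h
    obtain ⟨u, hu⟩ := u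
    simp only at hu1 hu2
    subst hu1
    have hg := (mem_derivOp_graph_iff hω u _).1 ((derivOp ω hω H).mem_graph ⟨u, hu.1⟩)
    refine ⟨_, hg, fun n => ?_⟩
    rw [← hpot hu.2 (hg.summable_norm hκ), ← hu2]
    change fourierEquiv hω H (derivOp ω hω H ⟨u, hu.1⟩ - potentialOp ω 𝓥 ⟨u, hu.2⟩) n = _
    rw [map_sub]
    rfl
  · rintro ⟨w, hw, hz⟩
    have hg : (y, (fourierEquiv hω H).symm w) ∈ (derivOp ω hω H).graph := by
      rw [mem_derivOp_graph_iff, LinearIsometryEquiv.apply_symm_apply]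
      exact hw
    obtain ⟨u, hu1, hu2⟩ := (LinearPMap.mem_graph_iff _).1 hg
    obtain ⟨u, hu⟩ := u
    simp only at hu1 hu2
    subst hu1
    have hp := derivOp_domain_le hω h𝓥 hu
    refine (LinearPMap.mem_graph_iff _).2 ⟨⟨u, hu, hp⟩, rfl, ?_⟩
    change derivOp ω hω H ⟨u, hu⟩ - potentialOp ω 𝓥 ⟨u, hp⟩ = z
    apply (fourierEquiv hω H).injective
    refine lp.ext <| funext fun n => ?_
    rw [hz n, ← hpot hp (hw.summable_norm hκ), hu2, map_sub,
      LinearIsometryEquiv.apply_symm_apply]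
    rfl

end Potential

end MixedProblem
end

theorem theorem2p10 {H : Type*} [NormedAddCommGroup H] [InnerProductSpace ℂ H] [CompleteSpace H]
    (ω : ℝ) (hω : 0 < ω) (𝓥 : ℝ → H →L[ℂ] H) (h𝓥 : MixedProblem.StronglyL2 ω 𝓥)
    (h_sq : Summable fun n : ℤ => ‖MixedProblem.fourierCoeffOp h𝓥 n‖ ^ 2)
    (h_double : Summable fun p : ℤ × ℤ =>
      ‖∑' n : ℤ, if n = p.2 then (0 : H →L[ℂ] H) else
        (1 / ((p.2 : ℂ) - (n : ℂ))) •
          (MixedProblem.fourierCoeffOp h𝓥 (p.1 + n) *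
            MixedProblem.fourierCoeffOp h𝓥 (p.2 + n))‖ ^ 2) :
    (MixedProblem.derivOp ω hω H).domain ≤ (MixedProblem.potentialOp ω 𝓥).domain ∧
    (∃! T : ℝ → MixedProblem.L2 ω H →L[ℂ] MixedProblem.L2 ω H,
      MixedProblem.IsC0Group T ∧
        MixedProblem.IsGenerator T (MixedProblem.mixedOp ω hω 𝓥)) ∧
    ∀ T : ℝ → MixedProblem.L2 ω H →L[ℂ] MixedProblem.L2 ω H,
      MixedProblem.IsC0Group T →
      MixedProblem.IsGenerator T (MixedProblem.mixedOp ω hω 𝓥) →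
      MixedProblem.spectralBound (MixedProblem.mixedOp ω hω 𝓥) = MixedProblem.growthBound T ∧
      MixedProblem.spectralBound (-MixedProblem.mixedOp ω hω 𝓥) =
        MixedProblem.growthBound (fun t => T (-t)) := by
  have hκ : 2 * Real.pi / ω ≠ 0 := div_ne_zero (by positivity) hω.ne'
  obtain ⟨U, m, c, hc, h⟩ := MixedProblem.exists_hankel_model hκ h_sq h_double
  refine ⟨MixedProblem.derivOp_domain_le hω h𝓥, ?_⟩
  -- The similarity is the Fourier transform followed by the isomorphism of ℓ²(ℤ, H) that carries
  -- the Hankel perturbation to a model operator.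
  refine MixedProblem.IsModeledBy.generation (Ψ := (MixedProblem.fourierEquiv hω
    H).toContinuousLinearEquiv.trans U) (m := m) (c := c) hκ (fun y z => ?_) hc
  rw [MixedProblem.mem_mixedOp_graph_iff hω h𝓥, h]
  rfl
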